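/- Let $d\in\mathbb N_0$ and let $\varpi\in C^\infty(\mathbb R^d;\mathbb R)$ satisfy $\varpi\ge\mu$ for some constant $\mu>0$. Let $\mathscr D=C_c^\infty(\mathbb R^d;\mathbb C)$, let $\mathscr D'$ be the space of complex distributions on $\mathbb R^d$, let $\langle f,g\rangle_2$ be the $L^2$ inner product (antilinear in $f$), and put $\langle f,T\rangle_2=T(\bar f)$ for $f\in\mathscr D$, $T\in\mathscr D'$. Smooth functions of $\varpi$ act on $\mathscr D$ by multiplication and on $\mathscr D'$ by transposition. Let $\mathbb W$ be the C*-algebra of canonical commutation relations over $(\mathscr D,\Im\langle\cdot,\cdot\rangle_2)$, generated by nonzero elements $W(f)$, $f\in\mathscr D$, with $W(f)^*=W(-f)$ and $W(f)W(g)=e^{-i\pi^2\Im\langle f,g\rangle_2}W(f+g)$. Let $\mathcal F=\bigoplus_{n\ge0}L^2((\mathbb R^d)^n)_{\mathrm s}$ be the symmetric Fock space, $\Omega=(1,0,0,\dots)$, let $\mathrm d\Gamma(\varpi)$ be the second quantization of $\varpi$ (multiplication by $\sum_{i=1}^n\varpi(x_i)$ on the $n$-particle sector, with maximal domain), and for $h\in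 L^2(\mathbb R^d)$ let $\epsilon(h)=\sum_n h^{\otimes n}/\sqrt{n!}\in\mathcal F$. Let $v\in\mathscr D'$. Then there are unique objects as follows: (a) a one-parameter group $(\tau_t)_{t\in\mathbb R}$ of *-automorphisms of $\mathbb W$ (the van Hove--Miyatake dynamics with source $v$) with $$\tau_t(W(f))=e^{2\pi i\,\mathrm{Re}\langle f,(e^{-it\varpi}-1)v/\varpi\rangle_2}\,W(e^{it\varpi}f);$$ (b) a *-representation $\pi_{\mathrm F}$ of $\mathbb W$ on $\mathcal F$ (the Fock representation, $\pi_{\mathrm F}(W(f))=e^{i\pi(a(f)+a^*(f))}$) with $$\pi_{\mathrm F}(W(f))\epsilon(h)=e^{-\frac{\pi^2}2\|f\|_2^2+i\pi\langle f,h\rangle_2}\,\epsilon(h+i\pi f);$$ (c) a state $\omega_\infty$ on $\mathbb W$ with $\omega_\infty(W(f))=e^{-\frac{\pi^2}2\|f\|_2^2}e^{2\pi i\,\mathrm{Re}\langle f,-v/\varpi\rangle_2}$. Let $\omega_{\mathrm F}(a)=\langle\Omega,\pi_{\mathrm F}(a)\Omega\rangle$ be the Fock vacuum state, and let $(\mathscr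 H,\pi,\Omega_{\omega_\infty})$ be the GNS representation of $\omega_\infty$. (1) There is a unique self-adjoint operator $\hat H_{\omega_\infty}$ on $\mathscr H$ (the dressed renormalized Hamiltonian) with $\pi(\tau_t(a))=e^{it\hat H_{\omega_\infty}}\pi(a)e^{-it\hat H_{\omega_\infty}}$ for all $a\in\mathbb W$, $t\in\mathbb R$, and $\hat H_{\omega_\infty}\Omega_{\omega_\infty}=0$. There is a unitary $V:\mathscr H\to\mathcal F$ with $V\Omega_{\omega_\infty}=\Omega$, $V\pi(W(f))V^*=e^{2\pi i\,\mathrm{Re}\langle f,-v/\varpi\rangle_2}\pi_{\mathrm F}(W(f))$ for all $f\in\mathscr D$, and $$V\hat H_{\omega_\infty}V^*=\mathrm d\Gamma(\varpi).$$ (2) The undressed van Hove Hamiltonian exists, i.e. there is a self-adjoint operator $H$ on $\mathcal F$ with $\pi_{\mathrm F}(\tau_t(a))=e^{itH}\pi_{\mathrm F}(a)e^{-itH}$ for all $a\in\mathbb W$, $t\in\mathbb R$, if and only if $v/\varpi\in L^2(\mathbb R^d)$. If $v/\varpi=g\in L^2(\mathbb R^d)$, then $H=D\,\mathrm d\Gamma(\varpi)D^*$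 is such an operator, where $D=e^{a(g)-a^*(g)}$ is the unitary with $D\epsilon(h)=e^{-\frac12\|g\|_2^2+\langle g,h\rangle_2}\epsilon(h-g)$ for $h\in L^2(\mathbb R^d)$. (3) $v/\varpi\in L^2(\mathbb R^d)$ if and only if $\omega_\infty$ is normal with respect to $\omega_{\mathrm F}$, i.e. there are vectors $\psi_n$ in the GNS space of $\omega_{\mathrm F}$ with $\sum_n\|\psi_n\|^2<\infty$ and $\omega_\infty(a)=\sum_n\langle\psi_n,\pi_{\omega_{\mathrm F}}(a)\psi_n\rangle$ for all $a\in\mathbb W$. -/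

import Mathlib

open MeasureTheory Complex TopologicalSpace
open scoped ENNReal ContDiff Distributions ComplexConjugate ComplexOrder

noncomputable section

namespace VanHove

/-! ### One-particle space, test functions, distributions -/

/-- Momentum space `ℝ^d`. -/
abbrev E (d : ℕ) := EuclideanSpace ℝ (Fin d)

/-- The space `𝒟(ℝ^d)` of complex-valued smooth compactly supported functions. -/
abbrev Test (d : ℕ) := 𝓓((⊤ : Opens (E d)), ℂ)

/-- The space `𝒟'(ℝ^d)` of complex distributions: continuous complex-linear forms on `𝒟`. -/
abbrev Dist (d : ℕ) := Test d →L[ℂ] ℂ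

/-- The one-particle space `L²(ℝ^d)`. -/
abbrev L2 (d : ℕ) := Lp ℂ 2 (volume : Measure (E d))

theorem Test.memLp {d : ℕ} (f : Test d) : MemLp (fun k => f k) 2 (volume : Measure (E d)) :=
  f.continuous.memLp_of_hasCompactSupport f.hasCompactSupport

/-- The inclusion `𝒟 ⊆ L²`. -/
def toL2 {d : ℕ} : Test d →ₗ[ℂ] L2 d where
  toFun f := f.memLp.toLp
  map_add' _ _ := rfl
  map_smul' _ _ := rfl

/-- The product `m · f` of a smooth function `m` and a test function `f`. -/
def mulTest {d : ℕ} (m : E d → ℂ) (hm : ContDiff ℝ ∞ m) (f : Test d) : Test d where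
  toFun k := m k * f k
  contDiff' := hm.mul f.contDiff
  hasCompactSupport' := f.hasCompactSupport.mul_left
  tsupport_subset' := by simp

/-- The complex conjugate of a test function. -/
def conjTest {d : ℕ} (f : Test d) : Test d where
  toFun k := conj (f k)
  contDiff' := Complex.conjCLE.contDiff.comp f.contDiff
  hasCompactSupport' := f.hasCompactSupport.comp_left (g := fun z : ℂ => conj z) (by simp)
  tsupport_subset' := by simp

/-- The product `m · T` of a smooth function and a linear form on `𝒟`, by transposition:
`(m · T)(f) = T(m · f)`. -/
def mulDist {d : ℕ} (m : E d → ℂ) (hm : ContDiff ℝ ∞ m) (T : Test d →ₗ[ℂ] ℂ) :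
    Test d →ₗ[ℂ] ℂ where
  toFun f := T (mulTest m hm f)
  map_add' f g := by
    rw [← map_add]; congr 1; ext k; simp [mulTest, mul_add]
  map_smul' c f := by
    rw [RingHom.id_apply, ← map_smul]; congr 1; ext k; simp [mulTest]; ring

/-- The duality bracket `⟨f, T⟩₂ = T(f̄)`, antilinear in `f` and linear in `T`. -/
def bracket {d : ℕ} (f : Test d) (T : Test d →ₗ[ℂ] ℂ) : ℂ := T (conjTest f)

/-- The linear form `T` on `𝒟` is (integration against) the `L²` function `g`. -/
def IsRepresentedBy {d : ℕ} (T : Test d →ₗ[ℂ] ℂ) (g : L2 d) : Prop :=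
  ∀ f : Test d, T f = ∫ k, g k * f k

/-- `T ∈ L²`. -/
def MemL2 {d : ℕ} (T : Test d →ₗ[ℂ] ℂ) : Prop := ∃ g : L2 d, IsRepresentedBy T g

/-! ### The boson dispersion relation -/

/-- A massive boson dispersion relation `ϖ ≥ μ > 0` that acts by multiplication on `𝒟` (hence,
by transposition, on `𝒟'`), i.e. a smooth one. -/
structure Dispersion (d : ℕ) where
  toFun : E d → ℝ
  smooth : ContDiff ℝ ∞ toFun
  massive : ∃ μ : ℝ, 0 < μ ∧ ∀ k, μ ≤ toFun k

namespace Dispersion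

variable {d : ℕ} (w : Dispersion d)

theorem pos (k : E d) : 0 < w.toFun k := by
  obtain ⟨μ, hμ, h⟩ := w.massive
  exact hμ.trans_le (h k)

theorem contDiff_ofReal : ContDiff ℝ ∞ (fun k => (w.toFun k : ℂ)) :=
  Complex.ofRealCLM.contDiff.comp w.smooth

/-- The function `e^{itϖ}`. -/
def phase (t : ℝ) (k : E d) : ℂ := Complex.exp (I * t * w.toFun k)

theorem phase_smooth (t : ℝ) : ContDiff ℝ ∞ (w.phase t) :=
  (contDiff_const.mul w.contDiff_ofReal).cexp

theorem inv_smooth : ContDiff ℝ ∞ (fun k => ((w.toFun k : ℂ))⁻¹) :=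
  w.contDiff_ofReal.inv fun k => by exact_mod_cast (w.pos k).ne'

/-- `v/ϖ`. -/
def quot (v : Dist d) : Test d →ₗ[ℂ] ℂ := mulDist _ w.inv_smooth v.toLinearMap

/-- `(e^{-itϖ} - 1) v/ϖ`. -/
def drift (t : ℝ) (v : Dist d) : Test d →ₗ[ℂ] ℂ :=
  mulDist (fun k => w.phase (-t) k - 1) ((w.phase_smooth (-t)).sub contDiff_const) (w.quot v)

end Dispersion

/-! ### The C*-algebra of canonical commutation relations -/

/-- The symplectic form `Im ⟨f, g⟩₂` on `𝒟`. -/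
def symp {d : ℕ} (f g : Test d) : ℝ := (inner ℂ (toL2 f) (toL2 g)).im

/-- `ℓ²(𝒟)`, with `𝒟` as a discrete set. -/
abbrev Ell2 (d : ℕ) := lp (fun _ : Test d => ℂ) 2

/-- The unimodular number `e^{-iπ² Im⟨f, g⟩}`. -/
def weylPhase {d : ℕ} (f g : Test d) : ℂ := Complex.exp (-(I * (Real.pi ^ 2 * symp f g : ℝ)))

theorem norm_weylPhase {d : ℕ} (f g : Test d) : ‖weylPhase f g‖ = 1 := by
  rw [weylPhase, Complex.norm_exp]
  simp only [Complex.neg_re, Complex.I_mul_re, Complex.ofReal_im, neg_zero, Real.exp_zero]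

/-- The twisted translation `(W(f)ψ)(h) = e^{-iπ² Im⟨f, h⟩} ψ(h - f)` on `ℓ²(𝒟)`; on the
canonical basis, `W(f) δ_h = e^{-iπ² Im⟨f, h⟩} δ_{f + h}`. -/
def twist {d : ℕ} (f : Test d) : Ell2 d →ₗᵢ[ℂ] Ell2 d where
  toFun ψ := ⟨fun h => weylPhase f h * ψ (h - f), by
    have h1 := (lp.memℓp ψ).summable (by norm_num)
    refine memℓp_gen ?_
    simp only [norm_mul, norm_weylPhase, one_mul]
    exact (Equiv.subRight f).summable_iff.mpr h1⟩
  map_add' ψ φ := by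
    ext h
    exact mul_add (weylPhase f h) (ψ (h - f)) (φ (h - f))
  map_smul' c ψ := by
    ext h
    exact mul_left_comm (weylPhase f h) c (ψ (h - f))
  norm_map' ψ := by
    rw [lp.norm_eq_tsum_rpow (by norm_num), lp.norm_eq_tsum_rpow (by norm_num)]
    congr 1
    simp only [LinearMap.coe_mk, AddHom.coe_mk, norm_mul, norm_weylPhase, one_mul]
    exact (Equiv.subRight f).tsum_eq (fun h => ‖ψ h‖ ^ (2 : ℝ≥0∞).toReal)

/-- The C*-algebra `𝕎(𝒟, Im⟨·,·⟩₂)` generated by the Weyl operators, realised on `ℓ²(𝒟)`. As the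
symplectic form is nondegenerate, it is up to isomorphism the only C*-algebra generated by nonzero
elements `W(f)` that satisfy the Weyl relations. -/
def ccrSubalgebra (d : ℕ) : StarSubalgebra ℂ (Ell2 d →L[ℂ] Ell2 d) :=
  (StarAlgebra.adjoin ℂ
    (Set.range fun f : Test d => (twist f).toContinuousLinearMap)).topologicalClosure

instance (d : ℕ) : IsClosed (ccrSubalgebra d : Set (Ell2 d →L[ℂ] Ell2 d)) :=
  StarSubalgebra.isClosed_topologicalClosure _

/-- `𝕎(𝒟, Im⟨·,·⟩₂)` as a type. -/
def CCR (d : ℕ) : Type := ccrSubalgebra d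

instance (d : ℕ) : CStarAlgebra (CCR d) := inferInstanceAs (CStarAlgebra (ccrSubalgebra d))

instance (d : ℕ) : PartialOrder (CCR d) := CStarAlgebra.spectralOrder _

instance (d : ℕ) : StarOrderedRing (CCR d) := CStarAlgebra.spectralOrderedRing _

/-- The Weyl operator `W(f) ∈ 𝕎`. -/
def weyl {d : ℕ} (f : Test d) : CCR d :=
  ⟨(twist f).toContinuousLinearMap,
    StarSubalgebra.le_topologicalClosure _ (StarAlgebra.subset_adjoin ℂ _ ⟨f, rfl⟩)⟩

/-- The Weyl relation `W(f) W(g) = e^{-iπ² Im⟨f, g⟩} W(f + g)`. -/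
theorem weyl_mul {d : ℕ} (f g : Test d) : weyl f * weyl g = weylPhase f g • weyl (f + g) := by
  apply Subtype.ext
  ext ψ h
  change weylPhase f h * (weylPhase g (h - f) * ψ (h - f - g)) =
    weylPhase f g * (weylPhase (f + g) h * ψ (h - (f + g)))
  have hs : symp g f = - symp f g := by
    rw [symp, symp, ← inner_conj_symm, Complex.conj_im]
  have key : weylPhase f h * weylPhase g (h - f) = weylPhase f g * weylPhase (f + g) h := by
    simp only [weylPhase, ← Complex.exp_add]
    congr 1
    have h1 : symp g (h - f) = symp g h + symp f g := by
      rw [← neg_neg (symp f g), ← hs]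
      rw [symp, symp, symp, map_sub, inner_sub_right, Complex.sub_im, sub_eq_add_neg]
    have h2 : symp (f + g) h = symp f h + symp g h := by
      rw [symp, symp, symp, map_add, inner_add_left, Complex.add_im]
    rw [h1, h2]
    push_cast
    ring
  rw [← mul_assoc, key, mul_assoc, sub_sub]

theorem weyl_zero (d : ℕ) : weyl (0 : Test d) = 1 := by
  apply Subtype.ext
  ext ψ h
  change weylPhase 0 h * ψ (h - 0) = ψ h
  rw [sub_zero, weylPhase, symp, map_zero, inner_zero_left]
  simp

/-- The Weyl relation `W(f)* = W(-f)`. -/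
theorem star_weyl {d : ℕ} (f : Test d) : star (weyl f) = weyl (-f) := by
  have h1 : star (weyl f) * weyl f = 1 := by
    apply Subtype.ext
    change ContinuousLinearMap.adjoint (twist f).toContinuousLinearMap ∘L
      (twist f).toContinuousLinearMap = 1
    exact (ContinuousLinearMap.norm_map_iff_adjoint_comp_self _).mp (twist f).norm_map
  have h2 : weyl f * weyl (-f) = 1 := by
    have hs : symp f (-f) = 0 := by
      rw [symp, map_neg, inner_neg_right, Complex.neg_im, neg_eq_zero]
      exact inner_self_im (𝕜 := ℂ) (toL2 f)
    rw [weyl_mul, weylPhase, hs, add_neg_cancel, weyl_zero]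
    simp
  calc star (weyl f) = star (weyl f) * (weyl f * weyl (-f)) := by rw [h2, mul_one]
    _ = weyl (-f) := by rw [← mul_assoc, h1, one_mul]

/-! ### Fock space -/

/-- `L²((ℝ^d)^n)`. -/
abbrev L2n (d n : ℕ) := Lp ℂ 2 (volume : Measure (Fin n → E d))

theorem measurePreserving_perm (d n : ℕ) (σ : Equiv.Perm (Fin n)) :
    MeasurePreserving (fun x : Fin n → E d => x ∘ σ) volume volume := by
  have h := volume_measurePreserving_piCongrLeft (fun _ : Fin n => E d) σ.symm
  convert h using 1
  funext x i
  have := Equiv.piCongrLeft_apply_apply (fun _ : Fin n => E d) σ.symm x (σ i)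
  rw [Equiv.symm_apply_apply] at this
  exact this.symm

/-- `L²((ℝ^d)^n)_s`: the square-integrable functions of `n` variables in `ℝ^d` that are symmetric
under permutations of the variables. -/
def symL2 (d n : ℕ) : Submodule ℂ (L2n d n) where
  carrier := {ψ | ∀ σ : Equiv.Perm (Fin n),
    Lp.compMeasurePreservingₗᵢ ℂ _ (measurePreserving_perm d n σ) ψ = ψ}
  zero_mem' σ := by simp
  add_mem' h1 h2 σ := by rw [map_add, h1 σ, h2 σ]
  smul_mem' c ψ h σ := by rw [map_smul, h σ]

theorem isClosed_symL2 (d n : ℕ) : IsClosed (symL2 d n : Set (L2n d n)) := by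
  have : (symL2 d n : Set (L2n d n)) = ⋂ σ : Equiv.Perm (Fin n),
      {ψ | Lp.compMeasurePreservingₗᵢ ℂ _ (measurePreserving_perm d n σ) ψ = ψ} := by
    ext ψ; simp [symL2]
  rw [this]
  exact isClosed_iInter fun σ => isClosed_eq (LinearIsometry.continuous _) continuous_id

instance (d n : ℕ) : CompleteSpace (symL2 d n) := (isClosed_symL2 d n).completeSpace_coe

/-- The symmetric Fock space `⨁_n L²((ℝ^d)^n)_s` (Hilbert space direct sum). -/
def Fock (d : ℕ) : Type := lp (fun n : ℕ => symL2 d n) 2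

instance (d : ℕ) : NormedAddCommGroup (Fock d) :=
  inferInstanceAs (NormedAddCommGroup (lp (fun n : ℕ => symL2 d n) 2))

instance (d : ℕ) : InnerProductSpace ℂ (Fock d) :=
  inferInstanceAs (InnerProductSpace ℂ (lp (fun n : ℕ => symL2 d n) 2))

instance (d : ℕ) : CompleteSpace (Fock d) :=
  inferInstanceAs (CompleteSpace (lp (fun n : ℕ => symL2 d n) 2))

/-- The Fock space vector with a given square-summable sequence of components. -/
def Fock.mk {d : ℕ} (ψ : lp (fun n : ℕ => symL2 d n) 2) : Fock d := ψ

/-- The components of a Fock space vector. -/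
def Fock.toLp {d : ℕ} (ψ : Fock d) : lp (fun n : ℕ => symL2 d n) 2 := ψ

/-- The `n`-particle component of a Fock space vector, as an element of `L²((ℝ^d)^n)`. -/
def comp {d : ℕ} (n : ℕ) : Fock d →ₗ[ℂ] L2n d n where
  toFun ψ := ((ψ.toLp n : symL2 d n) : L2n d n)
  map_add' _ _ := rfl
  map_smul' _ _ := rfl

theorem comp_ext {d : ℕ} {ψ φ : Fock d} (h : ∀ n, comp n ψ = comp n φ) : ψ = φ :=
  lp.ext (funext fun n => Subtype.ext (h n))

theorem memLp_tensorPow {d : ℕ} (h : L2 d) (n : ℕ) :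
    MemLp (fun x : Fin n → E d => ∏ i, h (x i)) 2 volume := by
  have hm : AEStronglyMeasurable (fun x : Fin n → E d => ∏ i, h (x i)) volume := by
    refine (Finset.aestronglyMeasurable_fun_prod _ fun i _ => ?_)
    exact (Lp.aestronglyMeasurable h).comp_quasiMeasurePreserving
      (Measure.quasiMeasurePreserving_eval (fun _ => volume) i)
  rw [memLp_two_iff_integrable_sq_norm hm]
  have h2 : Integrable (fun x => ‖h x‖ ^ 2) (volume : Measure (E d)) :=
    (memLp_two_iff_integrable_sq_norm (Lp.aestronglyMeasurable h)).mp (Lp.memLp h)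
  have := Integrable.fintype_prod (ι := Fin n) (fun _ => h2)
  simp only [norm_prod, ← Finset.prod_pow]
  exact this

/-- The tensor power `h^{⊗n}`, i.e. the function `(x₁, …, x_n) ↦ h(x₁) ⋯ h(x_n)`. -/
def tensorPow {d : ℕ} (h : L2 d) (n : ℕ) : symL2 d n :=
  ⟨(memLp_tensorPow h n).toLp, fun σ => by
    apply Lp.ext
    change (Lp.compMeasurePreserving _ (measurePreserving_perm d n σ) _ : L2n d n) =ᵐ[volume] _
    refine (Lp.coeFn_compMeasurePreserving _ (measurePreserving_perm d n σ)).trans ?_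
    refine ((measurePreserving_perm d n σ).quasiMeasurePreserving.ae_eq_comp
      (memLp_tensorPow h n).coeFn_toLp).trans ?_
    refine Filter.EventuallyEq.trans ?_ (memLp_tensorPow h n).coeFn_toLp.symm
    refine Filter.Eventually.of_forall fun x => ?_
    exact Equiv.prod_comp σ (fun i => h (x i))⟩

theorem norm_tensorPow {d : ℕ} (h : L2 d) (n : ℕ) : ‖tensorPow h n‖ = ‖h‖ ^ n := by
  have key : ∀ {X : Type} [MeasurableSpace X] (μ : Measure X) (f : X → ℂ) (hf : MemLp f 2 μ),
      ‖hf.toLp‖ ^ 2 = ∫ x, ‖f x‖ ^ 2 ∂μ := by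
    intro X _ μ f hf
    have h2 : (inner ℂ hf.toLp hf.toLp : ℂ) = ((∫ x, ‖f x‖ ^ 2 ∂μ : ℝ) : ℂ) := by
      rw [L2.inner_def]
      refine Eq.trans (integral_congr_ae ?_) (integral_ofReal (𝕜 := ℂ))
      filter_upwards [hf.coeFn_toLp] with x hx
      rw [hx, inner_self_eq_norm_sq_to_K]
      simp
    rw [inner_self_eq_norm_sq_to_K] at h2
    have h3 : ((‖hf.toLp‖ ^ 2 : ℝ) : ℂ) = ((∫ x, ‖f x‖ ^ 2 ∂μ : ℝ) : ℂ) := by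
      rw [← h2]; simp
    exact Complex.ofReal_injective h3
  have e1 : ‖tensorPow h n‖ ^ 2 = ∫ x : Fin n → E d, ‖∏ i, h (x i)‖ ^ 2 :=
    key volume _ (memLp_tensorPow h n)
  have e2 : ‖h‖ ^ 2 = ∫ x : E d, ‖h x‖ ^ 2 := by
    have := key volume _ (Lp.memLp h)
    rwa [Lp.toLp_coeFn] at this
  have e3 : ‖tensorPow h n‖ ^ 2 = (‖h‖ ^ n) ^ 2 := by
    rw [e1, ← pow_mul, mul_comm, pow_mul, e2]
    simp only [norm_prod, ← Finset.prod_pow]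
    have := integral_fintype_prod_volume_eq_pow (ι := Fin n) (fun x : E d => ‖h x‖ ^ 2)
    rw [this, Fintype.card_fin]
  exact (pow_left_inj₀ (norm_nonneg _) (by positivity) two_ne_zero).mp e3

/-- The exponential vector `ε(h) = ∑_n h^{⊗n} / √(n!)`. -/
def expVector {d : ℕ} (h : L2 d) : Fock d :=
  Fock.mk ⟨fun n => ((Real.sqrt n.factorial : ℂ))⁻¹ • tensorPow h n, by
    refine memℓp_gen ?_
    have := Real.summable_pow_div_factorial (‖h‖ ^ 2)
    refine this.congr fun n => ?_
    have h0 : (0 : ℝ) ≤ n.factorial := by positivity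
    rw [norm_smul, norm_inv, Complex.norm_real, Real.norm_of_nonneg (Real.sqrt_nonneg _),
      norm_tensorPow]
    simp only [ENNReal.toReal_ofNat, Real.rpow_ofNat]
    rw [mul_pow, inv_pow, Real.sq_sqrt h0, ← pow_mul, ← pow_mul, mul_comm n 2, div_eq_inv_mul]⟩

/-- The Fock vacuum `(1, 0, 0, …)`; the zeroth tensor power is the constant function `1` on the
one-point space `(ℝ^d)^0`. -/
def vacuum (d : ℕ) : Fock d := Fock.mk (lp.single 2 0 (tensorPow 0 0))

/-- The graph of the operator of multiplication by `ϖ(x₁) + ⋯ + ϖ(x_n)` on `L²((ℝ^d)^n)`, with its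
maximal domain. -/
def sectorGraph {d : ℕ} (w : Dispersion d) (n : ℕ) : Submodule ℂ (L2n d n × L2n d n) where
  carrier := {p | p.2 =ᵐ[volume] fun x => (∑ i, (w.toFun (x i) : ℂ)) * p.1 x}
  zero_mem' := by
    filter_upwards [Lp.coeFn_zero ℂ 2 (volume : Measure (Fin n → E d))] with x hx
    rw [Prod.snd_zero, Prod.fst_zero, hx]; simp
  add_mem' {p q} hp hq := by
    filter_upwards [hp, hq, Lp.coeFn_add p.2 q.2, Lp.coeFn_add p.1 q.1] with x h1 h2 h3 h4
    rw [Prod.snd_add, Prod.fst_add, h3, h4, Pi.add_apply, Pi.add_apply, h1, h2, mul_add]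
  smul_mem' c p hp := by
    filter_upwards [hp, Lp.coeFn_smul c p.2, Lp.coeFn_smul c p.1] with x h1 h2 h3
    rw [Prod.smul_snd, Prod.smul_fst, h2, h3, Pi.smul_apply, Pi.smul_apply, h1, smul_eq_mul,
      smul_eq_mul]
    ring

theorem sectorGraph_zero {d : ℕ} (w : Dispersion d) (n : ℕ) (p : L2n d n × L2n d n)
    (hp : p ∈ sectorGraph w n) (h0 : p.1 = 0) : p.2 = 0 := by
  have hp' : p.2 =ᵐ[volume] fun x => (∑ i, (w.toFun (x i) : ℂ)) * p.1 x := hp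
  apply Lp.ext
  rw [h0] at hp'
  filter_upwards [hp', Lp.coeFn_zero ℂ 2 (volume : Measure (Fin n → E d))] with x h2 h3
  rw [h2, h3]
  simp

/-- The graph of the second quantization `dΓ(ϖ)`: the pairs `(ψ, φ)` of Fock space vectors with
`φ⁽ⁿ⁾(x₁, …, x_n) = (ϖ(x₁) + ⋯ + ϖ(x_n)) ψ⁽ⁿ⁾(x₁, …, x_n)` for every `n`. -/
def dGammaGraph {d : ℕ} (w : Dispersion d) : Submodule ℂ (Fock d × Fock d) :=
  ⨅ n : ℕ, (sectorGraph w n).comap ((comp n).prodMap (comp n))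

/-- The second quantization `dΓ(ϖ)`, as an unbounded operator on Fock space with its maximal
domain. -/
def dGamma {d : ℕ} (w : Dispersion d) : Fock d →ₗ.[ℂ] Fock d := (dGammaGraph w).toLinearPMap

theorem dGamma_graph {d : ℕ} (w : Dispersion d) : (dGamma w).graph = dGammaGraph w := by
  refine Submodule.toLinearPMap_graph_eq _ fun p hp h0 => comp_ext fun n => ?_
  rw [map_zero]
  refine sectorGraph_zero w n (comp n p.1, comp n p.2) ?_ ?_
  · exact (Submodule.mem_iInf _).mp hp n
  · rw [h0, map_zero]

theorem mem_dGamma_graph {d : ℕ} (w : Dispersion d) (ψ φ : Fock d) :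
    (ψ, φ) ∈ (dGamma w).graph ↔
      ∀ n, comp n φ =ᵐ[volume] fun x => (∑ i, (w.toFun (x i) : ℂ)) * comp n ψ x := by
  rw [dGamma_graph, dGammaGraph, Submodule.mem_iInf]
  rfl

/-! ### Unitary groups and their generators -/

section Generators

variable {K L : Type*} [NormedAddCommGroup K] [InnerProductSpace ℂ K]
  [NormedAddCommGroup L] [InnerProductSpace ℂ L]

/-- `U t = e^{itH}`: `U` is a strongly continuous one-parameter unitary group, and `H` (with its
domain) is its generator `Hψ = -i d/dt U(t)ψ |_{t=0}`. -/
structure IsExpOf (U : ℝ → K ≃ₗᵢ[ℂ] K) (H : K →ₗ.[ℂ] K) : Prop where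
  add : ∀ s t ψ, U (s + t) ψ = U s (U t ψ)
  continuous : ∀ ψ, Continuous fun t => U t ψ
  generator : ∀ ψ φ, (ψ, φ) ∈ H.graph ↔ HasDerivAt (fun t => U t ψ) (I • φ) 0

/-- `V H V* = T` for a unitary `V`, including equality of the domains. -/
def IsConj (V : K ≃ₗᵢ[ℂ] L) (H : K →ₗ.[ℂ] K) (T : L →ₗ.[ℂ] L) : Prop :=
  ∀ ψ φ, (ψ, φ) ∈ H.graph ↔ (V ψ, V φ) ∈ T.graph

end Generators

/-! ### States, dynamics, representations -/

section Model

variable {d : ℕ}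

/-- The Fock representation `π_F(W(f)) = e^{iπ(a(f) + a*(f))}` of `𝕎`, the Weyl operators on Fock
space being given by their action on the (total) set of exponential vectors. -/
def IsFockRep (π : CCR d →⋆ₐ[ℂ] (Fock d →L[ℂ] Fock d)) : Prop :=
  ∀ (f : Test d) (h : L2 d), π (weyl f) (expVector h) =
    Complex.exp (-(Real.pi ^ 2 / 2 * ‖toL2 f‖ ^ 2 : ℝ) + I * Real.pi * inner ℂ (toL2 f) h) •
      expVector (h + (I * Real.pi : ℂ) • toL2 f)

/-- The dynamical map with source `v`: the group of *-automorphisms of `𝕎` with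
`τ_t(W(f)) = e^{2πi Re⟨f, (e^{-itϖ} - 1)v/ϖ⟩} W(e^{itϖ} f)`. -/
structure IsVHMDynamics (w : Dispersion d) (v : Dist d) (τ : ℝ → CCR d ≃⋆ₐ[ℂ] CCR d) :
    Prop where
  add : ∀ s t a, τ (s + t) a = τ s (τ t a)
  weyl : ∀ t f, τ t (weyl f) =
    Complex.exp (2 * Real.pi * I * ((bracket f (w.drift t v)).re : ℂ)) •
      weyl (mulTest (w.phase t) (w.phase_smooth t) f)

/-- The state `ω_∞`, with noncommutative Fourier transform
`ω_∞(W(f)) = e^{-π²‖f‖²/2} e^{2πi Re⟨f, -v/ϖ⟩}`. -/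
structure IsOmegaInfty (w : Dispersion d) (v : Dist d) (ρ : CCR d →ₚ[ℂ] ℂ) : Prop where
  map_one : ρ 1 = 1
  weyl : ∀ f, ρ (weyl f) = Complex.exp (-(Real.pi ^ 2 / 2 * ‖toL2 f‖ ^ 2 : ℝ)) *
    Complex.exp (2 * Real.pi * I * ((bracket f (-(w.quot v))).re : ℂ))

/-- The Fock vacuum state `ω_F(a) = ⟨Ω, π_F(a) Ω⟩`. -/
def IsFockVacuumState (π : CCR d →⋆ₐ[ℂ] (Fock d →L[ℂ] Fock d)) (ρ : CCR d →ₚ[ℂ] ℂ) : Prop :=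
  ∀ a, ρ a = inner ℂ (vacuum d) (π a (vacuum d))

end Model

section Algebra

variable {A : Type*} [CStarAlgebra A] [PartialOrder A] [StarOrderedRing A]

/-- The cyclic vector `Ω_ρ` of the GNS representation, the class of `1`. -/
def gnsVector (ρ : A →ₚ[ℂ] ℂ) : ρ.GNS := ((ρ.toPreGNS 1 : ρ.PreGNS) : ρ.GNS)

/-- `ρ` is normal with respect to `ρ₀`: it is given by a density matrix `∑ₙ |ψₙ⟩⟨ψₙ|` in the GNS
representation of `ρ₀`. -/
def IsNormalWrt (ρ ρ₀ : A →ₚ[ℂ] ℂ) : Prop :=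
  ∃ ψ : ℕ → ρ₀.GNS, Summable (fun n => ‖ψ n‖ ^ 2) ∧
    ∀ a, HasSum (fun n => inner ℂ (ψ n) (ρ₀.gnsStarAlgHom a (ψ n))) (ρ a)

/-- The self-adjoint operator `H` implements the dynamics `τ` in the representation `π`:
`π(τ_t(a)) = e^{itH} π(a) e^{-itH}`. -/
def IsHamiltonianIn {K : Type*} [NormedAddCommGroup K] [InnerProductSpace ℂ K] [CompleteSpace K]
    (π : A →⋆ₐ[ℂ] (K →L[ℂ] K)) (τ : ℝ → A ≃⋆ₐ[ℂ] A) (H : K →ₗ.[ℂ] K) : Prop :=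
  IsSelfAdjoint H ∧ ∃ U : ℝ → K ≃ₗᵢ[ℂ] K, IsExpOf U H ∧
    ∀ t a ψ, π (τ t a) ψ = U t (π a ((U t).symm ψ))

/-- The Hamiltonian of the dynamics `τ` in the GNS representation of the state `ρ`: the
self-adjoint operator that implements `τ` there and annihilates the cyclic vector `Ω_ρ`. -/
def IsGNSHamiltonian (τ : ℝ → A ≃⋆ₐ[ℂ] A) (ρ : A →ₚ[ℂ] ℂ) (H : ρ.GNS →ₗ.[ℂ] ρ.GNS) : Prop :=
  IsHamiltonianIn ρ.gnsStarAlgHom τ H ∧ (gnsVector ρ, 0) ∈ H.graph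

end Algebra

end VanHove

end

/-!
The Weyl operators of Fock space are the unitaries `fockWeyl u`, `u ∈ L²`, with
`fockWeyl u ε(h) = e^{-‖u‖²/2 - ⟨u, h⟩} ε(h + u)`. The Fock representation is
`W(f) ↦ fockWeyl (iπ f)`. As the exponential vectors are total, every unitary below is determined,
and is constructed, by the inner products of the images of a total family
(`exists_unitary_of_inner_eq`, `dense_span_expVector`).

*Representations of `𝕎`.* The algebra `𝕎` is generated by twisted translations of the discrete group
`𝒟`. To extend a system of unitaries with the Weyl relations to a representation of `𝕎`, one needs
`‖∑ c_f U(f)‖ ≤ ‖∑ c_f W(f)‖`. Tensoring with `ℓ²(𝒟)` turns the unitary system into a multiple of a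
twisted regular representation, and the abelian group `𝒟` is amenable: the boxes in a finitely
generated subgroup grow polynomially, so a vector spread evenly over a large box is almost invariant
under the finitely many translations involved (`IsWeylSystem.norm_sum_le`). This yields the dynamics
`τ`, the Fock representation, and the latter twisted by the character `f ↦ e^{2πi Re⟨f, T⟩}`
(`exists_gauged_fockRep`). Uniqueness is the density of the span of the Weyl operators.

*The renormalized Hamiltonian.* For `T = -v/ϖ` the vacuum vector state of the twisted Fock
representation is `ω_∞`, and the vacuum is cyclic, so the GNS representation of `ω_∞` is this
representation. The character of `W(f)` under `τ_t` is the quotient of the characters of `f` and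
`e^{itϖ}f` for `T`, hence `τ_t` is implemented by the second quantization `Γ(e^{itϖ})`, which fixes
the vacuum and is generated by `dΓ(ϖ)` (`exists_gnsHamiltonian`). A Hamiltonian annihilating the
cyclic vector generates the group `π(a)Ω ↦ π(τ_t(a))Ω`, hence is unique.

*The source in `L²`.* If `v/ϖ = g ∈ L²`, the character for `-v/ϖ` is obtained by conjugation with
the Weyl operator `fockWeyl (-g)`, which is the dressing transformation: conjugating `Γ(e^{itϖ})`
with it implements `τ` on Fock space, and `fockWeyl (-g) Ω` is a vector that represents `ω_∞`
(`exists_undressed`, `isNormalWrt_of_memL2`).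

*The source not in `L²`.* A linear form `T` is in `L²` if it is bounded in the `L²` norm (Riesz),
and it is bounded if its characters `e^{2πi Re⟨f, T⟩}` stay away from `-1` on a ball, since they do
so on the whole segment from `0` to `f`. Normality of `ω_∞` makes `f ↦ ω_∞(W(f))` continuous in the
`L²` norm, and this gives `v/ϖ ∈ L²` (`memL2_of_isNormalWrt`). If a strongly continuous unitary
group implements `τ`, the same argument with the vectors `U(-t)Ω`, which are close to the vacuum,
bounds `(e^{-itϖ} - 1)v/ϖ` uniformly for small `t ≥ 0` (`memL2_of_isHamiltonianIn`). The factor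
`e^{-itϖ} - 1` may vanish somewhere for every single `t`, but a suitable average over `t` is bounded
away from zero because `ϖ ≥ μ > 0`; dividing by the average bounds `v/ϖ`
(`memL2_quot_of_drift_bound`).
-/

noncomputable section

namespace VanHove

/-! ### Unitaries from Gram matrices, and generators of unitary groups -/

set_option linter.unusedSectionVars false

section Hilbert

variable {K L : Type*} [NormedAddCommGroup K] [InnerProductSpace ℂ K] [CompleteSpace K]
  [NormedAddCommGroup L] [InnerProductSpace ℂ L] [CompleteSpace L]

theorem inner_linearCombination {X : Type*} (e : X → K) (c b : X →₀ ℂ) :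
    inner ℂ (Finsupp.linearCombination ℂ e c) (Finsupp.linearCombination ℂ e b) =
      c.sum fun x z => b.sum fun y u => conj z * (u * inner ℂ (e x) (e y)) := by
  simp only [Finsupp.linearCombination_apply, Finsupp.sum, sum_inner, inner_sum, inner_smul_left,
    inner_smul_right, Finset.mul_sum]
  rw [Finset.sum_comm]
  exact Finset.sum_congr rfl fun _ _ => Finset.sum_congr rfl fun _ _ => by ring

/-- Two total families with the same Gram matrix are related by a unitary. -/
theorem exists_unitary_of_inner_eq {X : Type*} (e : X → K) (e' : X → L)
    (he : Dense (Submodule.span ℂ (Set.range e) : Set K))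
    (he' : Dense (Submodule.span ℂ (Set.range e') : Set L))
    (h : ∀ x y, (inner ℂ (e x) (e y) : ℂ) = inner ℂ (e' x) (e' y)) :
    ∃ V : K ≃ₗᵢ[ℂ] L, ∀ x, V (e x) = e' x := by
  set f := Finsupp.linearCombination ℂ e with hf
  set f' := Finsupp.linearCombination ℂ e' with hf'
  have hd : DenseRange f := by
    rw [DenseRange, hf, ← LinearMap.coe_range, Finsupp.range_linearCombination]; exact he
  have hd' : DenseRange f' := by
    rw [DenseRange, hf', ← LinearMap.coe_range, Finsupp.range_linearCombination]; exact he'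
  have hn : ∀ c, ‖f' c‖ = ‖f c‖ := fun c => by
    have : (inner ℂ (f' c) (f' c) : ℂ) = inner ℂ (f c) (f c) := by
      simp only [hf, hf', inner_linearCombination, h]
    rw [@norm_eq_sqrt_re_inner ℂ, @norm_eq_sqrt_re_inner ℂ, this]
  have h1 : ∃ C, ∀ x, ‖f' (LinearEquiv.refl ℂ (X →₀ ℂ) x)‖ ≤ C * ‖f x‖ :=
    ⟨1, fun c => by simp [hn]⟩
  have h2 : ∃ C, ∀ x, ‖f ((LinearEquiv.refl ℂ (X →₀ ℂ)).symm x)‖ ≤ C * ‖f' x‖ :=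
    ⟨1, fun c => by simp [hn]⟩
  set T := (LinearEquiv.refl ℂ (X →₀ ℂ)).extend f f' hd h1 hd' h2
  have hT : ∀ c, T (f c) = f' c := fun c => LinearEquiv.extend_eq _ _ _ hd h1 hd' h2 c
  refine ⟨⟨T.toLinearEquiv, fun x => ?_⟩, fun x => ?_⟩
  · change ‖T x‖ = ‖x‖
    refine hd.induction (P := fun x => ‖T x‖ = ‖x‖) ?_
      (isClosed_eq (by fun_prop) (by fun_prop)) x
    rintro _ ⟨c, rfl⟩
    rw [hT, hn]
  · change T (e x) = e' x
    have := hT (Finsupp.single x 1)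
    simpa [hf, hf'] using this

theorem eq_of_eqOn_total {X F : Type*} [NormedAddCommGroup F] [NormedSpace ℂ F] {e : X → K}
    (he : Dense (Submodule.span ℂ (Set.range e) : Set K)) {S T : K →L[ℂ] F}
    (h : ∀ x, S (e x) = T (e x)) : S = T :=
  ContinuousLinearMap.ext_on he (by rintro _ ⟨x, rfl⟩; exact h x)

theorem unitary_eq_of_eqOn_total {X : Type*} {e : X → K}
    (he : Dense (Submodule.span ℂ (Set.range e) : Set K)) {S T : K ≃ₗᵢ[ℂ] L}
    (h : ∀ x, S (e x) = T (e x)) (ψ : K) : S ψ = T ψ :=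
  DFunLike.congr_fun (eq_of_eqOn_total he
    (S := (S.toLinearIsometry.toContinuousLinearMap : K →L[ℂ] L))
    (T := (T.toLinearIsometry.toContinuousLinearMap : K →L[ℂ] L)) h) ψ

/-- The graph of the generator of a family of unitaries. -/
def generatorGraph (U : ℝ → K ≃ₗᵢ[ℂ] K) : Submodule ℂ (K × K) where
  carrier := {p | HasDerivAt (fun t => U t p.1) (I • p.2) 0}
  zero_mem' := by simpa using hasDerivAt_const (0 : ℝ) (0 : K)
  add_mem' {p q} hp hq := by
    have := HasDerivAt.add hp hq
    simp only [Set.mem_ofPred_eq, Prod.fst_add, Prod.snd_add, map_add, smul_add]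
    exact this
  smul_mem' c p hp := by
    have := HasDerivAt.const_smul c hp
    simp only [Set.mem_ofPred_eq, Prod.smul_fst, Prod.smul_snd, map_smul]
    rw [smul_comm]
    exact this

/-- The generator `-i d/dt U(t)|_{t=0}` of a unitary group, on the domain of all vectors for which
the derivative exists. -/
def generator (U : ℝ → K ≃ₗᵢ[ℂ] K) : K →ₗ.[ℂ] K := (generatorGraph U).toLinearPMap

theorem mem_generator_graph (U : ℝ → K ≃ₗᵢ[ℂ] K) (ψ φ : K) :
    (ψ, φ) ∈ (generator U).graph ↔ HasDerivAt (fun t => U t ψ) (I • φ) 0 := by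
  rw [generator, Submodule.toLinearPMap_graph_eq]
  · rfl
  · intro p hp h0
    have hp' : HasDerivAt (fun t => U t p.1) (I • p.2) 0 := hp
    simp only [h0, map_zero] at hp'
    have := hp'.unique (hasDerivAt_const (0 : ℝ) (0 : K))
    exact (smul_eq_zero.mp this).resolve_left I_ne_zero

theorem isExpOf_generator {U : ℝ → K ≃ₗᵢ[ℂ] K} (ha : ∀ s t ψ, U (s + t) ψ = U s (U t ψ))
    (hc : ∀ ψ, Continuous fun t => U t ψ) : IsExpOf U (generator U) :=
  ⟨ha, hc, mem_generator_graph U⟩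

theorem IsExpOf.eq_of_eq {U : ℝ → K ≃ₗᵢ[ℂ] K} {H H' : K →ₗ.[ℂ] K} (h : IsExpOf U H)
    (h' : IsExpOf U H') : H = H' := by
  refine LinearPMap.eq_of_eq_graph ?_
  ext ⟨ψ, φ⟩
  rw [h.generator, h'.generator]

section Group

variable {U : ℝ → K ≃ₗᵢ[ℂ] K} {H : K →ₗ.[ℂ] K} (hU : IsExpOf U H)
include hU

namespace IsExpOf

theorem zero_apply (ψ : K) : U 0 ψ = ψ := by
  refine (U 0).injective ?_
  rw [← hU.add, add_zero]

theorem symm_apply (t : ℝ) (ψ : K) : (U t).symm ψ = U (-t) ψ := by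
  rw [LinearIsometryEquiv.symm_apply_eq, ← hU.add, add_neg_cancel, hU.zero_apply]

theorem inner_apply (t : ℝ) (ψ φ : K) : (inner ℂ (U t ψ) φ : ℂ) = inner ℂ ψ (U (-t) φ) := by
  rw [← (U t).inner_map_map ψ, ← hU.add, add_neg_cancel, hU.zero_apply]

theorem hasDerivAt {ψ φ : K} (h : (ψ, φ) ∈ H.graph) (t : ℝ) :
    HasDerivAt (fun t => U t ψ) (I • U t φ) t := by
  have h0 := (hU.generator ψ φ).mp h
  have h1 : HasDerivAt (fun s => U (s - t) ψ) (I • φ) t :=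
    HasDerivAt.comp_sub_const t t (by simpa using h0)
  have h2 := ((U t).toContinuousLinearEquiv.toContinuousLinearMap.restrictScalars
    ℝ).hasFDerivAt.comp_hasDerivAt t h1
  convert! h2 using 1
  · funext s
    simp [← hU.add]
  · simp

theorem apply_mem_graph {ψ φ : K} (h : (ψ, φ) ∈ H.graph) (t : ℝ) : (U t ψ, U t φ) ∈ H.graph := by
  have h0 := hU.hasDerivAt h t
  rw [hU.generator]
  have h1 : HasDerivAt (fun s => U (s + t) ψ) (I • U t φ) 0 :=
    HasDerivAt.comp_add_const 0 t (by simpa using h0)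
  simpa only [hU.add] using h1

theorem apply_eq_of_mem_graph_zero {ψ : K} (h : (ψ, 0) ∈ H.graph) (t : ℝ) : U t ψ = ψ := by
  have h1 : ∀ t, HasDerivAt (fun t => U t ψ) 0 t := fun t => by
    simpa using hU.hasDerivAt h t
  have h2 := is_const_of_deriv_eq_zero (fun t => (h1 t).differentiableAt) (fun t => (h1 t).deriv)
  rw [h2 t 0, hU.zero_apply]

theorem hasDerivAt_integral (x : K) (t : ℝ) :
    HasDerivAt (fun t => ∫ s in (0 : ℝ)..t, U s x) (U t x) t :=
  intervalIntegral.integral_hasDerivAt_right ((hU.continuous x).intervalIntegrable _ _)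
    (hU.continuous x).stronglyMeasurable.stronglyMeasurableAtFilter (hU.continuous x).continuousAt

/-- Time averages lie in the domain of the generator. -/
theorem integral_mem_graph (x : K) (h : ℝ) :
    (∫ s in (0 : ℝ)..h, U s x, -I • (U h x - x)) ∈ H.graph := by
  rw [hU.generator]
  have key : (fun t => U t (∫ s in (0 : ℝ)..h, U s x)) =
      fun t => (∫ s in (0 : ℝ)..(t + h), U s x) - ∫ s in (0 : ℝ)..t, U s x := by
    funext t
    have h1 : U t (∫ s in (0 : ℝ)..h, U s x) = ∫ s in (0 : ℝ)..h, U t (U s x) :=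
      (((U t).toContinuousLinearEquiv.toContinuousLinearMap.restrictScalars
        ℝ).intervalIntegral_comp_comm ((hU.continuous x).intervalIntegrable _ _)).symm
    rw [h1]
    simp only [← hU.add]
    rw [intervalIntegral.integral_comp_add_left (fun s => U s x), add_zero,
      intervalIntegral.integral_interval_sub_left] <;>
    exact (hU.continuous x).intervalIntegrable _ _
  rw [key]
  have h1 : HasDerivAt (fun t => ∫ s in (0 : ℝ)..(t + h), U s x) (U (0 + h) x) 0 :=
    HasDerivAt.comp_add_const 0 h (hU.hasDerivAt_integral x (0 + h))
  convert! h1.sub (hU.hasDerivAt_integral x 0) using 1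
  rw [smul_smul, hU.zero_apply, zero_add]
  simp

theorem dense_domain : Dense (H.domain : Set K) := by
  rw [Submodule.dense_iff_topologicalClosure_eq_top,
    Submodule.topologicalClosure_eq_top_iff, Submodule.eq_bot_iff]
  intro y hy
  have h1 : ∀ h, (inner ℂ y (∫ s in (0 : ℝ)..h, U s y) : ℂ) = 0 := fun h =>
    Submodule.inner_left_of_mem_orthogonal
      (LinearPMap.mem_domain_of_mem_graph (hU.integral_mem_graph y h)) hy
  have h2 := (((innerSL ℂ y).restrictScalars ℝ).hasFDerivAt.comp_hasDerivAt 0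
    (hU.hasDerivAt_integral y 0))
  have h3 : HasDerivAt (fun _ : ℝ => (0 : ℂ)) (inner ℂ y (U 0 y)) 0 := by
    convert! h2 using 1
    funext h
    exact (h1 h).symm
  have h4 := h3.unique (hasDerivAt_const _ _)
  rwa [hU.zero_apply, inner_self_eq_zero] at h4

theorem inner_symm {ψ φ ψ' φ' : K} (h : (ψ, φ) ∈ H.graph) (h' : (ψ', φ') ∈ H.graph) :
    (inner ℂ φ ψ' : ℂ) = inner ℂ ψ φ' := by
  have h1 := ((hU.generator _ _).mp h).inner ℂ ((hU.generator _ _).mp h')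
  have h2 : HasDerivAt (fun _ : ℝ => (inner ℂ ψ ψ' : ℂ))
      (inner ℂ (U 0 ψ) (I • φ') + inner ℂ (I • φ) (U 0 ψ')) 0 := by
    convert! h1 using 1
    funext t
    exact ((U t).inner_map_map ψ ψ').symm
  have h3 := h2.unique (hasDerivAt_const _ _)
  rw [hU.zero_apply, hU.zero_apply, inner_smul_left, inner_smul_right, conj_I] at h3
  have h4 : I * (inner ℂ ψ φ' - inner ℂ φ ψ') = 0 := by rw [← h3]; ring
  exact (sub_eq_zero.mp ((mul_eq_zero.mp h4).resolve_left I_ne_zero)).symm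

/-- The generator of a strongly continuous unitary group is self-adjoint: if `(y, z)` belongs to
the graph of the adjoint, then `U(t) y - y` and `∫₀ᵗ i U(s) z ds` have the same inner products
with the vectors of the dense domain. -/
theorem isSelfAdjoint : IsSelfAdjoint H := by
  rw [LinearPMap.isSelfAdjoint_def]
  refine LinearPMap.eq_of_eq_graph ?_
  rw [LinearPMap.adjoint_graph_eq_graph_adjoint hU.dense_domain]
  ext ⟨y, z⟩
  rw [Submodule.mem_adjoint_iff]
  constructor
  swap
  · intro h a b hab
    rw [hU.inner_symm hab h, sub_self]
  intro h
  have hz : ∀ ψ φ, (ψ, φ) ∈ H.graph → (inner ℂ φ y : ℂ) = inner ℂ ψ z :=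
    fun ψ φ hp => sub_eq_zero.mp (h ψ φ hp)
  have key : ∀ t, U t y = y + I • ∫ s in (0 : ℝ)..t, U s z := by
    intro t
    refine hU.dense_domain.eq_of_inner_right ℂ fun ψ hψ => ?_
    obtain ⟨φ, hφ⟩ := LinearPMap.mem_domain_iff.mp hψ
    have hd : ∀ s, HasDerivAt
        (fun s => (inner ℂ ψ (U s y) : ℂ) - inner ℂ ψ (y + I • ∫ r in (0 : ℝ)..s, U r z)) 0 s := by
      intro s
      have e1 : HasDerivAt (fun s => (inner ℂ ψ (U s y) : ℂ)) (I * inner ℂ ψ (U s z)) s := by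
        have a1 : HasDerivAt (fun s => U (-s) ψ) (-(I • U (-s) φ)) s := by
          have a0 := (hU.hasDerivAt hφ (-s)).scomp s (hasDerivAt_neg s)
          rw [neg_one_smul] at a0
          exact a0
        have a2 := a1.inner ℂ (hasDerivAt_const s y)
        have a3 : (inner ℂ (U (-s) ψ) 0 : ℂ) + inner ℂ (-(I • U (-s) φ)) y =
            I * inner ℂ ψ (U s z) := by
          rw [inner_zero_right, inner_neg_left, inner_smul_left, conj_I,
            hz _ _ (hU.apply_mem_graph hφ (-s)), hU.inner_apply, neg_neg]
          ring
        rw [a3] at a2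
        convert! a2 using 1
        funext s
        rw [hU.inner_apply, neg_neg]
      have e2 : HasDerivAt (fun s => (inner ℂ ψ (y + I • ∫ r in (0 : ℝ)..s, U r z) : ℂ))
          (I * inner ℂ ψ (U s z)) s := by
        have a1 := ((hU.hasDerivAt_integral z s).const_smul I).const_add y
        have a2 := (hasDerivAt_const s ψ).inner ℂ a1
        rw [inner_zero_left, add_zero, inner_smul_right] at a2
        exact a2
      have e3 := e1.sub e2
      rw [sub_self] at e3
      exact e3
    have hc := is_const_of_deriv_eq_zero (fun s => (hd s).differentiableAt)
      (fun s => (hd s).deriv) t 0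
    simp only [intervalIntegral.integral_same, smul_zero, add_zero, hU.zero_apply, sub_self] at hc
    exact sub_eq_zero.mp hc
  rw [hU.generator, show (fun t => U t y) = _ from funext key]
  have := ((hU.hasDerivAt_integral z 0).const_smul I).const_add y
  rwa [hU.zero_apply] at this

end IsExpOf

end Group

end Hilbert

/-! ### Representations of the algebra of canonical commutation relations -/

section CCR

variable {d : ℕ} {K : Type*} [NormedAddCommGroup K] [InnerProductSpace ℂ K] [CompleteSpace K]

theorem dense_span_weyl (d : ℕ) :
    Dense (Submodule.span ℂ (Set.range (weyl : Test d → CCR d)) : Set (CCR d)) := by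
  let J : CCR d →ₗ[ℂ] (Ell2 d →L[ℂ] Ell2 d) := (ccrSubalgebra d).subtype.toLinearMap
  set s : Set (Ell2 d →L[ℂ] Ell2 d) :=
    Set.range fun f : Test d => (twist f).toContinuousLinearMap with hs
  have hJ : J '' (Submodule.span ℂ (Set.range (weyl : Test d → CCR d)) : Set (CCR d)) =
      Submodule.span ℂ s := by
    rw [← Submodule.map_coe, Submodule.map_span, ← Set.range_comp]
    rfl
  have hmul : ∀ f g : Test d, (twist f).toContinuousLinearMap * (twist g).toContinuousLinearMap =
      weylPhase f g • (twist (f + g)).toContinuousLinearMap := fun f g =>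
    congrArg Subtype.val (weyl_mul f g)
  have hstar : ∀ f : Test d, star (twist f).toContinuousLinearMap =
      (twist (-f)).toContinuousLinearMap := fun f => congrArg Subtype.val (star_weyl f)
  have hone : (twist (0 : Test d)).toContinuousLinearMap = 1 :=
    congrArg Subtype.val (weyl_zero d)
  have hle : ∀ a ∈ StarAlgebra.adjoin ℂ s, a ∈ Submodule.span ℂ s := by
    intro a ha
    induction ha using StarAlgebra.adjoin_induction with
    | mem x hx => exact Submodule.subset_span hx
    | algebraMap r =>
      rw [Algebra.algebraMap_eq_smul_one, ← hone]
      exact Submodule.smul_mem _ _ (Submodule.subset_span ⟨0, rfl⟩)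
    | add x y _ _ hx hy => exact Submodule.add_mem _ hx hy
    | mul x y _ _ hx hy =>
      have := Submodule.mul_mem_mul hx hy
      rw [Submodule.span_mul_span] at this
      refine Submodule.span_le.mpr ?_ this
      rintro _ ⟨_, ⟨f, rfl⟩, _, ⟨g, rfl⟩, rfl⟩
      simp only [SetLike.mem_coe, hmul]
      exact Submodule.smul_mem _ _ (Submodule.subset_span ⟨f + g, rfl⟩)
    | star x hx' hx =>
      clear hx'
      induction hx using Submodule.span_induction with
      | mem x hx =>
        obtain ⟨f, rfl⟩ := hx
        simp only [hstar]
        exact Submodule.subset_span ⟨-f, rfl⟩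
      | zero => simp
      | add x y _ _ hx hy => rw [star_add]; exact Submodule.add_mem _ hx hy
      | smul c x _ hx => rw [star_smul]; exact Submodule.smul_mem _ _ hx
  intro a
  have h1 : (a.1 : Ell2 d →L[ℂ] Ell2 d) ∈ closure
      (J '' (Submodule.span ℂ (Set.range (weyl : Test d → CCR d)) : Set (CCR d))) := by
    rw [hJ]
    exact closure_mono hle a.2
  exact (Topology.IsInducing.subtypeVal.closure_eq_preimage_closure_image _).ge h1

/-- Continuous linear maps on `𝕎` are determined by their values on the Weyl operators. -/
theorem ccr_ext {F : Type*} [NormedAddCommGroup F] [NormedSpace ℂ F] {S T : CCR d →L[ℂ] F}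
    (h : ∀ f, S (weyl f) = T (weyl f)) : S = T :=
  ContinuousLinearMap.ext_on (dense_span_weyl d) (by rintro _ ⟨x, rfl⟩; exact h x)

/-- Exponential growth is faster than polynomial growth. -/
theorem le_of_forall_pow_le_poly_mul_pow {x y : ℝ} (hy : 0 ≤ y) (n : ℕ)
    (h : ∀ N : ℕ, x ^ N ≤ (2 * N + 1 : ℝ) ^ n * y ^ N) : x ≤ y := by
  by_contra! hlt
  have hy0 : 0 < y := by
    refine hy.lt_of_ne fun h0 => ?_
    have := h 1
    rw [← h0] at this
    simp at this
    linarith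
  have hr : 1 < x / y := (one_lt_div hy0).mpr hlt
  have h1 := (tendsto_pow_const_div_const_pow_of_one_lt n hr).const_mul (3 ^ n : ℝ)
  rw [mul_zero] at h1
  obtain ⟨N, hN1, hN⟩ := ((h1.eventually_lt_const one_pos).and
    (Filter.eventually_ge_atTop 1)).exists
  have h2 : 0 < (x / y) ^ N := pow_pos (by linarith) N
  rw [← mul_div_assoc, div_lt_one h2, ← mul_pow, div_pow, lt_div_iff₀ (pow_pos hy0 N)] at hN1
  have h3 : (2 * N + 1 : ℝ) ^ n ≤ (3 * N : ℝ) ^ n := by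
    have : (1 : ℝ) ≤ N := by exact_mod_cast hN
    gcongr
    linarith
  have := (h N).trans (mul_le_mul_of_nonneg_right h3 (pow_nonneg hy N))
  linarith

/-- The operator `∑ c_f W(f)` on `ℓ²(𝒟)`, applied to `K`-valued functions of finite support, is
bounded by its norm on scalar functions. -/
theorem sum_norm_sq_twist_le (c : Test d →₀ ℂ) (S S' : Finset (Test d)) (Ψ : Test d → K)
    (hΨ : ∀ h ∉ S, Ψ h = 0) :
    ∑ h ∈ S', ‖∑ f ∈ c.support, c f • weylPhase f h • Ψ (h - f)‖ ^ 2 ≤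
      ‖Finsupp.linearCombination ℂ (weyl : Test d → CCR d) c‖ ^ 2 * ∑ h ∈ S, ‖Ψ h‖ ^ 2 := by
  classical
  set W : Submodule ℂ K := Submodule.span ℂ (S.image Ψ : Set K)
  have hW : ∀ h, Ψ h ∈ W := fun h => by
    by_cases hS : h ∈ S
    · exact Submodule.subset_span (by simpa using ⟨h, hS, rfl⟩)
    · rw [hΨ h hS]; exact W.zero_mem
  have : FiniteDimensional ℂ W := FiniteDimensional.span_finset ℂ _
  set b := stdOrthonormalBasis ℂ W
  have hpars : ∀ x ∈ W, ‖x‖ ^ 2 = ∑ j, ‖(inner ℂ ((b j : W) : K) x : ℂ)‖ ^ 2 := fun x hx =>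
    (b.sum_sq_norm_inner_right (⟨x, hx⟩ : W)).symm
  set T : CCR d := Finsupp.linearCombination ℂ (weyl : Test d → CCR d) c with hT
  have hTapp : ∀ (ψ : Ell2 d) h, (T.1 ψ) h =
      ∑ f ∈ c.support, c f * (weylPhase f h * ψ (h - f)) := by
    intro ψ h
    have h1 : (T.1 : Ell2 d →L[ℂ] Ell2 d) =
        ∑ f ∈ c.support, c f • (twist f).toContinuousLinearMap := by
      change (ccrSubalgebra d).subtype T = _
      rw [hT, Finsupp.linearCombination_apply, Finsupp.sum]
      exact map_sum (ccrSubalgebra d).subtype _ _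
    rw [h1, sum_apply]
    have h2 : ∀ (s : Finset (Test d)) (F : Test d → Ell2 d),
        (∑ f ∈ s, F f : Ell2 d) h = ∑ f ∈ s, F f h := fun s F => by
      rw [lp.coeFn_sum, Finset.sum_apply]
    rw [h2]
    rfl
  have hfs : ∀ j, Summable fun h => ‖(inner ℂ ((b j : W) : K) (Ψ h) : ℂ)‖ ^ (2 : ℝ≥0∞).toReal :=
    fun j => summable_of_ne_finset_zero (s := S) fun h hh => by simp [hΨ h hh]
  let ψ : Fin (Module.finrank ℂ W) → Ell2 d := fun j =>
    ⟨fun h => inner ℂ ((b j : W) : K) (Ψ h), memℓp_gen (hfs j)⟩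
  have hψ : ∀ j, ‖ψ j‖ ^ 2 = ∑ h ∈ S, ‖(inner ℂ ((b j : W) : K) (Ψ h) : ℂ)‖ ^ 2 := fun j => by
    have := lp.norm_rpow_eq_tsum (p := 2) (by norm_num) (ψ j)
    simp only [ENNReal.toReal_ofNat, Real.rpow_ofNat] at this
    rw [this, tsum_eq_sum (s := S)]
    intro h hh
    change ‖(inner ℂ ((b j : W) : K) (Ψ h) : ℂ)‖ ^ 2 = 0
    simp [hΨ h hh]
  have hj : ∀ j, ∑ h ∈ S', ‖(inner ℂ ((b j : W) : K)
      (∑ f ∈ c.support, c f • weylPhase f h • Ψ (h - f)) : ℂ)‖ ^ 2 ≤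
      ‖T‖ ^ 2 * ∑ h ∈ S, ‖(inner ℂ ((b j : W) : K) (Ψ h) : ℂ)‖ ^ 2 := fun j => by
    have h1 := lp.sum_rpow_le_norm_rpow (p := 2) (by norm_num) (T.1 (ψ j)) S'
    simp only [ENNReal.toReal_ofNat, Real.rpow_ofNat] at h1
    have h2 : ‖T.1 (ψ j)‖ ≤ ‖T‖ * ‖ψ j‖ := T.1.le_opNorm (ψ j)
    rw [← hψ, ← mul_pow]
    refine le_trans (le_of_eq ?_) (h1.trans (pow_le_pow_left₀ (norm_nonneg _) h2 2))
    refine Finset.sum_congr rfl fun h _ => ?_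
    rw [hTapp, inner_sum]
    simp only [inner_smul_right]
    rfl
  calc ∑ h ∈ S', ‖∑ f ∈ c.support, c f • weylPhase f h • Ψ (h - f)‖ ^ 2
      = ∑ h ∈ S', ∑ j, ‖(inner ℂ ((b j : W) : K)
          (∑ f ∈ c.support, c f • weylPhase f h • Ψ (h - f)) : ℂ)‖ ^ 2 :=
        Finset.sum_congr rfl fun h _ => hpars _ (Submodule.sum_mem _ fun f _ =>
          W.smul_mem _ (W.smul_mem _ (hW _)))
    _ = ∑ j, ∑ h ∈ S', ‖(inner ℂ ((b j : W) : K)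
          (∑ f ∈ c.support, c f • weylPhase f h • Ψ (h - f)) : ℂ)‖ ^ 2 := Finset.sum_comm
    _ ≤ ∑ j, ‖T‖ ^ 2 * ∑ h ∈ S, ‖(inner ℂ ((b j : W) : K) (Ψ h) : ℂ)‖ ^ 2 :=
        Finset.sum_le_sum fun j _ => hj j
    _ = ‖T‖ ^ 2 * ∑ h ∈ S, ‖Ψ h‖ ^ 2 := by
        rw [← Finset.mul_sum, Finset.sum_comm]
        congr 1
        exact Finset.sum_congr rfl fun h _ => (hpars _ (hW h)).symm

theorem symp_swap (f g : Test d) : symp g f = -symp f g := by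
  rw [symp, symp, ← inner_conj_symm, Complex.conj_im]

theorem weylPhase_neg_left (f h : Test d) : weylPhase (-h) f = weylPhase f h := by
  have : symp (-h) f = symp f h := by
    rw [symp, map_neg, inner_neg_left, Complex.neg_im, symp_swap h f]; rfl
  rw [weylPhase, weylPhase, this]

theorem weylPhase_self_neg (f : Test d) : weylPhase f (-f) = 1 := by
  have hs : symp f (-f) = 0 := by
    rw [symp, map_neg, inner_neg_right, Complex.neg_im, neg_eq_zero]
    exact inner_self_im (𝕜 := ℂ) (toL2 f)
  rw [weylPhase, hs]
  simp

section WeylSystem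

/-- A Weyl system: unitaries on a Hilbert space that satisfy the Weyl relations. -/
def IsWeylSystem (u : Test d → K ≃ₗᵢ[ℂ] K) : Prop :=
  ∀ f g ψ, u f (u g ψ) = weylPhase f g • u (f + g) ψ

variable {u : Test d → K ≃ₗᵢ[ℂ] K} (hu : IsWeylSystem u)
include hu

theorem IsWeylSystem.zero_apply (ψ : K) : u 0 ψ = ψ := by
  refine (u 0).injective ?_
  rw [hu, add_zero, show weylPhase (0 : Test d) 0 = 1 by
    simpa using weylPhase_self_neg (0 : Test d), one_smul]

theorem IsWeylSystem.apply_neg (f : Test d) (ψ : K) : u f (u (-f) ψ) = ψ := by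
  rw [hu, weylPhase_self_neg, one_smul, add_neg_cancel, hu.zero_apply]

/-- Weak containment of every Weyl system in the regular one: the group `𝒟` is amenable, being
abelian. The vectors `1_S(h) u(-h)ψ` in `ℓ²(𝒟; K)` intertwine the two up to the boundary of `S`,
and for the boxes `S` generated by the support of `c` the boundary is negligible, as the
cardinality of the boxes grows polynomially. -/
theorem IsWeylSystem.norm_sum_le (c : Test d →₀ ℂ) (ψ : K) :
    ‖∑ f ∈ c.support, c f • u f ψ‖ ≤
      ‖Finsupp.linearCombination ℂ (weyl : Test d → CCR d) c‖ * ‖ψ‖ := by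
  classical
  set C := ‖Finsupp.linearCombination ℂ (weyl : Test d → CCR d) c‖
  set x := ‖∑ f ∈ c.support, c f • u f ψ‖ with hx
  let box : ℕ → Finset (Test d) := fun N =>
    (Fintype.piFinset fun _ : c.support => Finset.Icc (-(N : ℤ)) N).image
      fun k => ∑ f : c.support, k f • (f : Test d)
  have hbox : ∀ N, ∀ h ∈ box N, ∀ f ∈ c.support, h - f ∈ box (N + 1) := by
    intro N h hh f hf
    obtain ⟨k, hk, rfl⟩ := Finset.mem_image.mp hh
    refine Finset.mem_image.mpr ⟨k - Pi.single ⟨f, hf⟩ 1, ?_, ?_⟩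
    · rw [Fintype.mem_piFinset] at hk ⊢
      intro g
      have := Finset.mem_Icc.mp (hk g)
      rw [Finset.mem_Icc, Pi.sub_apply, Pi.single_apply]
      push_cast
      split_ifs <;> omega
    · simp only [Pi.sub_apply, sub_smul, Finset.sum_sub_distrib, Pi.single_apply, ite_smul,
        one_smul, zero_smul, Finset.sum_ite_eq', Finset.mem_univ, if_true]
  have hcard : ∀ N, ((box N).card : ℝ) ≤ (2 * N + 1 : ℝ) ^ c.support.card := by
    intro N
    have h1 : (box N).card ≤ (2 * N + 1) ^ c.support.card := by
      refine Finset.card_image_le.trans (le_of_eq ?_)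
      rw [Fintype.card_piFinset]
      simp only [Int.card_Icc, Finset.prod_const, Finset.card_univ, Fintype.card_coe]
      congr 1
      omega
    exact_mod_cast h1
  have hstep : ∀ N, ((box N).card : ℝ) * x ^ 2 ≤ (C * ‖ψ‖) ^ 2 * (box (N + 1)).card := by
    intro N
    have h1 := sum_norm_sq_twist_le c (box (N + 1)) (box N)
      (fun h => if h ∈ box (N + 1) then u (-h) ψ else 0) (fun h hh => if_neg hh)
    have h2 : ∀ h ∈ box N, ‖∑ f ∈ c.support, c f • weylPhase f h •
        (if h - f ∈ box (N + 1) then u (-(h - f)) ψ else 0)‖ ^ 2 = x ^ 2 := by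
      intro h hh
      rw [hx, ← (u (-h)).norm_map (∑ f ∈ c.support, c f • u f ψ), map_sum]
      congr 2
      refine Finset.sum_congr rfl fun f hf => ?_
      rw [if_pos (hbox N h hh f hf), map_smul, hu, weylPhase_neg_left, neg_sub, neg_add_eq_sub]
    have h3 : ∀ h ∈ box (N + 1),
        ‖(if h ∈ box (N + 1) then u (-h) ψ else 0)‖ ^ 2 = ‖ψ‖ ^ 2 := by
      intro h hh
      rw [if_pos hh, (u (-h)).norm_map]
    rw [Finset.sum_congr rfl h2, Finset.sum_congr rfl h3, Finset.sum_const, Finset.sum_const,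
      nsmul_eq_mul, nsmul_eq_mul] at h1
    refine h1.trans (le_of_eq ?_)
    ring
  have hpow : ∀ N : ℕ, (x ^ 2) ^ N ≤ (box N).card * ((C * ‖ψ‖) ^ 2) ^ N := by
    intro N
    induction N with
    | zero =>
      have h0 : (0 : Test d) ∈ box 0 := Finset.mem_image.mpr ⟨fun _ => 0, by simp, by simp⟩
      have h1 : 1 ≤ (box 0).card := Finset.card_pos.mpr ⟨0, h0⟩
      simpa using h1
    | succ N ih =>
      calc (x ^ 2) ^ (N + 1) = (x ^ 2) ^ N * x ^ 2 := pow_succ _ _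
        _ ≤ ((box N).card * ((C * ‖ψ‖) ^ 2) ^ N) * x ^ 2 := by gcongr
        _ = ((C * ‖ψ‖) ^ 2) ^ N * ((box N).card * x ^ 2) := by ring
        _ ≤ ((C * ‖ψ‖) ^ 2) ^ N * ((C * ‖ψ‖) ^ 2 * (box (N + 1)).card) := by
          exact mul_le_mul_of_nonneg_left (hstep N) (by positivity)
        _ = _ := by ring
  have h1 := le_of_forall_pow_le_poly_mul_pow (sq_nonneg (C * ‖ψ‖)) c.support.card
    fun N => (hpow N).trans (by gcongr; exact hcard N)
  exact (pow_le_pow_iff_left₀ (norm_nonneg _) (by positivity) two_ne_zero).mp h1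

/-- Every Weyl system extends to a representation of `𝕎`. -/
theorem IsWeylSystem.exists_rep :
    ∃ π : CCR d →⋆ₐ[ℂ] (K →L[ℂ] K), ∀ f ψ, π (weyl f) ψ = u f ψ := by
  let v : Test d → K →L[ℂ] K := fun f => (u f).toContinuousLinearEquiv.toContinuousLinearMap
  set R := Finsupp.linearCombination ℂ v with hR
  set Λ := Finsupp.linearCombination ℂ (weyl : Test d → CCR d) with hΛ
  have hdense : DenseRange Λ := by
    rw [DenseRange, hΛ, ← LinearMap.coe_range, Finsupp.range_linearCombination]
    exact dense_span_weyl d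
  have hnorm : ∃ C, ∀ c, ‖R c‖ ≤ C * ‖Λ c‖ := by
    refine ⟨1, fun c => ?_⟩
    rw [one_mul]
    refine ContinuousLinearMap.opNorm_le_bound _ (norm_nonneg _) fun ψ => ?_
    have := hu.norm_sum_le c ψ
    rw [hR, Finsupp.linearCombination_apply, Finsupp.sum, sum_apply]
    exact this
  set Φ : CCR d →L[ℂ] (K →L[ℂ] K) := R.extendOfNorm Λ with hΦdef
  have hΦ : ∀ f, Φ (weyl f) = v f := fun f => by
    have := LinearMap.extendOfNorm_eq hdense hnorm (Finsupp.single f 1)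
    simpa [hR, hΛ] using this
  have hv : ∀ f g, v f * v g = weylPhase f g • v (f + g) := fun f g => by
    ext ψ; exact hu f g ψ
  have hone : Φ 1 = 1 := by
    rw [← weyl_zero, hΦ]; ext ψ; exact hu.zero_apply ψ
  have hstarv : ∀ f, star (v f) = v (-f) := fun f => by
    rw [ContinuousLinearMap.star_eq_adjoint]
    refine ((ContinuousLinearMap.eq_adjoint_iff _ _).mpr fun x y => ?_).symm
    change (inner ℂ (u (-f) x) y : ℂ) = inner ℂ x (u f y)
    rw [← (u f).inner_map_map, hu.apply_neg]
  have hmul1 : ∀ f a, Φ (weyl f * a) = v f * Φ a := fun f a =>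
    DFunLike.congr_fun (ccr_ext (S := Φ ∘L ContinuousLinearMap.mul ℂ (CCR d) (weyl f))
      (T := ContinuousLinearMap.mul ℂ (K →L[ℂ] K) (v f) ∘L Φ) fun g => by
        change Φ (weyl f * weyl g) = v f * Φ (weyl g)
        rw [weyl_mul, map_smul, hΦ, hΦ, hv]) a
  have hmul : ∀ a b, Φ (a * b) = Φ a * Φ b := fun a b =>
    DFunLike.congr_fun (ccr_ext (S := Φ ∘L (ContinuousLinearMap.mul ℂ (CCR d)).flip b)
      (T := (ContinuousLinearMap.mul ℂ (K →L[ℂ] K)).flip (Φ b) ∘L Φ) fun g => by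
        change Φ (weyl g * b) = Φ (weyl g) * Φ b
        rw [hmul1, hΦ]) a
  have hstar : ∀ a, Φ (star a) = star (Φ a) := fun a => by
    have := DFunLike.congr_fun (ccr_ext
      (S := ((starL ℂ : (K →L[ℂ] K) ≃L⋆[ℂ] (K →L[ℂ] K)).toContinuousLinearMap.comp
        (Φ.comp (starL ℂ : CCR d ≃L⋆[ℂ] CCR d).toContinuousLinearMap)))
      (T := Φ) fun g => by
        change star (Φ (star (weyl g))) = Φ (weyl g)
        rw [star_weyl, hΦ, hΦ, hstarv, neg_neg]) a
    change star (Φ (star a)) = Φ a at this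
    rw [← this, star_star]
  refine ⟨{ toFun := Φ, map_one' := hone, map_mul' := hmul, map_zero' := map_zero Φ,
            map_add' := map_add Φ, map_star' := hstar, commutes' := fun r => ?_ }, fun f ψ => ?_⟩
  · rw [Algebra.algebraMap_eq_smul_one, map_smul, hone, ← Algebra.algebraMap_eq_smul_one]
  · exact DFunLike.congr_fun (hΦ f) ψ

end WeylSystem

end CCR

/-! ### Exponential vectors -/

section FockSpace

variable {d : ℕ}

theorem hasSum_inner_comp (ψ φ : Fock d) :
    HasSum (fun n => (inner ℂ (comp n ψ) (comp n φ) : ℂ)) (inner ℂ ψ φ) :=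
  lp.hasSum_inner ψ.toLp φ.toLp

theorem hasSum_norm_comp_sq (ψ : Fock d) : HasSum (fun n => ‖comp n ψ‖ ^ 2) (‖ψ‖ ^ 2) := by
  have h := (hasSum_inner_comp ψ ψ).mapL reCLM
  simpa only [inner_self_eq_norm_sq_to_K, reCLM_apply, coe_algebraMap, ← ofReal_pow, ofReal_re]
    using h

theorem norm_comp_le (n : ℕ) (ψ : Fock d) : ‖comp n ψ‖ ≤ ‖ψ‖ := by
  refine (pow_le_pow_iff_left₀ (norm_nonneg _) (norm_nonneg _) two_ne_zero).mp ?_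
  rw [← (hasSum_norm_comp_sq ψ).tsum_eq]
  exact (hasSum_norm_comp_sq ψ).summable.le_tsum n fun _ _ => sq_nonneg _

theorem comp_expVector (n : ℕ) (h : L2 d) :
    comp n (expVector h) = ((Real.sqrt n.factorial : ℂ))⁻¹ • (memLp_tensorPow h n).toLp := rfl

theorem inner_toLp_eq_integral {X : Type*} [MeasurableSpace X] {μ : Measure X} {f g : X → ℂ}
    (hf : MemLp f 2 μ) (hg : MemLp g 2 μ) :
    (inner ℂ hf.toLp hg.toLp : ℂ) = ∫ x, conj (f x) * g x ∂μ := by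
  rw [L2.inner_def]
  refine integral_congr_ae ?_
  filter_upwards [hf.coeFn_toLp, hg.coeFn_toLp] with x h1 h2
  rw [h1, h2, RCLike.inner_apply, mul_comm]

theorem inner_eq_integral {X : Type*} [MeasurableSpace X] {μ : Measure X} (f g : Lp ℂ 2 μ) :
    (inner ℂ f g : ℂ) = ∫ x, conj (f x) * g x ∂μ := by
  rw [L2.inner_def]
  exact integral_congr_ae (Filter.Eventually.of_forall fun x => by
    simp only [RCLike.inner_apply, mul_comm])

theorem inner_toLp_tensorPow (h g : L2 d) (n : ℕ) :
    (inner ℂ (memLp_tensorPow h n).toLp (memLp_tensorPow g n).toLp : ℂ) = inner ℂ h g ^ n := by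
  rw [inner_toLp_eq_integral, inner_eq_integral]
  have := integral_fintype_prod_volume_eq_pow (ι := Fin n) (fun x : E d => conj (h x) * g x)
  rw [Fintype.card_fin] at this
  rw [← this]
  simp only [map_prod, Finset.prod_mul_distrib]

theorem inner_expVector (h g : L2 d) :
    (inner ℂ (expVector h) (expVector g) : ℂ) = Complex.exp (inner ℂ h g) := by
  refine (hasSum_inner_comp (expVector h) (expVector g)).unique ?_
  have := NormedSpace.expSeries_div_hasSum_exp (inner ℂ h g : ℂ)
  rw [← Complex.exp_eq_exp_ℂ] at this
  refine this.congr_fun fun n => ?_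
  rw [comp_expVector, comp_expVector, inner_smul_left, inner_smul_right, inner_toLp_tensorPow,
    map_inv₀, conj_ofReal, ← mul_assoc, ← mul_inv, ← ofReal_mul,
    Real.mul_self_sqrt (by positivity), div_eq_inv_mul, ofReal_natCast]

theorem vacuum_eq (d : ℕ) : vacuum d = expVector (0 : L2 d) := by
  refine comp_ext fun n => ?_
  rw [comp_expVector]
  have h1 : comp n (vacuum d) = ((lp.single (E := fun n => symL2 d n) 2 0 (tensorPow 0 0) :
    lp (fun n : ℕ => symL2 d n) 2) n : L2n d n) := rfl
  rw [h1]
  rcases Nat.eq_zero_or_pos n with rfl | hn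
  · rw [lp.single_apply_self]
    simp only [Nat.factorial_zero, Nat.cast_one, Real.sqrt_one, ofReal_one, inv_one, one_smul]
    rfl
  · rw [lp.single_apply_ne _ _ _ hn.ne']
    have h2 : ‖(memLp_tensorPow (0 : L2 d) n).toLp‖ = 0 := by
      have := norm_tensorPow (0 : L2 d) n
      rw [norm_zero, zero_pow hn.ne'] at this
      exact this
    rw [norm_eq_zero.mp h2, smul_zero]
    rfl

theorem norm_vacuum (d : ℕ) : ‖vacuum d‖ = 1 := by
  have h : (inner ℂ (vacuum d) (vacuum d) : ℂ) = 1 := by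
    rw [vacuum_eq, inner_expVector, inner_zero_left, Complex.exp_zero]
  rw [@norm_eq_sqrt_re_inner ℂ, h]
  simp

theorem continuous_expVector : Continuous (expVector : L2 d → Fock d) := by
  rw [continuous_iff_continuousAt]
  intro g
  rw [ContinuousAt, tendsto_iff_norm_sub_tendsto_zero]
  have h1 : ∀ h : L2 d, ‖expVector h - expVector g‖ = Real.sqrt (Complex.exp (inner ℂ h h) -
      Complex.exp (inner ℂ h g) - Complex.exp (inner ℂ g h) + Complex.exp (inner ℂ g g)).re := by
    intro h
    have h2 : (inner ℂ (expVector h - expVector g) (expVector h - expVector g) : ℂ) =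
        Complex.exp (inner ℂ h h) - Complex.exp (inner ℂ h g) - Complex.exp (inner ℂ g h) +
          Complex.exp (inner ℂ g g) := by
      rw [inner_sub_left, inner_sub_right, inner_sub_right, inner_expVector, inner_expVector,
        inner_expVector, inner_expVector]
      ring
    rw [@norm_eq_sqrt_re_inner ℂ, h2]
    rfl
  have h2 : Continuous fun h : L2 d => ‖expVector h - expVector g‖ := by
    simp only [h1]
    fun_prop
  have h3 := h2.tendsto g
  simpa using h3

/-! ### Totality of the exponential vectors -/

theorem memLp_tensor {n : ℕ} (h : Fin n → L2 d) :
    MemLp (fun x : Fin n → E d => ∏ i, h i (x i)) 2 volume := by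
  have hm : AEStronglyMeasurable (fun x : Fin n → E d => ∏ i, h i (x i)) volume := by
    refine (Finset.aestronglyMeasurable_fun_prod _ fun i _ => ?_)
    exact (Lp.aestronglyMeasurable (h i)).comp_quasiMeasurePreserving
      (Measure.quasiMeasurePreserving_eval (fun _ => volume) i)
  rw [memLp_two_iff_integrable_sq_norm hm]
  have h2 : ∀ i, Integrable (fun x => ‖h i x‖ ^ 2) (volume : Measure (E d)) := fun i =>
    (memLp_two_iff_integrable_sq_norm (Lp.aestronglyMeasurable (h i))).mp (Lp.memLp (h i))
  have := Integrable.fintype_prod (ι := Fin n) h2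
  simp only [norm_prod, ← Finset.prod_pow]
  exact this

theorem ae_comp_eval {n : ℕ} {p : E d → Prop} (h : ∀ᵐ y : E d, p y) (i : Fin n) :
    ∀ᵐ x : Fin n → E d, p (x i) :=
  (Measure.quasiMeasurePreserving_eval (fun _ : Fin n => (volume : Measure (E d))) i).ae h

/-- The tensor product `h₁ ⊗ ⋯ ⊗ h_n`, as a multilinear map. -/
def tensorMap (d n : ℕ) : MultilinearMap ℂ (fun _ : Fin n => L2 d) (L2n d n) where
  toFun h := (memLp_tensor h).toLp
  map_update_add' := by
    intro _ h i x y
    rw [← MemLp.toLp_add]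
    refine MemLp.toLp_congr _ _ ?_
    filter_upwards [ae_comp_eval (Lp.coeFn_add x y) i] with t ht
    have h1 : ∀ z : L2 d, ∏ j, (Function.update h i z j) (t j) =
        z (t i) * ∏ j ∈ Finset.univ.erase i, h j (t j) := fun z => by
      rw [← Finset.mul_prod_erase _ _ (Finset.mem_univ i), Function.update_self]
      congr 1
      refine Finset.prod_congr rfl fun j hj => ?_
      rw [Function.update_of_ne (Finset.ne_of_mem_erase hj)]
    rw [Pi.add_apply, h1, h1, h1, ht, Pi.add_apply, add_mul]
  map_update_smul' := by
    intro _ h i c x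
    rw [← MemLp.toLp_const_smul]
    refine MemLp.toLp_congr _ _ ?_
    filter_upwards [ae_comp_eval (Lp.coeFn_smul c x) i] with t ht
    have h1 : ∀ z : L2 d, ∏ j, (Function.update h i z j) (t j) =
        z (t i) * ∏ j ∈ Finset.univ.erase i, h j (t j) := fun z => by
      rw [← Finset.mul_prod_erase _ _ (Finset.mem_univ i), Function.update_self]
      congr 1
      refine Finset.prod_congr rfl fun j hj => ?_
      rw [Function.update_of_ne (Finset.ne_of_mem_erase hj)]
    rw [Pi.smul_apply, h1, h1, ht, Pi.smul_apply, smul_eq_mul, smul_eq_mul, mul_assoc]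

theorem compMeasurePreserving_tensorMap {n : ℕ} (σ : Equiv.Perm (Fin n)) (h : Fin n → L2 d) :
    Lp.compMeasurePreservingₗᵢ ℂ _ (measurePreserving_perm d n σ) (tensorMap d n h) =
      tensorMap d n (h ∘ σ.symm) := by
  apply Lp.ext
  change (Lp.compMeasurePreserving _ (measurePreserving_perm d n σ) _ : L2n d n) =ᵐ[volume] _
  refine (Lp.coeFn_compMeasurePreserving _ (measurePreserving_perm d n σ)).trans ?_
  refine ((measurePreserving_perm d n σ).quasiMeasurePreserving.ae_eq_comp
    (memLp_tensor h).coeFn_toLp).trans ?_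
  refine Filter.EventuallyEq.trans ?_ (memLp_tensor (h ∘ σ.symm)).coeFn_toLp.symm
  refine Filter.Eventually.of_forall fun x => ?_
  change ∏ i, h i (x (σ i)) = ∏ i, h (σ.symm i) (x i)
  rw [← Equiv.prod_comp σ fun i => h (σ.symm i) (x i)]
  simp only [Equiv.symm_apply_apply]

/-- Polarization: a symmetric multilinear form that vanishes on the diagonal is zero, as
`∑_ε (∏ ε_i) β(∑ ε_i h_i, …, ∑ ε_i h_i) = 2ⁿ n! β(h)`, the sum being over all signs. -/
theorem multilinear_eq_zero_of_diag {V : Type*} [AddCommGroup V] [Module ℂ V] {n : ℕ}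
    (β : MultilinearMap ℂ (fun _ : Fin n => V) ℂ)
    (hs : ∀ (σ : Equiv.Perm (Fin n)) h, β (h ∘ σ) = β h) (hd : ∀ v, β (fun _ => v) = 0)
    (h : Fin n → V) : β h = 0 := by
  classical
  let s : (Fin n → ℤˣ) → Fin n → ℂ := fun ε i => ((ε i : ℤ) : ℂ)
  have h1 : ∑ ε : Fin n → ℤˣ, (∏ i, s ε i) * β (fun _ => ∑ i, s ε i • h i) = 0 :=
    Finset.sum_eq_zero fun ε _ => by rw [hd, mul_zero]
  have h2 : ∀ ε, β (fun _ => ∑ i, s ε i • h i) =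
      ∑ φ : Fin n → Fin n, (∏ j, s ε (φ j)) * β (h ∘ φ) := fun ε => by
    rw [β.map_sum]
    refine Finset.sum_congr rfl fun φ _ => ?_
    exact β.map_smul_univ (fun j => s ε (φ j)) (fun j => h (φ j))
  have h3 : ∀ φ : Fin n → Fin n, ¬ Function.Bijective φ →
      ∑ ε : Fin n → ℤˣ, (∏ i, s ε i) * ∏ j, s ε (φ j) = 0 := by
    intro φ hφ
    rw [← Finite.surjective_iff_bijective] at hφ
    simp only [Function.Surjective, not_forall, not_exists] at hφ
    obtain ⟨k, hk⟩ := hφ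
    let flip : Equiv.Perm (Fin n → ℤˣ) := Equiv.mulLeft (Function.update 1 k (-1))
    have hfl : ∀ ε, (∏ i, s (flip ε) i) * ∏ j, s (flip ε) (φ j) =
        -((∏ i, s ε i) * ∏ j, s ε (φ j)) := by
      intro ε
      have e1 : ∏ j, s (flip ε) (φ j) = ∏ j, s ε (φ j) := by
        refine Finset.prod_congr rfl fun j _ => ?_
        simp [s, flip, Function.update_of_ne (hk j)]
      have e2 : ∏ i, s (flip ε) i = -∏ i, s ε i := by
        have : ∀ i, s (flip ε) i = (if i = k then (-1 : ℂ) else 1) * s ε i := fun i => by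
          by_cases hik : i = k
          · subst hik; simp [s, flip]
          · simp [s, flip, hik]
        simp only [this, Finset.prod_mul_distrib]
        simp
      rw [e1, e2, neg_mul]
    have h4 := Equiv.sum_comp flip (fun ε => (∏ i, s ε i) * ∏ j, s ε (φ j))
    simp only [hfl, Finset.sum_neg_distrib] at h4
    exact self_eq_neg.mp h4.symm
  have h4 : ∀ φ : Fin n → Fin n, Function.Bijective φ →
      ∑ ε : Fin n → ℤˣ, (∏ i, s ε i) * ∏ j, s ε (φ j) = 2 ^ n := by
    intro φ hφ
    have : ∀ ε, (∏ i, s ε i) * ∏ j, s ε (φ j) = 1 := fun ε => by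
      rw [hφ.prod_comp (s ε), ← Finset.prod_mul_distrib]
      refine Finset.prod_eq_one fun i _ => ?_
      rcases Int.units_eq_one_or (ε i) with hh | hh <;> simp [s, hh]
    simp only [this]
    simp
  have h5 : ∑ φ : Fin n → Fin n,
      (∑ ε : Fin n → ℤˣ, (∏ i, s ε i) * ∏ j, s ε (φ j)) * β (h ∘ φ) = 0 := by
    rw [← h1]
    simp only [h2, Finset.mul_sum, Finset.sum_mul, ← mul_assoc]
    exact Finset.sum_comm
  have h6 : ∀ φ : Fin n → Fin n,
      (∑ ε : Fin n → ℤˣ, (∏ i, s ε i) * ∏ j, s ε (φ j)) * β (h ∘ φ) =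
        if Function.Bijective φ then 2 ^ n * β h else 0 := by
    intro φ
    split_ifs with hφ
    · rw [h4 φ hφ, ← hs (Equiv.ofBijective φ hφ) h]; rfl
    · rw [h3 φ hφ, zero_mul]
  simp only [h6] at h5
  rw [← Finset.sum_filter, Finset.sum_const, nsmul_eq_mul] at h5
  have hc : ((Finset.univ.filter fun φ : Fin n → Fin n => Function.Bijective φ).card : ℂ) ≠ 0 := by
    rw [Nat.cast_ne_zero, Finset.card_ne_zero]
    exact ⟨id, Finset.mem_filter.mpr ⟨Finset.mem_univ _, Function.bijective_id⟩⟩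
  exact (mul_eq_zero.mp ((mul_eq_zero.mp h5).resolve_left hc)).resolve_left (by positivity)

/-- The products of functions of one variable are total in `L²` of the product space. -/
theorem eq_zero_of_inner_tensorMap_eq_zero {n : ℕ} (ψ : L2n d n)
    (h : ∀ g, (inner ℂ ψ (tensorMap d n g) : ℂ) = 0) : ψ = 0 := by
  let B : ℕ → Set (Fin n → E d) := fun R => Set.univ.pi fun _ => Metric.ball 0 R
  have hBm : ∀ R, MeasurableSet (B R) := fun R =>
    MeasurableSet.univ_pi fun _ => Metric.isOpen_ball.measurableSet
  have hBfin : ∀ R, volume (B R) < ⊤ := fun R => by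
    rw [volume_pi_pi]
    exact ENNReal.prod_lt_top fun i _ => Metric.isBounded_ball.measure_lt_top
  let F : (Fin n → E d) → ℂ := fun x => conj (ψ x)
  have hF2 : MemLp F 2 volume := (Lp.memLp ψ).star
  have hFint : ∀ R, IntegrableOn F (B R) := fun R => by
    have : IsFiniteMeasure (volume.restrict (B R)) := ⟨by simpa using hBfin R⟩
    exact (hF2.restrict (B R)).integrable (by norm_num)
  have hbox : ∀ R (A : Fin n → Set (E d)), (∀ i, MeasurableSet (A i)) →
      ∫ x in Set.univ.pi A, F x ∂(volume.restrict (B R)) = 0 := by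
    intro R A hA
    have hfin : ∀ i, volume (A i ∩ Metric.ball 0 (R : ℝ)) ≠ ⊤ := fun i =>
      ((measure_mono Set.inter_subset_right).trans_lt Metric.isBounded_ball.measure_lt_top).ne
    have hAm : ∀ i, MeasurableSet (A i ∩ Metric.ball 0 (R : ℝ)) := fun i =>
      (hA i).inter Metric.isOpen_ball.measurableSet
    let g : Fin n → L2 d := fun i => indicatorConstLp 2 (hAm i) (hfin i) (1 : ℂ)
    have hset : Set.univ.pi A ∩ B R = Set.univ.pi fun i => A i ∩ Metric.ball 0 (R : ℝ) :=
      Set.pi_inter_distrib.symm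
    have hpm : MeasurableSet (Set.univ.pi fun i => A i ∩ Metric.ball 0 (R : ℝ)) :=
      MeasurableSet.univ_pi hAm
    rw [Measure.restrict_restrict (MeasurableSet.univ_pi hA), hset, ← integral_indicator hpm,
      ← h g, inner_eq_integral]
    refine integral_congr_ae ?_
    have hg : ∀ᵐ x : Fin n → E d, ∀ i, g i (x i) =
        (A i ∩ Metric.ball 0 (R : ℝ)).indicator (fun _ => (1 : ℂ)) (x i) :=
      ae_all_iff.mpr fun i => ae_comp_eval indicatorConstLp_coeFn i
    filter_upwards [hg, (memLp_tensor g).coeFn_toLp] with x hx hx2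
    have hx3 : tensorMap d n g x = ∏ i, g i (x i) := hx2
    rw [hx3]
    by_cases hxA : x ∈ Set.univ.pi fun i => A i ∩ Metric.ball 0 (R : ℝ)
    · rw [Set.indicator_of_mem hxA, Finset.prod_eq_one, mul_one]
      intro i _
      rw [hx i, Set.indicator_of_mem (hxA i (Set.mem_univ i))]
    · rw [Set.indicator_of_notMem hxA]
      simp only [Set.mem_univ_pi, not_forall] at hxA
      obtain ⟨i, hi⟩ := hxA
      rw [Finset.prod_eq_zero (Finset.mem_univ i), mul_zero]
      rw [hx i, Set.indicator_of_notMem hi]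
  have hall : ∀ R (s : Set (Fin n → E d)), MeasurableSet s →
      ∫ x in s, F x ∂(volume.restrict (B R)) = 0 := by
    intro R s hs
    refine MeasurableSpace.induction_on_inter
      (C := fun s _ => ∫ x in s, F x ∂(volume.restrict (B R)) = 0) generateFrom_pi.symm
      isPiSystem_pi ?_ ?_ ?_ ?_ s hs
    · simp
    · rintro _ ⟨A, hA, rfl⟩
      exact hbox R A fun i => hA i (Set.mem_univ i)
    · intro t ht ih
      have h0 := hbox R (fun _ => Set.univ) fun _ => MeasurableSet.univ
      rw [Set.pi_univ, setIntegral_univ] at h0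
      have := integral_add_compl ht (hFint R)
      rw [ih, zero_add, h0] at this
      exact this
    · intro f hdisj hm ih
      rw [integral_iUnion hm hdisj (hFint R).integrableOn]
      simp [ih]
  have hae : ∀ R, ∀ᵐ x, x ∈ B R → F x = 0 := fun R => by
    rw [← ae_restrict_iff' (hBm R)]
    exact Integrable.ae_eq_zero_of_forall_setIntegral_eq_zero (hFint R) fun s hs _ => hall R s hs
  apply Lp.ext
  filter_upwards [ae_all_iff.mpr hae, Lp.coeFn_zero ℂ 2 (volume : Measure (Fin n → E d))]
    with x hx h0
  rw [h0]
  obtain ⟨R, hR⟩ := exists_nat_gt ‖x‖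
  have hx0 : F x = 0 := hx R fun i _ => by
    rw [mem_ball_zero_iff]
    exact (norm_le_pi_norm x i).trans_lt hR
  simpa [F] using hx0

theorem eq_zero_of_inner_tensorPow_eq_zero {n : ℕ} (ψ : symL2 d n)
    (h : ∀ g : L2 d, (inner ℂ (ψ : L2n d n) (memLp_tensorPow g n).toLp : ℂ) = 0) : ψ = 0 := by
  refine Subtype.ext (eq_zero_of_inner_tensorMap_eq_zero _ fun g => ?_)
  refine multilinear_eq_zero_of_diag
    ((innerSL ℂ (ψ : L2n d n)).toLinearMap.compMultilinearMap (tensorMap d n)) (fun σ g => ?_) h g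
  change (inner ℂ (ψ : L2n d n) (tensorMap d n (g ∘ σ)) : ℂ) =
    inner ℂ (ψ : L2n d n) (tensorMap d n g)
  rw [← (Lp.compMeasurePreservingₗᵢ ℂ _ (measurePreserving_perm d n σ)).inner_map_map,
    compMeasurePreserving_tensorMap, ψ.2 σ, Function.comp_assoc, Equiv.self_comp_symm,
    Function.comp_id]

theorem coeff_eq_zero_of_hasSum_zero {a : ℕ → ℂ} (h : ∀ z : ℂ, HasSum (fun n => z ^ n * a n) 0)
    (n : ℕ) : a n = 0 := by
  have h1 : HasFPowerSeriesAt (0 : ℂ → ℂ) (FormalMultilinearSeries.ofScalars ℂ a) 0 := by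
    rw [hasFPowerSeriesAt_iff]
    refine Filter.Eventually.of_forall fun z => ?_
    simpa [FormalMultilinearSeries.coeff_ofScalars] using h z
  have h2 : (FormalMultilinearSeries.ofScalars ℂ a).coeff n = 0 := by
    rw [h1.eq_zero]; rfl
  rwa [FormalMultilinearSeries.coeff_ofScalars] at h2

/-- The exponential vectors are total: `⟨ψ, ε(z h)⟩` is a power series in `z` whose coefficients
are the multiples of `⟨ψ⁽ⁿ⁾, h^{⊗n}⟩`. -/
theorem dense_span_expVector (d : ℕ) :
    Dense (Submodule.span ℂ (Set.range (expVector : L2 d → Fock d)) : Set (Fock d)) := by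
  rw [Submodule.dense_iff_topologicalClosure_eq_top,
    Submodule.topologicalClosure_eq_top_iff, Submodule.eq_bot_iff]
  intro ψ hψ
  have h0 : ∀ g : L2 d, (inner ℂ ψ (expVector g) : ℂ) = 0 := fun g =>
    Submodule.inner_left_of_mem_orthogonal
      (Submodule.subset_span (Set.mem_range_self g)) hψ
  refine comp_ext fun n => ?_
  rw [map_zero]
  have h1 : ∀ g : L2 d, (inner ℂ (comp n ψ) (memLp_tensorPow g n).toLp : ℂ) = 0 := by
    intro g
    have h2 : ∀ z : ℂ, HasSum (fun n => z ^ n *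
        (((Real.sqrt n.factorial : ℂ))⁻¹ *
          (inner ℂ (comp n ψ) (memLp_tensorPow g n).toLp : ℂ))) 0 := by
      intro z
      rw [← h0 (z • g)]
      refine (hasSum_inner_comp ψ (expVector (z • g))).congr_fun fun n => ?_
      have h3 : (memLp_tensorPow (z • g) n).toLp = z ^ n • (memLp_tensorPow g n).toLp := by
        have := (tensorMap d n).map_smul_univ (fun _ => z) (fun _ => g)
        rw [Finset.prod_const, Finset.card_univ, Fintype.card_fin] at this
        exact this
      rw [comp_expVector, h3, inner_smul_right, inner_smul_right]
      ring
    have h4 := coeff_eq_zero_of_hasSum_zero h2 n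
    refine (mul_eq_zero.mp h4).resolve_left (inv_ne_zero ?_)
    rw [ofReal_ne_zero]
    positivity
  exact congrArg Subtype.val (eq_zero_of_inner_tensorPow_eq_zero (ψ.toLp n) h1)

theorem denseRange_toL2 (d : ℕ) : DenseRange (toL2 : Test d → L2 d) := by
  intro f
  refine (mem_closure_iff_nhds_basis Metric.nhds_basis_closedBall).2 fun ε hε => ?_
  obtain ⟨g, hg₁, hg₂, hg₃⟩ := MemLp.exist_eLpNorm_sub_le (by norm_num) (by norm_num)
    (Lp.memLp f) hε
  let G : Test d := ⟨g, hg₂, hg₁, by simp⟩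
  refine ⟨toL2 G, ⟨G, rfl⟩, ?_⟩
  have : (f : E d → ℂ) - (toL2 G : E d → ℂ) =ᵐ[volume] (f : E d → ℂ) - g := by
    filter_upwards [G.memLp.coeFn_toLp] with x hx
    rw [Pi.sub_apply, Pi.sub_apply]
    congr 1
  rw [Metric.mem_closedBall', Lp.dist_def, eLpNorm_congr_ae this]
  exact ENNReal.toReal_le_of_le_ofReal hε.le hg₃

theorem dense_span_expVector_test {c : ℂ} (hc : c ≠ 0) :
    Dense (Submodule.span ℂ (Set.range fun f : Test d => expVector (c • toL2 f)) :
      Set (Fock d)) := by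
  rw [Submodule.dense_iff_topologicalClosure_eq_top, eq_top_iff,
    ← Submodule.dense_iff_topologicalClosure_eq_top.mp (dense_span_expVector d)]
  refine Submodule.topologicalClosure_minimal _ (Submodule.span_le.mpr ?_)
    (Submodule.isClosed_topologicalClosure _)
  rintro _ ⟨h, rfl⟩
  have hcl : IsClosed {g : L2 d | expVector (c • g) ∈
      (Submodule.span ℂ (Set.range fun f : Test d => expVector (c • toL2 f))).topologicalClosure} :=
    (Submodule.isClosed_topologicalClosure _).preimage
      (continuous_expVector.comp (continuous_const_smul c))
  have h1 := (denseRange_toL2 d).induction (P := fun g => expVector (c • g) ∈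
      (Submodule.span ℂ (Set.range fun f : Test d => expVector (c • toL2 f))).topologicalClosure)
      (by
        rintro _ ⟨f, rfl⟩
        exact Submodule.le_topologicalClosure _ (Submodule.subset_span ⟨f, rfl⟩)) hcl (c⁻¹ • h)
  rwa [smul_smul, mul_inv_cancel₀ hc, one_smul] at h1

end FockSpace

/-! ### Weyl operators on Fock space -/

section FockWeyl

variable {d : ℕ}

theorem exists_fockWeyl (u : L2 d) : ∃ V : Fock d ≃ₗᵢ[ℂ] Fock d, ∀ h, V (expVector h) =
    Complex.exp (-(‖u‖ ^ 2 / 2 : ℝ) - inner ℂ u h) • expVector (h + u) := by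
  refine exists_unitary_of_inner_eq (expVector (d := d))
    (fun h => Complex.exp (-(‖u‖ ^ 2 / 2 : ℝ) - inner ℂ u h) • expVector (h + u))
    (dense_span_expVector d) ((dense_span_expVector d).mono ?_) fun h g => ?_
  · refine Submodule.span_le.mpr ?_
    rintro _ ⟨h, rfl⟩
    have h1 : expVector h = (Complex.exp (-(‖u‖ ^ 2 / 2 : ℝ) - inner ℂ u (h - u)))⁻¹ •
        (Complex.exp (-(‖u‖ ^ 2 / 2 : ℝ) - inner ℂ u (h - u)) • expVector (h - u + u)) := by
      rw [smul_smul, inv_mul_cancel₀ (Complex.exp_ne_zero _), one_smul, sub_add_cancel]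
    rw [h1]
    exact Submodule.smul_mem _ _ (Submodule.subset_span ⟨h - u, rfl⟩)
  · rw [inner_smul_left, inner_smul_right, inner_expVector, inner_expVector, ← Complex.exp_conj,
      ← Complex.exp_add, ← Complex.exp_add]
    congr 1
    have h2 : (inner ℂ u u : ℂ) = (‖u‖ : ℂ) ^ 2 := inner_self_eq_norm_sq_to_K u
    rw [map_sub, inner_conj_symm, map_neg, conj_ofReal, inner_add_left, inner_add_right,
      inner_add_right, h2]
    push_cast
    ring

/-- The Weyl operator `e^{a*(u) - a(u)}` on Fock space. -/
def fockWeyl (u : L2 d) : Fock d ≃ₗᵢ[ℂ] Fock d := (exists_fockWeyl u).choose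

theorem fockWeyl_expVector (u h : L2 d) : fockWeyl u (expVector h) =
    Complex.exp (-(‖u‖ ^ 2 / 2 : ℝ) - inner ℂ u h) • expVector (h + u) :=
  (exists_fockWeyl u).choose_spec h

/-- A unitary, as an element of the algebra of bounded operators. -/
abbrev opOf {K L : Type*} [NormedAddCommGroup K] [InnerProductSpace ℂ K]
    [NormedAddCommGroup L] [InnerProductSpace ℂ L] (V : K ≃ₗᵢ[ℂ] L) : K →L[ℂ] L :=
  V.toContinuousLinearEquiv.toContinuousLinearMap

theorem fockWeyl_mul (u u' : L2 d) (ψ : Fock d) : fockWeyl u (fockWeyl u' ψ) =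
    Complex.exp (-(I * ((inner ℂ u u' : ℂ).im : ℝ))) • fockWeyl (u + u') ψ := by
  refine DFunLike.congr_fun (eq_of_eqOn_total (dense_span_expVector d)
    (S := opOf (fockWeyl u) ∘L opOf (fockWeyl u'))
    (T := Complex.exp (-(I * ((inner ℂ u u' : ℂ).im : ℝ))) • opOf (fockWeyl (u + u')))
    fun h => ?_) ψ
  change fockWeyl u (fockWeyl u' (expVector h)) =
    Complex.exp (-(I * ((inner ℂ u u' : ℂ).im : ℝ))) • fockWeyl (u + u') (expVector h)
  rw [fockWeyl_expVector, map_smul, fockWeyl_expVector, fockWeyl_expVector, smul_smul, smul_smul,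
    ← Complex.exp_add, ← Complex.exp_add, add_assoc h, add_comm u' u]
  congr 2
  have h2 : ∀ u : L2 d, (‖u‖ : ℂ) ^ 2 = inner ℂ u u := fun u =>
    (inner_self_eq_norm_sq_to_K u).symm
  have h3 : (inner ℂ u u' : ℂ) - inner ℂ u' u = 2 * (I * ((inner ℂ u u' : ℂ).im : ℝ)) := by
    rw [← inner_conj_symm u' u, Complex.sub_conj]
    push_cast
    ring
  push_cast
  rw [h2, h2, h2, inner_add_left, inner_add_right, inner_add_right, inner_add_left,
    inner_add_right, show I * ((inner ℂ u u' : ℂ).im : ℂ) =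
      ((inner ℂ u u' : ℂ) - inner ℂ u' u) / 2 by rw [h3]; ring]
  ring

theorem fockWeyl_zero (ψ : Fock d) : fockWeyl 0 ψ = ψ := by
  refine (fockWeyl 0).injective ?_
  rw [fockWeyl_mul, inner_zero_left]
  simp

theorem fockWeyl_symm (u : L2 d) (ψ : Fock d) : (fockWeyl u).symm ψ = fockWeyl (-u) ψ := by
  have h : (inner ℂ u (-u) : ℂ).im = 0 := by
    rw [inner_neg_right, Complex.neg_im, neg_eq_zero]
    exact inner_self_im (𝕜 := ℂ) u
  rw [LinearIsometryEquiv.symm_apply_eq, fockWeyl_mul, h, add_neg_cancel, fockWeyl_zero]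
  simp

theorem fockWeyl_comm (u u' : L2 d) (ψ : Fock d) : fockWeyl u (fockWeyl u' ψ) =
    Complex.exp (-(2 * I * ((inner ℂ u u' : ℂ).im : ℝ))) • fockWeyl u' (fockWeyl u ψ) := by
  rw [fockWeyl_mul, fockWeyl_mul, smul_smul, ← Complex.exp_add, add_comm u' u]
  congr 2
  rw [← inner_conj_symm u' u, Complex.conj_im]
  push_cast
  ring

/-- Strong convergence of unitaries may be tested on a total set. -/
theorem tendsto_unitary_of_total {K X ι : Type*} [NormedAddCommGroup K] [InnerProductSpace ℂ K]
    {e : X → K} (he : Dense (Submodule.span ℂ (Set.range e) : Set K)) {l : Filter ι}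
    {T : ι → K ≃ₗᵢ[ℂ] K} {S : K ≃ₗᵢ[ℂ] K}
    (h : ∀ x, Filter.Tendsto (fun i => T i (e x)) l (nhds (S (e x)))) (ψ : K) :
    Filter.Tendsto (fun i => T i ψ) l (nhds (S ψ)) := by
  have h1 : ∀ ψ ∈ Submodule.span ℂ (Set.range e),
      Filter.Tendsto (fun i => T i ψ) l (nhds (S ψ)) := by
    intro ψ hψ
    induction hψ using Submodule.span_induction with
    | mem x hx => obtain ⟨x, rfl⟩ := hx; exact h x
    | zero => simpa using tendsto_const_nhds
    | add x y _ _ hx hy => simpa only [map_add] using hx.add hy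
    | smul c x _ hx => simpa only [map_smul] using hx.const_smul c
  rw [Metric.tendsto_nhds]
  intro ε hε
  obtain ⟨φ, hφ, hd⟩ := Metric.dense_iff.mp he ψ (ε / 3) (by positivity)
  rw [Metric.mem_ball, dist_comm] at hφ
  filter_upwards [Metric.tendsto_nhds.mp (h1 φ hd) (ε / 3) (by positivity)] with i hi
  calc dist (T i ψ) (S ψ) ≤ dist (T i ψ) (T i φ) + dist (T i φ) (S φ) + dist (S φ) (S ψ) :=
        dist_triangle4 _ _ _ _
    _ < ε / 3 + ε / 3 + ε / 3 := by
        rw [LinearIsometryEquiv.dist_map, LinearIsometryEquiv.dist_map, dist_comm φ ψ]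
        gcongr
    _ = ε := by ring

theorem tendsto_fockWeyl_zero (ψ : Fock d) :
    Filter.Tendsto (fun u : L2 d => fockWeyl u ψ) (nhds 0) (nhds ψ) := by
  have := tendsto_unitary_of_total (dense_span_expVector d) (l := nhds (0 : L2 d))
    (T := fockWeyl) (S := fockWeyl 0) (fun h => ?_) ψ
  · rwa [fockWeyl_zero] at this
  · simp only [fockWeyl_expVector]
    have h1 : Continuous fun u : L2 d =>
        Complex.exp (-(‖u‖ ^ 2 / 2 : ℝ) - (inner ℂ u h : ℂ)) := by fun_prop
    have h2 : Continuous fun u : L2 d => expVector (h + u) :=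
      continuous_expVector.comp (continuous_const.add continuous_id)
    exact (h1.smul h2).tendsto 0

end FockWeyl

/-! ### The second quantization as a generator -/

section SecondQuantization

section Mul

variable {X : Type*} [MeasurableSpace X] {μ : Measure X}

theorem norm_sq_eq_integral (f : Lp ℂ 2 μ) : ‖f‖ ^ 2 = ∫ x, ‖f x‖ ^ 2 ∂μ := by
  have h1 := inner_self_eq_norm_sq_to_K (𝕜 := ℂ) f
  rw [inner_eq_integral] at h1
  have h2 : ∀ x, conj (f x) * f x = ((‖f x‖ ^ 2 : ℝ) : ℂ) := fun x => by
    rw [mul_comm, Complex.mul_conj, Complex.normSq_eq_norm_sq]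
  simp only [h2] at h1
  rw [integral_complex_ofReal] at h1
  refine ofReal_injective (h1.trans ?_).symm
  simp

theorem tendsto_norm_zero_of_sq {F ι : Type*} [SeminormedAddCommGroup F] {l : Filter ι}
    {f : ι → F} (h : Filter.Tendsto (fun i => ‖f i‖ ^ 2) l (nhds 0)) :
    Filter.Tendsto (fun i => ‖f i‖) l (nhds 0) := by
  simpa only [Real.sqrt_sq (norm_nonneg _), Real.sqrt_zero] using h.sqrt

/-- Dominated convergence in `L²`. -/
theorem tendsto_norm_sq_zero_of_dominated {ι : Type*} {l : Filter ι} [l.IsCountablyGenerated]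
    {F : ι → Lp ℂ 2 μ} {f : ι → X → ℂ} (hF : ∀ i, F i =ᵐ[μ] f i) (g : Lp ℂ 2 μ) (C : ℝ)
    (hb : ∀ᶠ i in l, ∀ᵐ x ∂μ, ‖f i x‖ ≤ C * ‖g x‖)
    (hl : ∀ᵐ x ∂μ, Filter.Tendsto (fun i => f i x) l (nhds 0)) :
    Filter.Tendsto (fun i => ‖F i‖ ^ 2) l (nhds 0) := by
  have h1 : ∀ i, ‖F i‖ ^ 2 = ∫ x, ‖f i x‖ ^ 2 ∂μ := fun i => by
    rw [norm_sq_eq_integral]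
    refine integral_congr_ae ?_
    filter_upwards [hF i] with x hx
    rw [hx]
  simp only [h1]
  rw [show (0 : ℝ) = ∫ x, (0 : ℝ) ∂μ by simp]
  refine tendsto_integral_filter_of_dominated_convergence (fun x => C ^ 2 * ‖g x‖ ^ 2) ?_ ?_ ?_ ?_
  · refine Filter.Eventually.of_forall fun i => ?_
    exact (((Lp.aestronglyMeasurable (F i)).congr (hF i)).norm.pow 2)
  · filter_upwards [hb] with i hi
    filter_upwards [hi] with x hx
    rw [Real.norm_of_nonneg (by positivity), ← mul_pow]
    exact pow_le_pow_left₀ (norm_nonneg _) hx 2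
  · exact ((memLp_two_iff_integrable_sq_norm (Lp.aestronglyMeasurable g)).mp
      (Lp.memLp g)).const_mul _
  · filter_upwards [hl] with x hx
    simpa using hx.norm.pow 2

theorem memLp_unimodular_mul {b : X → ℂ} (hb : AEStronglyMeasurable b μ) (h1 : ∀ x, ‖b x‖ = 1)
    (f : Lp ℂ 2 μ) : MemLp (fun x => b x * f x) 2 μ :=
  (Lp.memLp f).of_le (hb.mul (Lp.aestronglyMeasurable f))
    (Filter.Eventually.of_forall fun x => by rw [norm_mul, h1, one_mul])

/-- Multiplication by a unimodular function, as an isometry of `L²`. -/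
def unimodularMul (b : X → ℂ) (hb : AEStronglyMeasurable b μ) (h1 : ∀ x, ‖b x‖ = 1) :
    Lp ℂ 2 μ →ₗᵢ[ℂ] Lp ℂ 2 μ where
  toFun f := (memLp_unimodular_mul hb h1 f).toLp
  map_add' f g := by
    rw [← MemLp.toLp_add]
    refine MemLp.toLp_congr _ _ ?_
    filter_upwards [Lp.coeFn_add f g] with x hx
    rw [hx, Pi.add_apply, Pi.add_apply, mul_add]
  map_smul' c f := by
    rw [RingHom.id_apply, ← MemLp.toLp_const_smul]
    refine MemLp.toLp_congr _ _ ?_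
    filter_upwards [Lp.coeFn_smul c f] with x hx
    rw [hx, Pi.smul_apply, Pi.smul_apply, smul_eq_mul, smul_eq_mul]
    ring
  norm_map' f := by
    change ‖(memLp_unimodular_mul hb h1 f).toLp‖ = ‖f‖
    rw [Lp.norm_toLp, Lp.norm_def]
    congr 1
    exact eLpNorm_congr_norm_ae (Filter.Eventually.of_forall fun x => by
      rw [norm_mul, h1, one_mul])

theorem coeFn_unimodularMul (b : X → ℂ) (hb : AEStronglyMeasurable b μ) (h1 : ∀ x, ‖b x‖ = 1)
    (f : Lp ℂ 2 μ) : unimodularMul b hb h1 f =ᵐ[μ] fun x => b x * f x :=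
  (memLp_unimodular_mul hb h1 f).coeFn_toLp

end Mul

variable {d : ℕ} (w : Dispersion d)

namespace Dispersion

/-- The total energy `ϖ(x₁) + ⋯ + ϖ(x_n)` on the `n`-particle sector. -/
def energy (n : ℕ) (x : Fin n → E d) : ℝ := ∑ i, w.toFun (x i)

theorem continuous_energy (n : ℕ) : Continuous (w.energy n) :=
  continuous_finsetSum _ fun i _ => w.smooth.continuous.comp (continuous_apply i)

theorem ofReal_energy (n : ℕ) (x : Fin n → E d) :
    (w.energy n x : ℂ) = ∑ i, (w.toFun (x i) : ℂ) := by
  rw [energy, ofReal_sum]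

theorem norm_phase (t : ℝ) (k : E d) : ‖w.phase t k‖ = 1 := by
  rw [phase, mul_assoc, ← ofReal_mul, mul_comm, Complex.norm_exp_ofReal_mul_I]

theorem continuous_phase (t : ℝ) : Continuous (w.phase t) := (w.phase_smooth t).continuous

theorem phase_add (s t : ℝ) (k : E d) : w.phase (s + t) k = w.phase s k * w.phase t k := by
  rw [phase, phase, phase, ← Complex.exp_add]
  push_cast
  ring_nf

theorem phase_zero (k : E d) : w.phase 0 k = 1 := by
  rw [phase]; simp

theorem conj_phase (t : ℝ) (k : E d) : conj (w.phase t k) = w.phase (-t) k := by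
  rw [phase, phase, ← Complex.exp_conj]
  simp

/-- Multiplication by `e^{itϖ}` on the one-particle space. -/
def phaseMul (t : ℝ) : L2 d →ₗᵢ[ℂ] L2 d :=
  unimodularMul (w.phase t) (w.continuous_phase t).aestronglyMeasurable (w.norm_phase t)

theorem coeFn_phaseMul (t : ℝ) (f : L2 d) : w.phaseMul t f =ᵐ[volume] fun k => w.phase t k * f k :=
  coeFn_unimodularMul _ _ _ f

theorem phaseMul_add (s t : ℝ) (f : L2 d) :
    w.phaseMul (s + t) f = w.phaseMul s (w.phaseMul t f) := by
  apply Lp.ext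
  filter_upwards [w.coeFn_phaseMul (s + t) f, w.coeFn_phaseMul s (w.phaseMul t f),
    w.coeFn_phaseMul t f] with k h1 h2 h3
  rw [h1, h2, h3, phase_add, mul_assoc]

theorem phaseMul_zero (f : L2 d) : w.phaseMul 0 f = f := by
  apply Lp.ext
  filter_upwards [w.coeFn_phaseMul 0 f] with k h1
  rw [h1, phase_zero, one_mul]

theorem phaseMul_toL2 (t : ℝ) (f : Test d) :
    w.phaseMul t (toL2 f) = toL2 (mulTest (w.phase t) (w.phase_smooth t) f) := by
  apply Lp.ext
  filter_upwards [w.coeFn_phaseMul t (toL2 f), f.memLp.coeFn_toLp,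
    (mulTest (w.phase t) (w.phase_smooth t) f).memLp.coeFn_toLp] with k h1 h2 h3
  have h2' : toL2 f k = f k := h2
  have h3' : toL2 (mulTest (w.phase t) (w.phase_smooth t) f) k = w.phase t k * f k := h3
  rw [h1, h2', h3']

theorem continuous_phaseMul (f : L2 d) : Continuous fun t => w.phaseMul t f := by
  rw [continuous_iff_continuousAt]
  intro s
  rw [ContinuousAt, tendsto_iff_norm_sub_tendsto_zero]
  refine tendsto_norm_zero_of_sq (tendsto_norm_sq_zero_of_dominated
    (f := fun t k => (w.phase t k - w.phase s k) * f k) (fun t => ?_) f 2 ?_ ?_)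
  · filter_upwards [Lp.coeFn_sub (w.phaseMul t f) (w.phaseMul s f), w.coeFn_phaseMul t f,
      w.coeFn_phaseMul s f] with k h1 h2 h3
    rw [h1, Pi.sub_apply, h2, h3, sub_mul]
  · refine Filter.Eventually.of_forall fun t => Filter.Eventually.of_forall fun k => ?_
    rw [norm_mul]
    gcongr
    refine (norm_sub_le _ _).trans ?_
    rw [norm_phase, norm_phase]
    norm_num
  · refine Filter.Eventually.of_forall fun k => ?_
    have h1 : Continuous fun t => (w.phase t k - w.phase s k) * f k := by
      unfold phase
      fun_prop
    simpa using h1.tendsto s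

theorem exists_secondQuant (t : ℝ) : ∃ V : Fock d ≃ₗᵢ[ℂ] Fock d, ∀ h,
    V (expVector h) = expVector (w.phaseMul t h) := by
  refine exists_unitary_of_inner_eq (expVector (d := d)) (fun h => expVector (w.phaseMul t h))
    (dense_span_expVector d) ((dense_span_expVector d).mono ?_) fun h g => ?_
  · refine Submodule.span_mono ?_
    rintro _ ⟨h, rfl⟩
    refine ⟨w.phaseMul (-t) h, ?_⟩
    change expVector (w.phaseMul t (w.phaseMul (-t) h)) = _
    rw [← phaseMul_add, add_neg_cancel, phaseMul_zero]
  · rw [inner_expVector, inner_expVector, LinearIsometry.inner_map_map]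

/-- The free dynamics `Γ(e^{itϖ})` on Fock space. -/
def secondQuant (t : ℝ) : Fock d ≃ₗᵢ[ℂ] Fock d := (w.exists_secondQuant t).choose

theorem secondQuant_expVector (t : ℝ) (h : L2 d) :
    w.secondQuant t (expVector h) = expVector (w.phaseMul t h) :=
  (w.exists_secondQuant t).choose_spec h

theorem secondQuant_add (s t : ℝ) (ψ : Fock d) :
    w.secondQuant (s + t) ψ = w.secondQuant s (w.secondQuant t ψ) :=
  unitary_eq_of_eqOn_total (dense_span_expVector d) (S := w.secondQuant (s + t))
    (T := (w.secondQuant t).trans (w.secondQuant s)) (fun h => by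
      rw [LinearIsometryEquiv.trans_apply, secondQuant_expVector, secondQuant_expVector,
        secondQuant_expVector, phaseMul_add]) ψ

theorem secondQuant_zero (ψ : Fock d) : w.secondQuant 0 ψ = ψ := by
  refine (w.secondQuant 0).injective ?_
  rw [← secondQuant_add, add_zero]

theorem continuous_secondQuant (ψ : Fock d) : Continuous fun t => w.secondQuant t ψ := by
  rw [continuous_iff_continuousAt]
  intro s
  refine tendsto_unitary_of_total (dense_span_expVector d) (fun h => ?_) ψ
  simp only [secondQuant_expVector]
  exact (continuous_expVector.comp (w.continuous_phaseMul h)).tendsto s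

theorem secondQuant_vacuum (t : ℝ) : w.secondQuant t (vacuum d) = vacuum d := by
  rw [vacuum_eq, secondQuant_expVector, map_zero]

theorem secondQuant_fockWeyl (t : ℝ) (u : L2 d) (ψ : Fock d) :
    w.secondQuant t (fockWeyl u ψ) = fockWeyl (w.phaseMul t u) (w.secondQuant t ψ) :=
  unitary_eq_of_eqOn_total (dense_span_expVector d) (S := (fockWeyl u).trans (w.secondQuant t))
    (T := (w.secondQuant t).trans (fockWeyl (w.phaseMul t u))) (fun h => by
      rw [LinearIsometryEquiv.trans_apply, LinearIsometryEquiv.trans_apply, fockWeyl_expVector,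
        map_smul, secondQuant_expVector, secondQuant_expVector, fockWeyl_expVector, map_add,
        LinearIsometry.norm_map, LinearIsometry.inner_map_map]) ψ

theorem continuous_sectorPhase (n : ℕ) (t : ℝ) :
    Continuous fun x => Complex.exp (I * t * w.energy n x) := by
  have := w.continuous_energy n
  fun_prop

theorem norm_sectorPhase (n : ℕ) (t : ℝ) (x : Fin n → E d) :
    ‖Complex.exp (I * t * w.energy n x)‖ = 1 := by
  rw [mul_assoc, ← ofReal_mul, mul_comm, Complex.norm_exp_ofReal_mul_I]

/-- The projection onto the `n`-particle sector, as a bounded operator. -/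
def _root_.VanHove.compL (d n : ℕ) : Fock d →L[ℂ] L2n d n :=
  (comp n).mkContinuous 1 fun ψ => by rw [one_mul]; exact norm_comp_le n ψ

theorem comp_secondQuant (n : ℕ) (t : ℝ) (ψ : Fock d) : comp n (w.secondQuant t ψ) =ᵐ[volume]
    fun x => Complex.exp (I * t * w.energy n x) * comp n ψ x := by
  let M := unimodularMul (μ := (volume : Measure (Fin n → E d))) _
    (w.continuous_sectorPhase n t).aestronglyMeasurable (w.norm_sectorPhase n t)
  have h1 : comp n (w.secondQuant t ψ) = M (comp n ψ) :=
    DFunLike.congr_fun (eq_of_eqOn_total (dense_span_expVector d)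
      (S := compL d n ∘L opOf (w.secondQuant t)) (T := M.toContinuousLinearMap ∘L compL d n)
      fun h => by
        change comp n (w.secondQuant t (expVector h)) = M (comp n (expVector h))
        rw [secondQuant_expVector, comp_expVector, comp_expVector, map_smul]
        congr 1
        apply Lp.ext
        filter_upwards [(memLp_tensorPow (w.phaseMul t h) n).coeFn_toLp,
          coeFn_unimodularMul _ (w.continuous_sectorPhase n t).aestronglyMeasurable
            (w.norm_sectorPhase n t) (memLp_tensorPow h n).toLp,
          (memLp_tensorPow h n).coeFn_toLp,
          ae_all_iff.mpr fun i : Fin n => ae_comp_eval (w.coeFn_phaseMul t h) i] with x h1 h2 h3 h4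
        rw [h1, h2, h3]
        simp only [h4, Finset.prod_mul_distrib]
        congr 1
        simp only [phase]
        rw [← Complex.exp_sum, ← Finset.mul_sum, ofReal_energy]) ψ
  rw [h1]
  exact coeFn_unimodularMul _ _ _ _

/-- If `dΓ(ϖ)ψ = φ`, the difference quotients of `Γ(e^{itϖ})ψ` converge in each sector, being
dominated by `2 |φ⁽ⁿ⁾|`, and the sum over the sectors is dominated as well. -/
theorem hasDerivAt_secondQuant {ψ φ : Fock d} (h : (ψ, φ) ∈ (dGamma w).graph) :
    HasDerivAt (fun t => w.secondQuant t ψ) (I • φ) 0 := by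
  rw [mem_dGamma_graph] at h
  rw [hasDerivAt_iff_tendsto_slope_zero, tendsto_iff_norm_sub_tendsto_zero]
  set F : ℝ → Fock d := fun t =>
    t⁻¹ • (w.secondQuant (0 + t) ψ - w.secondQuant 0 ψ) - I • φ with hF
  let f : (n : ℕ) → ℝ → (Fin n → E d) → ℂ := fun n t x =>
    (t : ℂ)⁻¹ * (Complex.exp (I * t * w.energy n x) - 1) * comp n ψ x -
      I * (w.energy n x * comp n ψ x)
  have hcF : ∀ n t, comp n (F t) =ᵐ[volume] f n t := by
    intro n t
    have h0 : comp n (F t) = (t : ℂ)⁻¹ • (comp n (w.secondQuant t ψ) - comp n ψ) -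
        I • comp n φ := by
      rw [hF, ← ofReal_inv, ← map_sub, ← map_smul, ← map_smul, ← map_sub]
      simp only [zero_add, secondQuant_zero, Complex.coe_smul]
    rw [h0]
    filter_upwards [h n, w.comp_secondQuant n t ψ,
      Lp.coeFn_sub ((t : ℂ)⁻¹ • (comp n (w.secondQuant t ψ) - comp n ψ)) (I • comp n φ),
      Lp.coeFn_smul ((t : ℂ)⁻¹) (comp n (w.secondQuant t ψ) - comp n ψ),
      Lp.coeFn_sub (comp n (w.secondQuant t ψ)) (comp n ψ), Lp.coeFn_smul I (comp n φ)]
      with x h1 h2 h3 h4 h5 h6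
    rw [h3, Pi.sub_apply, h4, h6, Pi.smul_apply, Pi.smul_apply, h5, Pi.sub_apply, h2, h1,
      smul_eq_mul, smul_eq_mul, ← ofReal_energy]
    simp only [f]
    ring
  have hb : ∀ n t, t ≠ 0 → ∀ᵐ x, ‖f n t x‖ ≤ 2 * ‖comp n φ x‖ := by
    intro n t ht
    filter_upwards [h n] with x hx
    rw [← ofReal_energy] at hx
    have h1 : ‖Complex.exp (I * t * w.energy n x) - 1‖ ≤ ‖t * w.energy n x‖ := by
      have := Real.norm_exp_I_mul_ofReal_sub_one_le (x := t * w.energy n x)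
      rwa [ofReal_mul, ← mul_assoc] at this
    have h2 : ‖(t : ℂ)⁻¹ * (Complex.exp (I * t * w.energy n x) - 1) * comp n ψ x‖ ≤
        ‖comp n φ x‖ := by
      rw [hx, norm_mul, norm_mul, norm_mul, norm_inv, norm_real, norm_real]
      gcongr
      rw [inv_mul_le_iff₀ (by simpa using ht), ← norm_mul]
      exact h1
    have h3 : ‖I * (w.energy n x * comp n ψ x)‖ = ‖comp n φ x‖ := by
      rw [hx, norm_mul, norm_I, one_mul]
    calc ‖f n t x‖ ≤ _ := norm_sub_le _ _
      _ ≤ 2 * ‖comp n φ x‖ := by linarith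
  have hl : ∀ n x, Filter.Tendsto (fun t => f n t x) (nhdsWithin 0 {0}ᶜ) (nhds 0) := by
    intro n x
    have h1 : HasDerivAt (fun t : ℝ => Complex.exp (I * t * w.energy n x))
        (I * w.energy n x) 0 := by
      have h2 : HasDerivAt (fun t : ℝ => I * t * w.energy n x) (I * w.energy n x) 0 := by
        simpa using ((hasDerivAt_id (0 : ℝ)).ofReal_comp.const_mul I).mul_const
          (w.energy n x : ℂ)
      simpa using h2.cexp
    rw [hasDerivAt_iff_tendsto_slope_zero] at h1
    have h2 := (h1.mul_const (comp n ψ x)).sub_const (I * (w.energy n x * comp n ψ x))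
    rw [mul_assoc I (w.energy n x : ℂ), sub_self] at h2
    refine h2.congr fun t => ?_
    simp [f]
  have hn : ∀ n, Filter.Tendsto (fun t => ‖comp n (F t)‖ ^ 2) (nhdsWithin 0 {0}ᶜ) (nhds 0) :=
    fun n => tendsto_norm_sq_zero_of_dominated (hcF n) (comp n φ) 2
      (by filter_upwards [self_mem_nhdsWithin] with t ht using hb n t ht)
      (Filter.Eventually.of_forall (hl n))
  have hbn : ∀ n t, t ≠ 0 → ‖comp n (F t)‖ ^ 2 ≤ 4 * ‖comp n φ‖ ^ 2 := by
    intro n t ht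
    have h1 : ‖comp n (F t)‖ ≤ 2 * ‖comp n φ‖ := Lp.norm_le_mul_norm_of_ae_le_mul (by
      filter_upwards [hcF n t, hb n t ht] with x h1 h2
      rwa [h1])
    calc ‖comp n (F t)‖ ^ 2 ≤ (2 * ‖comp n φ‖) ^ 2 := pow_le_pow_left₀ (norm_nonneg _) h1 2
      _ = 4 * ‖comp n φ‖ ^ 2 := by ring
  refine tendsto_norm_zero_of_sq ?_
  have h1 := tendsto_tsum_of_dominated_convergence
    (𝓕 := nhdsWithin (0 : ℝ) {0}ᶜ) (f := fun t n => ‖comp n (F t)‖ ^ 2) (g := fun _ => 0)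
    ((hasSum_norm_comp_sq φ).summable.mul_left 4) hn
    (by
      filter_upwards [self_mem_nhdsWithin] with t ht n
      rw [Real.norm_of_nonneg (by positivity)]
      exact hbn n t ht)
  rw [tsum_zero] at h1
  exact h1.congr fun t => (hasSum_norm_comp_sq (F t)).tsum_eq

/-- If `Γ(e^{itϖ})ψ` is differentiable, a sequence of difference quotients converges almost
everywhere in each sector, which identifies the derivative. -/
theorem mem_dGamma_graph_of_hasDerivAt {ψ φ : Fock d}
    (h : HasDerivAt (fun t => w.secondQuant t ψ) (I • φ) 0) : (ψ, φ) ∈ (dGamma w).graph := by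
  rw [mem_dGamma_graph]
  intro n
  have h1 : HasDerivAt (fun t => comp n (w.secondQuant t ψ)) (I • comp n φ) 0 := by
    have := ((compL d n).restrictScalars ℝ).hasFDerivAt.comp_hasDerivAt 0 h
    have h2 : (compL d n).restrictScalars ℝ (I • φ) = I • comp n φ := map_smul (comp n) I φ
    rw [h2] at this
    exact this
  rw [hasDerivAt_iff_tendsto_slope_zero] at h1
  have hs : Filter.Tendsto (fun k : ℕ => (1 : ℝ) / (k + 1)) Filter.atTop
      (nhdsWithin 0 {0}ᶜ) := by
    refine tendsto_nhdsWithin_iff.mpr ⟨tendsto_one_div_add_atTop_nhds_zero_nat,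
      Filter.Eventually.of_forall fun k => ?_⟩
    exact (by positivity : (0 : ℝ) < 1 / (k + 1)).ne'
  have h2 := h1.comp hs
  obtain ⟨ns, hns, hae⟩ := (tendstoInMeasure_of_tendsto_Lp h2).exists_seq_tendsto_ae
  let q : ℕ → ℝ := fun k => 1 / ((ns k : ℝ) + 1)
  have hq : Filter.Tendsto q Filter.atTop (nhdsWithin 0 {0}ᶜ) := hs.comp hns.tendsto_atTop
  have hform : ∀ᵐ x, ∀ k, ((q k)⁻¹ • (comp n (w.secondQuant (0 + q k) ψ) -
      comp n (w.secondQuant 0 ψ)) : L2n d n) x =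
      (q k : ℂ)⁻¹ * (Complex.exp (I * q k * w.energy n x) - 1) * comp n ψ x := by
    rw [ae_all_iff]
    intro k
    simp only [zero_add, secondQuant_zero]
    change ∀ᵐ x, (((((q k)⁻¹ : ℝ) : ℂ) •
      (comp n (w.secondQuant (q k) ψ) - comp n ψ) : L2n d n)) x = _
    filter_upwards [w.comp_secondQuant n (q k) ψ,
      Lp.coeFn_smul (((q k)⁻¹ : ℝ) : ℂ) (comp n (w.secondQuant (q k) ψ) - comp n ψ),
      Lp.coeFn_sub (comp n (w.secondQuant (q k) ψ)) (comp n ψ)] with x h1 h2 h3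
    rw [h2, Pi.smul_apply, h3, Pi.sub_apply, h1, smul_eq_mul, ofReal_inv]
    ring
  filter_upwards [hae, hform, Lp.coeFn_smul I (comp n φ)] with x hx hf hsm
  have h3 : HasDerivAt (fun t : ℝ => Complex.exp (I * t * w.energy n x))
      (I * w.energy n x) 0 := by
    have h2 : HasDerivAt (fun t : ℝ => I * t * w.energy n x) (I * w.energy n x) 0 := by
      simpa using ((hasDerivAt_id (0 : ℝ)).ofReal_comp.const_mul I).mul_const
        (w.energy n x : ℂ)
    simpa using h2.cexp
  rw [hasDerivAt_iff_tendsto_slope_zero] at h3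
  have h4 := (h3.comp hq).mul_const (comp n ψ x)
  have h5 := tendsto_nhds_unique hx (h4.congr fun k => by
    have := (hf k).symm
    simp only [Function.comp, zero_add, ofReal_zero, mul_zero, zero_mul, Complex.exp_zero,
      Complex.real_smul, ofReal_inv] at this ⊢
    exact this)
  rw [hsm, Pi.smul_apply, smul_eq_mul, mul_assoc] at h5
  rw [← ofReal_energy]
  exact mul_left_cancel₀ I_ne_zero h5

/-- `dΓ(ϖ)` generates `Γ(e^{itϖ})`. -/
theorem isExpOf_dGamma : IsExpOf w.secondQuant (dGamma w) :=
  ⟨w.secondQuant_add, w.continuous_secondQuant, fun _ _ =>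
    ⟨w.hasDerivAt_secondQuant, w.mem_dGamma_graph_of_hasDerivAt⟩⟩

end Dispersion

end SecondQuantization

/-! ### Dynamics and states -/

section Model

variable {d : ℕ} {K : Type*} [NormedAddCommGroup K] [InnerProductSpace ℂ K] [CompleteSpace K]

/-- A representation, as a continuous linear map. -/
def repL (π : CCR d →⋆ₐ[ℂ] (K →L[ℂ] K)) : CCR d →L[ℂ] (K →L[ℂ] K) :=
  ⟨π.toAlgHom.toLinearMap, map_continuous π⟩

theorem rep_ext {π π' : CCR d →⋆ₐ[ℂ] (K →L[ℂ] K)} (h : ∀ f, π (weyl f) = π' (weyl f)) :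
    π = π' :=
  StarAlgHom.ext fun a => DFunLike.congr_fun (ccr_ext (S := repL π) (T := repL π') h) a

/-- An automorphism that a unitary implements on the Weyl operators is implemented by it. -/
theorem implements_of_weyl {π : CCR d →⋆ₐ[ℂ] (K →L[ℂ] K)} {τ : CCR d ≃⋆ₐ[ℂ] CCR d}
    {U : K ≃ₗᵢ[ℂ] K} (h : ∀ f ψ, π (τ (weyl f)) (U ψ) = U (π (weyl f) ψ)) (a : CCR d) (ψ : K) :
    π (τ a) ψ = U (π a (U.symm ψ)) := by
  let τL : CCR d →L[ℂ] CCR d :=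
    ⟨(τ : CCR d →⋆ₐ[ℂ] CCR d).toAlgHom.toLinearMap, map_continuous (τ : CCR d →⋆ₐ[ℂ] CCR d)⟩
  let T : CCR d →L[ℂ] (K →L[ℂ] K) := (ContinuousLinearMap.compL ℂ K K K (opOf U)) ∘L
    ((ContinuousLinearMap.compL ℂ K K K).flip (opOf U.symm)) ∘L repL π
  have h1 : repL π ∘L τL = T := ccr_ext fun f => by
    ext φ
    change π (τ (weyl f)) φ = U (π (weyl f) (U.symm φ))
    rw [← h, LinearIsometryEquiv.apply_symm_apply]
  exact DFunLike.congr_fun (DFunLike.congr_fun h1 a) ψ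

/-- Multiplication by a number of modulus one, as a unitary. -/
def phaseUnitary (K : Type*) [NormedAddCommGroup K] [InnerProductSpace ℂ K] (c : ℂ)
    (hc : ‖c‖ = 1) : K ≃ₗᵢ[ℂ] K where
  toLinearEquiv := LinearEquiv.smulOfNeZero ℂ K c (norm_ne_zero_iff.mp (by rw [hc]; norm_num))
  norm_map' x := by
    change ‖c • x‖ = ‖x‖
    rw [norm_smul, hc, one_mul]

/-- The character `f ↦ e^{2πi Re⟨f, T⟩}` of `𝒟`. -/
def gaugeChar (T : Test d →ₗ[ℂ] ℂ) (f : Test d) : ℂ :=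
  Complex.exp (2 * Real.pi * I * ((bracket f T).re : ℂ))

theorem norm_gaugeChar (T : Test d →ₗ[ℂ] ℂ) (f : Test d) : ‖gaugeChar T f‖ = 1 := by
  rw [gaugeChar, show 2 * (Real.pi : ℂ) * I * ((bracket f T).re : ℂ) =
    ((2 * Real.pi * (bracket f T).re : ℝ) : ℂ) * I by push_cast; ring,
    Complex.norm_exp_ofReal_mul_I]

theorem conjTest_add (f g : Test d) : conjTest (f + g) = conjTest f + conjTest g := by
  ext k; exact map_add conj (f k) (g k)

theorem bracket_add (T : Test d →ₗ[ℂ] ℂ) (f g : Test d) :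
    bracket (f + g) T = bracket f T + bracket g T := by
  rw [bracket, bracket, bracket, conjTest_add, map_add]

theorem gaugeChar_add (T : Test d →ₗ[ℂ] ℂ) (f g : Test d) :
    gaugeChar T (f + g) = gaugeChar T f * gaugeChar T g := by
  rw [gaugeChar, gaugeChar, gaugeChar, ← Complex.exp_add, bracket_add, Complex.add_re]
  push_cast
  ring_nf

theorem gaugeChar_zero (f : Test d) : gaugeChar (0 : Test d →ₗ[ℂ] ℂ) f = 1 := by
  rw [gaugeChar, bracket]; simp

/-- A Weyl system may be composed with a symplectic map and multiplied by a character. -/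
theorem IsWeylSystem.twisted {u : Test d → K ≃ₗᵢ[ℂ] K} (hu : IsWeylSystem u)
    (T : Test d →ₗ[ℂ] ℂ) {A : Test d → Test d} (hA : ∀ f g, A (f + g) = A f + A g)
    (hs : ∀ f g, symp (A f) (A g) = symp f g) :
    IsWeylSystem fun f => (u (A f)).trans (phaseUnitary K (gaugeChar T f) (norm_gaugeChar T f)) := by
  intro f g ψ
  change gaugeChar T f • u (A f) (gaugeChar T g • u (A g) ψ) =
    weylPhase f g • gaugeChar T (f + g) • u (A (f + g)) ψ
  rw [map_smul, hu, hA, gaugeChar_add, weylPhase, hs, ← weylPhase, smul_smul, smul_smul, smul_smul]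
  congr 1
  ring

/-- The Weyl operators on `ℓ²(𝒟)`, as unitaries. -/
def twistUnitary (f : Test d) : Ell2 d ≃ₗᵢ[ℂ] Ell2 d :=
  LinearIsometryEquiv.ofSurjective (twist f) fun ψ => ⟨twist (-f) ψ, by
    have h : weyl f * weyl (-f) = 1 := by
      rw [weyl_mul, weylPhase_self_neg, one_smul, add_neg_cancel, weyl_zero]
    exact DFunLike.congr_fun (congrArg Subtype.val h) ψ⟩

theorem isWeylSystem_twistUnitary : IsWeylSystem (twistUnitary : Test d → _) := fun f g ψ =>
  DFunLike.congr_fun (congrArg Subtype.val (weyl_mul f g)) ψ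

/-- Symplectic maps and characters of `𝒟` induce endomorphisms of `𝕎`. -/
theorem exists_endomorphism (T : Test d →ₗ[ℂ] ℂ) {A : Test d → Test d}
    (hA : ∀ f g, A (f + g) = A f + A g) (hs : ∀ f g, symp (A f) (A g) = symp f g) :
    ∃ α : CCR d →⋆ₐ[ℂ] CCR d, ∀ f, α (weyl f) = gaugeChar T f • weyl (A f) := by
  obtain ⟨π, hπ⟩ := (isWeylSystem_twistUnitary.twisted T hA hs).exists_rep
  have hW : ∀ f, π (weyl f) = (gaugeChar T f • weyl (A f) : CCR d).1 := fun f => by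
    ext1 ψ
    rw [hπ]
    rfl
  have hmem : ∀ a, π a ∈ ccrSubalgebra d := fun a => by
    have hcl : IsClosed {a : CCR d | π a ∈ ccrSubalgebra d} :=
      (StarSubalgebra.isClosed_topologicalClosure _).preimage (map_continuous π)
    refine hcl.closure_subset_iff.mpr (fun b hb => ?_) ((dense_span_weyl d) a)
    have hle : Submodule.span ℂ (Set.range (weyl : Test d → CCR d)) ≤
        (Subalgebra.toSubmodule (ccrSubalgebra d).toSubalgebra).comap π.toAlgHom.toLinearMap := by
      refine Submodule.span_le.mpr ?_
      rintro _ ⟨f, rfl⟩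
      change π (weyl f) ∈ ccrSubalgebra d
      rw [hW]
      exact (gaugeChar T f • weyl (A f) : CCR d).2
    exact hle hb
  exact ⟨StarAlgHom.codRestrict π (ccrSubalgebra d) hmem, fun f => Subtype.ext (hW f)⟩

end Model

section Dynamics

variable {d : ℕ} (w : Dispersion d) (v : Dist d)

/-- Multiplication by `e^{itϖ}` on `𝒟`. -/
abbrev Dispersion.phaseTest (t : ℝ) (f : Test d) : Test d :=
  mulTest (w.phase t) (w.phase_smooth t) f

theorem Dispersion.phaseTest_add (s t : ℝ) (f : Test d) :
    w.phaseTest (s + t) f = w.phaseTest s (w.phaseTest t f) := by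
  ext k
  change w.phase (s + t) k * f k = w.phase s k * (w.phase t k * f k)
  rw [w.phase_add, mul_assoc]

theorem Dispersion.phaseTest_zero (f : Test d) : w.phaseTest 0 f = f := by
  ext k
  change w.phase 0 k * f k = f k
  rw [w.phase_zero, one_mul]

theorem Dispersion.symp_phaseTest (t : ℝ) (f g : Test d) :
    symp (w.phaseTest t f) (w.phaseTest t g) = symp f g := by
  rw [symp, symp, ← w.phaseMul_toL2, ← w.phaseMul_toL2, LinearIsometry.inner_map_map]

theorem Dispersion.conjTest_phaseTest (t : ℝ) (f : Test d) :
    conjTest (w.phaseTest t f) = w.phaseTest (-t) (conjTest f) := by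
  ext k
  change conj (w.phase t k * f k) = w.phase (-t) k * conj (f k)
  rw [map_mul, w.conj_phase]

theorem Dispersion.bracket_drift (t : ℝ) (f : Test d) : bracket f (w.drift t v) =
    w.quot v (w.phaseTest (-t) (conjTest f)) - w.quot v (conjTest f) := by
  rw [bracket, ← map_sub]
  change w.quot v _ = w.quot v _
  congr 1
  ext k
  change (w.phase (-t) k - 1) * conjTest f k = w.phase (-t) k * conjTest f k - conjTest f k
  ring

theorem Dispersion.bracket_neg_quot (f : Test d) :
    bracket f (-(w.quot v)) = -(w.quot v (conjTest f)) := rfl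

theorem Dispersion.gaugeChar_drift_add (s t : ℝ) (f : Test d) :
    gaugeChar (w.drift (s + t) v) f =
      gaugeChar (w.drift t v) f * gaugeChar (w.drift s v) (w.phaseTest t f) := by
  rw [gaugeChar, gaugeChar, gaugeChar, ← Complex.exp_add, w.bracket_drift, w.bracket_drift,
    w.bracket_drift, w.conjTest_phaseTest, ← w.phaseTest_add, neg_add]
  simp only [Complex.sub_re]
  push_cast
  ring_nf

theorem Dispersion.gaugeChar_drift_zero (f : Test d) : gaugeChar (w.drift 0 v) f = 1 := by
  rw [gaugeChar, w.bracket_drift, neg_zero, w.phaseTest_zero]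
  simp

theorem exists_isVHMDynamics : ∃ τ : ℝ → CCR d ≃⋆ₐ[ℂ] CCR d, IsVHMDynamics w v τ := by
  have hA : ∀ t f g, w.phaseTest t (f + g) = w.phaseTest t f + w.phaseTest t g := fun t f g => by
    ext k; exact mul_add (w.phase t k) (f k) (g k)
  choose α hα using fun t => exists_endomorphism (w.drift t v) (hA t) (w.symp_phaseTest t)
  let αL : ℝ → CCR d →L[ℂ] CCR d := fun t =>
    ⟨(α t).toAlgHom.toLinearMap, map_continuous (α t)⟩
  have hadd : ∀ s t a, α (s + t) a = α s (α t a) := fun s t a =>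
    DFunLike.congr_fun (ccr_ext (S := αL (s + t)) (T := αL s ∘L αL t) fun f => by
      change α (s + t) (weyl f) = α s (α t (weyl f))
      rw [hα, hα, map_smul, hα, smul_smul, w.gaugeChar_drift_add, ← w.phaseTest_add]) a
  have hzero : ∀ a, α 0 a = a := fun a =>
    DFunLike.congr_fun (ccr_ext (S := αL 0) (T := ContinuousLinearMap.id ℂ _) fun f => by
      change α 0 (weyl f) = weyl f
      rw [hα, w.gaugeChar_drift_zero, one_smul, w.phaseTest_zero]) a
  refine ⟨fun t => StarAlgEquiv.ofStarAlgHom (α t) (α (-t))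
    (StarAlgHom.ext fun a => ?_) (StarAlgHom.ext fun a => ?_), ⟨hadd, hα⟩⟩
  · change α (-t) (α t a) = a
    rw [← hadd, neg_add_cancel, hzero]
  · change α t (α (-t) a) = a
    rw [← hadd, add_neg_cancel, hzero]

theorem IsVHMDynamics.unique {w : Dispersion d} {v : Dist d} {τ τ' : ℝ → CCR d ≃⋆ₐ[ℂ] CCR d}
    (h : IsVHMDynamics w v τ) (h' : IsVHMDynamics w v τ') : τ = τ' := by
  funext t
  let L : (CCR d ≃⋆ₐ[ℂ] CCR d) → CCR d →L[ℂ] CCR d := fun σ =>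
    ⟨(σ : CCR d →⋆ₐ[ℂ] CCR d).toAlgHom.toLinearMap, map_continuous (σ : CCR d →⋆ₐ[ℂ] CCR d)⟩
  refine StarAlgEquiv.ext fun a => ?_
  exact DFunLike.congr_fun (ccr_ext (S := L (τ t)) (T := L (τ' t)) fun f => by
    change τ t (VanHove.weyl f) = τ' t (VanHove.weyl f)
    rw [h.weyl, h'.weyl]) a

end Dynamics

section States

variable {d : ℕ} {K : Type*} [NormedAddCommGroup K] [InnerProductSpace ℂ K] [CompleteSpace K]

/-- `iπf`, the vector whose Weyl operator on Fock space represents `W(f)`. -/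
def weylVector (f : Test d) : L2 d := (I * Real.pi : ℂ) • toL2 f

theorem weylVector_add (f g : Test d) : weylVector (f + g) = weylVector f + weylVector g := by
  rw [weylVector, map_add, smul_add]; rfl

theorem norm_weylVector (f : Test d) : ‖weylVector f‖ = Real.pi * ‖toL2 f‖ := by
  rw [weylVector, norm_smul, norm_mul, norm_I, one_mul, norm_real,
    Real.norm_of_nonneg Real.pi_pos.le]

theorem isWeylSystem_fockWeyl : IsWeylSystem fun f : Test d => fockWeyl (weylVector f) := by
  intro f g ψ
  change fockWeyl (weylVector f) (fockWeyl (weylVector g) ψ) =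
    weylPhase f g • fockWeyl (weylVector (f + g)) ψ
  rw [fockWeyl_mul, weylVector_add, weylPhase]
  congr 4
  rw [weylVector, weylVector, inner_smul_left, inner_smul_right, ← mul_assoc, symp]
  have : conj (I * (Real.pi : ℂ)) * (I * Real.pi) = ((Real.pi ^ 2 : ℝ) : ℂ) := by
    rw [map_mul, conj_I, conj_ofReal]
    push_cast
    linear_combination (-(Real.pi : ℂ) ^ 2) * I_sq
  rw [this, Complex.im_ofReal_mul]

theorem fockWeyl_weylVector_expVector (f : Test d) (h : L2 d) :
    fockWeyl (weylVector f) (expVector h) =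
      Complex.exp (-(Real.pi ^ 2 / 2 * ‖toL2 f‖ ^ 2 : ℝ) + I * Real.pi * inner ℂ (toL2 f) h) •
        expVector (h + (I * Real.pi : ℂ) • toL2 f) := by
  rw [fockWeyl_expVector, norm_weylVector]
  congr 2
  rw [weylVector, inner_smul_left, map_mul, conj_I, conj_ofReal]
  push_cast
  ring

theorem IsFockRep.apply {π : CCR d →⋆ₐ[ℂ] (Fock d →L[ℂ] Fock d)} (hπ : IsFockRep π) (f : Test d)
    (ψ : Fock d) : π (weyl f) ψ = fockWeyl (weylVector f) ψ :=
  DFunLike.congr_fun (eq_of_eqOn_total (dense_span_expVector d) (S := π (weyl f))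
    (T := opOf (fockWeyl (weylVector f))) fun h =>
      (hπ f h).trans (fockWeyl_weylVector_expVector f h).symm) ψ

theorem exists_isFockRep (d : ℕ) :
    ∃ π : CCR d →⋆ₐ[ℂ] (Fock d →L[ℂ] Fock d), IsFockRep π := by
  obtain ⟨π, hπ⟩ := (isWeylSystem_fockWeyl (d := d)).exists_rep
  exact ⟨π, fun f h => (hπ f _).trans (fockWeyl_weylVector_expVector f h)⟩

theorem IsFockRep.unique {π π' : CCR d →⋆ₐ[ℂ] (Fock d →L[ℂ] Fock d)} (h : IsFockRep π)
    (h' : IsFockRep π') : π = π' :=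
  rep_ext fun f => by ext1 ψ; rw [h.apply, h'.apply]

/-- The Fock representation, composed with the gauge automorphism
`W(f) ↦ e^{2πi Re⟨f, T⟩} W(f)`. -/
theorem exists_gauged_fockRep (T : Test d →ₗ[ℂ] ℂ) :
    ∃ π : CCR d →⋆ₐ[ℂ] (Fock d →L[ℂ] Fock d),
      ∀ f ψ, π (weyl f) ψ = gaugeChar T f • fockWeyl (weylVector f) ψ :=
  (isWeylSystem_fockWeyl.twisted T (A := id) (fun _ _ => rfl) fun _ _ => rfl).exists_rep

theorem dense_span_gauged_fockRep {T : Test d →ₗ[ℂ] ℂ} {π : CCR d →⋆ₐ[ℂ] (Fock d →L[ℂ] Fock d)}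
    (hπ : ∀ f ψ, π (weyl f) ψ = gaugeChar T f • fockWeyl (weylVector f) ψ) :
    Dense (Submodule.span ℂ (Set.range fun a => π a (vacuum d)) : Set (Fock d)) := by
  have hc : (I * Real.pi : ℂ) ≠ 0 :=
    mul_ne_zero I_ne_zero (ofReal_ne_zero.mpr Real.pi_ne_zero)
  refine (dense_span_expVector_test (d := d) hc).mono (Submodule.span_le.mpr ?_)
  rintro _ ⟨f, rfl⟩
  have h1 := hπ f (vacuum d)
  rw [vacuum_eq, fockWeyl_expVector, zero_add, smul_smul] at h1
  set z := gaugeChar T f * Complex.exp (-(‖weylVector f‖ ^ 2 / 2 : ℝ) -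
    inner ℂ (weylVector f) (0 : L2 d)) with hz
  have hz0 : z ≠ 0 := mul_ne_zero (norm_ne_zero_iff.mp (by rw [norm_gaugeChar]; norm_num))
    (Complex.exp_ne_zero _)
  have h2 : expVector (weylVector f) = z⁻¹ • π (weyl f) (vacuum d) := by
    rw [vacuum_eq, h1, smul_smul, inv_mul_cancel₀ hz0, one_smul]
  change expVector (weylVector f) ∈ _
  rw [h2]
  exact Submodule.smul_mem _ _ (Submodule.subset_span ⟨weyl f, rfl⟩)

/-- The positive functional `a ↦ ⟨ξ, π(a)ξ⟩`. -/
def vectorState (π : CCR d →⋆ₐ[ℂ] (K →L[ℂ] K)) (ξ : K) : CCR d →ₚ[ℂ] ℂ :=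
  PositiveLinearMap.mk₀
    { toFun := fun a => inner ℂ ξ (π a ξ)
      map_add' := fun a b => by rw [map_add, add_apply, inner_add_right]
      map_smul' := fun c a => by
        rw [map_smul, smul_apply, inner_smul_right]; rfl } fun a ha => by
    obtain ⟨b, rfl⟩ := CStarAlgebra.nonneg_iff_eq_star_mul_self.mp ha
    change 0 ≤ (inner ℂ ξ (π (star b * b) ξ) : ℂ)
    rw [map_mul, map_star, ContinuousLinearMap.star_eq_adjoint]
    change 0 ≤ (inner ℂ ξ (ContinuousLinearMap.adjoint (π b) (π b ξ)) : ℂ)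
    rw [ContinuousLinearMap.adjoint_inner_right, inner_self_eq_norm_sq_to_K]
    change 0 ≤ ((‖π b ξ‖ : ℂ)) ^ 2
    rw [← ofReal_pow]
    exact Complex.zero_le_real.mpr (sq_nonneg _)

theorem vectorState_apply (π : CCR d →⋆ₐ[ℂ] (K →L[ℂ] K)) (ξ : K) (a : CCR d) :
    vectorState π ξ a = inner ℂ ξ (π a ξ) := rfl

theorem state_ext {ρ ρ' : CCR d →ₚ[ℂ] ℂ} (h : ∀ f, ρ (weyl f) = ρ' (weyl f)) (a : CCR d) :
    ρ a = ρ' a := by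
  let L : (CCR d →ₚ[ℂ] ℂ) → CCR d →L[ℂ] ℂ := fun σ => ⟨σ.toLinearMap, map_continuous σ⟩
  exact DFunLike.congr_fun (ccr_ext (S := L ρ) (T := L ρ') h) a

theorem inner_vacuum_fockWeyl (u : L2 d) :
    (inner ℂ (vacuum d) (fockWeyl u (vacuum d)) : ℂ) = Complex.exp (-(‖u‖ ^ 2 / 2 : ℝ)) := by
  rw [vacuum_eq, fockWeyl_expVector, inner_smul_right, inner_expVector, inner_zero_left,
    inner_zero_right, Complex.exp_zero, mul_one, sub_zero]

theorem isOmegaInfty_vectorState {w : Dispersion d} {v : Dist d}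
    {π : CCR d →⋆ₐ[ℂ] (Fock d →L[ℂ] Fock d)}
    (hπ : ∀ f ψ, π (weyl f) ψ = gaugeChar (-(w.quot v)) f • fockWeyl (weylVector f) ψ) :
    IsOmegaInfty w v (vectorState π (vacuum d)) where
  map_one := by
    rw [vectorState_apply, map_one]
    change (inner ℂ (vacuum d) (vacuum d) : ℂ) = 1
    rw [inner_self_eq_norm_sq_to_K, norm_vacuum]
    simp
  weyl f := by
    rw [vectorState_apply, hπ, inner_smul_right, inner_vacuum_fockWeyl, norm_weylVector, mul_comm,
      gaugeChar]
    congr 4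
    ring

theorem IsOmegaInfty.unique {w : Dispersion d} {v : Dist d} {ρ ρ' : CCR d →ₚ[ℂ] ℂ}
    (h : IsOmegaInfty w v ρ) (h' : IsOmegaInfty w v ρ') (a : CCR d) : ρ a = ρ' a :=
  state_ext (fun f => by rw [h.weyl, h'.weyl]) a

end States

/-! ### The GNS representation -/

section GNS

variable {d : ℕ} {K : Type*} [NormedAddCommGroup K] [InnerProductSpace ℂ K] [CompleteSpace K]

theorem gnsStarAlgHom_gnsVector (ρ : CCR d →ₚ[ℂ] ℂ) (a : CCR d) :
    ρ.gnsStarAlgHom a (gnsVector ρ) = ((ρ.toPreGNS a : ρ.PreGNS) : ρ.GNS) := by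
  change ρ.gnsNonUnitalStarAlgHom a ((ρ.toPreGNS 1 : ρ.PreGNS) : ρ.GNS) = _
  rw [PositiveLinearMap.gnsNonUnitalStarAlgHom_apply_coe]
  change ((ρ.toPreGNS (a * 1) : ρ.PreGNS) : ρ.GNS) = _
  rw [mul_one]

theorem dense_span_gns (ρ : CCR d →ₚ[ℂ] ℂ) :
    Dense (Submodule.span ℂ (Set.range fun a => ρ.gnsStarAlgHom a (gnsVector ρ)) :
      Set ρ.GNS) := by
  refine Dense.mono Submodule.subset_span ?_
  have h := UniformSpace.Completion.denseRange_coe (α := ρ.PreGNS)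
  refine Dense.mono ?_ h
  rintro _ ⟨a, rfl⟩
  exact ⟨ρ.ofPreGNS a, gnsStarAlgHom_gnsVector ρ _⟩

theorem inner_gns (ρ : CCR d →ₚ[ℂ] ℂ) (a b : CCR d) :
    (inner ℂ (ρ.gnsStarAlgHom a (gnsVector ρ)) (ρ.gnsStarAlgHom b (gnsVector ρ)) : ℂ) =
      ρ (star a * b) := by
  rw [gnsStarAlgHom_gnsVector, gnsStarAlgHom_gnsVector, UniformSpace.Completion.inner_coe]
  rfl

theorem inner_rep_apply (π : CCR d →⋆ₐ[ℂ] (K →L[ℂ] K)) (ξ : K) (a b : CCR d) :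
    (inner ℂ (π a ξ) (π b ξ) : ℂ) = inner ℂ ξ (π (star a * b) ξ) := by
  have h1 : π (star a * b) ξ = ContinuousLinearMap.adjoint (π a) (π b ξ) := by
    rw [← ContinuousLinearMap.star_eq_adjoint, ← map_star π a]
    exact DFunLike.congr_fun (map_mul π (star a) b) ξ
  rw [h1]
  exact (ContinuousLinearMap.adjoint_inner_right (π a) ξ (π b ξ)).symm

/-- Uniqueness of the GNS representation. -/
theorem exists_gns_unitary {ρ : CCR d →ₚ[ℂ] ℂ} {π : CCR d →⋆ₐ[ℂ] (K →L[ℂ] K)} {ξ : K}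
    (hξ : Dense (Submodule.span ℂ (Set.range fun a => π a ξ) : Set K))
    (hρ : ∀ a, ρ a = inner ℂ ξ (π a ξ)) :
    ∃ V : ρ.GNS ≃ₗᵢ[ℂ] K, V (gnsVector ρ) = ξ ∧
      ∀ a ψ, V (ρ.gnsStarAlgHom a ψ) = π a (V ψ) := by
  obtain ⟨V, hV⟩ := exists_unitary_of_inner_eq (fun a => ρ.gnsStarAlgHom a (gnsVector ρ))
    (fun a => π a ξ) (dense_span_gns ρ) hξ fun a b =>
      (inner_gns ρ a b).trans ((hρ _).trans (inner_rep_apply π ξ a b).symm)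
  have hV' : ∀ a, V (ρ.gnsStarAlgHom a (gnsVector ρ)) = π a ξ := hV
  refine ⟨V, ?_, fun a ψ => ?_⟩
  · have h1 := hV' 1
    rw [gnsStarAlgHom_gnsVector] at h1
    have h2 : π 1 ξ = ξ := DFunLike.congr_fun (map_one π) ξ
    exact h1.trans h2
  · refine DFunLike.congr_fun (eq_of_eqOn_total (dense_span_gns ρ)
      (S := opOf V ∘L ρ.gnsStarAlgHom a) (T := π a ∘L opOf V) fun b => ?_) ψ
    change V (ρ.gnsStarAlgHom a (ρ.gnsStarAlgHom b (gnsVector ρ))) =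
      π a (V (ρ.gnsStarAlgHom b (gnsVector ρ)))
    have h1 : ρ.gnsStarAlgHom a (ρ.gnsStarAlgHom b (gnsVector ρ)) =
        ρ.gnsStarAlgHom (a * b) (gnsVector ρ) :=
      (DFunLike.congr_fun (map_mul ρ.gnsStarAlgHom a b) (gnsVector ρ)).symm
    have h2 : π (a * b) ξ = π a (π b ξ) := DFunLike.congr_fun (map_mul π a b) ξ
    rw [h1, hV', hV', h2]

end GNS

/-! ### Hamiltonians -/

section Hamiltonian

variable {d : ℕ} {K L : Type*} [NormedAddCommGroup K] [InnerProductSpace ℂ K] [CompleteSpace K]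
  [NormedAddCommGroup L] [InnerProductSpace ℂ L] [CompleteSpace L]

theorem hasDerivAt_unitary (V : K ≃ₗᵢ[ℂ] L) {f : ℝ → K} {x : K}
    (hf : HasDerivAt f (I • x) 0) : HasDerivAt (fun t => V (f t)) (I • V x) 0 := by
  have := ((opOf V).restrictScalars ℝ).hasFDerivAt.comp_hasDerivAt 0 hf
  have h2 : (opOf V).restrictScalars ℝ (I • x) = I • V x := map_smul V I x
  rw [h2] at this
  exact this

theorem IsExpOf.isConj {U : ℝ → K ≃ₗᵢ[ℂ] K} {H : K →ₗ.[ℂ] K} {U' : ℝ → L ≃ₗᵢ[ℂ] L}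
    {H' : L →ₗ.[ℂ] L} (h : IsExpOf U H) (h' : IsExpOf U' H') {V : K ≃ₗᵢ[ℂ] L}
    (hV : ∀ t ψ, V (U t ψ) = U' t (V ψ)) : IsConj V H H' := by
  intro ψ φ
  rw [h.generator, h'.generator]
  constructor
  · intro hd
    have := hasDerivAt_unitary V hd
    simpa only [hV] using this
  · intro hd
    have := hasDerivAt_unitary V.symm hd
    simpa only [← hV, LinearIsometryEquiv.symm_apply_apply] using this

/-- A unitary group, transported by a unitary, has a self-adjoint generator. -/
theorem IsExpOf.exists_conj {U : ℝ → K ≃ₗᵢ[ℂ] K} {H : K →ₗ.[ℂ] K} (h : IsExpOf U H)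
    (V : K ≃ₗᵢ[ℂ] L) :
    ∃ H' : L →ₗ.[ℂ] L, IsExpOf (fun t => (V.symm.trans (U t)).trans V) H' ∧
      IsSelfAdjoint H' ∧ IsConj V H H' := by
  have h' : IsExpOf (fun t => (V.symm.trans (U t)).trans V)
      (VanHove.generator fun t => (V.symm.trans (U t)).trans V) := by
    refine isExpOf_generator (fun s t ψ => ?_) fun ψ => ?_
    · simp only [LinearIsometryEquiv.trans_apply, LinearIsometryEquiv.symm_apply_apply, h.add]
    · simp only [LinearIsometryEquiv.trans_apply]
      exact V.continuous.comp (h.continuous _)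
  refine ⟨_, h', h'.isSelfAdjoint, h.isConj h' fun t ψ => ?_⟩
  simp only [LinearIsometryEquiv.trans_apply, LinearIsometryEquiv.symm_apply_apply]

theorem IsConj.symm {H : K →ₗ.[ℂ] K} {H' : L →ₗ.[ℂ] L} {V : K ≃ₗᵢ[ℂ] L} (h : IsConj V H H') :
    IsConj V.symm H' H := fun ψ φ => by
  rw [h]; simp only [LinearIsometryEquiv.apply_symm_apply]

/-- The unitary group of a Hamiltonian that annihilates the cyclic vector acts on the vectors
`π(a)Ω` as the dynamics does on `a`; hence there is only one such Hamiltonian. -/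
theorem IsGNSHamiltonian.unique {τ : ℝ → CCR d ≃⋆ₐ[ℂ] CCR d} {ρ : CCR d →ₚ[ℂ] ℂ}
    {H H' : ρ.GNS →ₗ.[ℂ] ρ.GNS} (h : IsGNSHamiltonian τ ρ H) (h' : IsGNSHamiltonian τ ρ H') :
    H = H' := by
  obtain ⟨⟨-, U, hU, hUτ⟩, h0⟩ := h
  obtain ⟨⟨-, U', hU', hUτ'⟩, h0'⟩ := h'
  have key : ∀ {H : ρ.GNS →ₗ.[ℂ] ρ.GNS} {U : ℝ → ρ.GNS ≃ₗᵢ[ℂ] ρ.GNS}, IsExpOf U H →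
      (∀ t a ψ, ρ.gnsStarAlgHom (τ t a) ψ = U t (ρ.gnsStarAlgHom a ((U t).symm ψ))) →
      (gnsVector ρ, 0) ∈ H.graph → ∀ t a, U t (ρ.gnsStarAlgHom a (gnsVector ρ)) =
        ρ.gnsStarAlgHom (τ t a) (gnsVector ρ) := by
    intro H U hU hUτ h0 t a
    rw [hUτ, hU.symm_apply, hU.apply_eq_of_mem_graph_zero h0]
  have hUU : U = U' := by
    funext t
    refine LinearIsometryEquiv.ext fun ψ =>
      unitary_eq_of_eqOn_total (dense_span_gns ρ) (fun a => ?_) ψ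
    rw [key hU hUτ h0, key hU' hUτ' h0']
  subst hUU
  exact hU.eq_of_eq hU'

variable {w : Dispersion d} {v : Dist d} {τ : ℝ → CCR d ≃⋆ₐ[ℂ] CCR d}
  {πF : CCR d →⋆ₐ[ℂ] (Fock d →L[ℂ] Fock d)} {ρ : CCR d →ₚ[ℂ] ℂ}

theorem Dispersion.phaseMul_weylVector (w : Dispersion d) (t : ℝ) (f : Test d) :
    w.phaseMul t (weylVector f) = weylVector (w.phaseTest t f) := by
  rw [weylVector, map_smul, w.phaseMul_toL2]; rfl

theorem IsOmegaInfty.exists_unitary (hρ : IsOmegaInfty w v ρ) :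
    ∃ V : ρ.GNS ≃ₗᵢ[ℂ] Fock d, V (gnsVector ρ) = vacuum d ∧
      ∀ f ψ, V (ρ.gnsStarAlgHom (VanHove.weyl f) ψ) =
        gaugeChar (-(w.quot v)) f • fockWeyl (weylVector f) (V ψ) := by
  obtain ⟨π, hπ⟩ := exists_gauged_fockRep (-(w.quot v))
  obtain ⟨V, hV1, hV2⟩ := exists_gns_unitary (dense_span_gauged_fockRep hπ)
    (hρ.unique (isOmegaInfty_vectorState hπ))
  exact ⟨V, hV1, fun f ψ => by rw [hV2, hπ]⟩

theorem Dispersion.gaugeChar_drift_mul (w : Dispersion d) (v : Dist d) (t : ℝ) (f : Test d) :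
    gaugeChar (w.drift t v) f * gaugeChar (-(w.quot v)) (w.phaseTest t f) =
      gaugeChar (-(w.quot v)) f := by
  rw [gaugeChar, gaugeChar, gaugeChar, ← Complex.exp_add, w.bracket_drift, w.bracket_neg_quot,
    w.bracket_neg_quot, w.conjTest_phaseTest]
  simp only [Complex.sub_re, Complex.neg_re]
  push_cast
  ring_nf

/-- In the GNS representation of `ω_∞`, identified with the gauged Fock representation, the free
dynamics `Γ(e^{itϖ})` implements `τ`. -/
theorem exists_gnsHamiltonian (hτ : IsVHMDynamics w v τ) {V : ρ.GNS ≃ₗᵢ[ℂ] Fock d}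
    (hV1 : V (gnsVector ρ) = vacuum d) (hV2 : ∀ f ψ, V (ρ.gnsStarAlgHom (weyl f) ψ) =
      gaugeChar (-(w.quot v)) f • fockWeyl (weylVector f) (V ψ)) :
    ∃ H : ρ.GNS →ₗ.[ℂ] ρ.GNS, IsGNSHamiltonian τ ρ H ∧ IsConj V H (dGamma w) := by
  obtain ⟨H, hU, hsa, hconj⟩ := w.isExpOf_dGamma.exists_conj V.symm
  refine ⟨H, ⟨⟨hsa, _, hU, fun t => implements_of_weyl fun f ψ => ?_⟩, ?_⟩, hconj.symm⟩
  · refine V.injective ?_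
    simp only [LinearIsometryEquiv.trans_apply, LinearIsometryEquiv.symm_symm,
      LinearIsometryEquiv.apply_symm_apply]
    have hτ' : τ t (weyl f) = gaugeChar (w.drift t v) f • weyl (w.phaseTest t f) := hτ.weyl t f
    rw [hτ', map_smul, smul_apply, map_smul, hV2, hV2, map_smul, w.secondQuant_fockWeyl,
      w.phaseMul_weylVector, smul_smul, w.gaugeChar_drift_mul,
      LinearIsometryEquiv.apply_symm_apply]
  · rw [hU.generator]
    have : (fun t => ((V.symm.symm.trans (w.secondQuant t)).trans V.symm) (gnsVector ρ)) =
        fun _ => gnsVector ρ := by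
      funext t
      simp only [LinearIsometryEquiv.trans_apply, LinearIsometryEquiv.symm_symm, hV1,
        w.secondQuant_vacuum]
      rw [← hV1, LinearIsometryEquiv.symm_apply_apply]
    rw [this, smul_zero]
    exact hasDerivAt_const _ _

end Hamiltonian

/-! ### Square integrability of distributions -/

section Criterion

variable {d : ℕ}

theorem norm_toL2_conjTest (f : Test d) : ‖toL2 (conjTest f)‖ = ‖toL2 f‖ := by
  change ‖(conjTest f).memLp.toLp‖ = ‖f.memLp.toLp‖
  rw [Lp.norm_toLp, Lp.norm_toLp]
  congr 1
  refine eLpNorm_congr_norm_ae (Filter.Eventually.of_forall fun k => ?_)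
  change ‖conj (f k)‖ = ‖f k‖
  rw [RCLike.norm_conj]

theorem conjTest_conjTest (f : Test d) : conjTest (conjTest f) = f := by
  ext k; exact Complex.conj_conj (f k)

theorem bracket_smul (T : Test d →ₗ[ℂ] ℂ) (c : ℂ) (f : Test d) :
    bracket (c • f) T = conj c * bracket f T := by
  have : conjTest (c • f) = conj c • conjTest f := by
    ext k; exact map_mul conj c (f k)
  rw [bracket, bracket, this, map_smul, smul_eq_mul]

theorem norm_toL2_smul (c : ℂ) (f : Test d) : ‖toL2 (c • f)‖ = ‖c‖ * ‖toL2 f‖ := by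
  rw [map_smul, norm_smul]

/-- A linear form on `𝒟` that is bounded in the `L²` norm is square integrable, by the density of
`𝒟` and the Riesz representation theorem. -/
theorem memL2_of_norm_le {T : Test d →ₗ[ℂ] ℂ} {C : ℝ} (h : ∀ f, ‖T f‖ ≤ C * ‖toL2 f‖) :
    MemL2 T := by
  set Φ : L2 d →L[ℂ] ℂ := T.extendOfNorm toL2
  have hΦ : ∀ f, Φ (toL2 f) = T f := LinearMap.extendOfNorm_eq (denseRange_toL2 d) ⟨C, h⟩
  set y : L2 d := (InnerProductSpace.toDual ℂ (L2 d)).symm Φ with hy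
  refine ⟨star y, fun f => ?_⟩
  rw [← hΦ, ← InnerProductSpace.toDual_symm_apply, inner_eq_integral]
  refine integral_congr_ae ?_
  filter_upwards [Lp.coeFn_star y, f.memLp.coeFn_toLp] with k h1 h2
  have h2' : toL2 f k = f k := h2
  rw [h1, h2', ← hy]
  rfl

/-- A bound on `Re⟨f, T⟩` for small `f` bounds the form `T`. -/
theorem norm_le_of_abs_re_bracket_le {T : Test d →ₗ[ℂ] ℂ} {δ : ℝ} (hδ : 0 < δ)
    (h : ∀ f, ‖toL2 f‖ ≤ δ → |(bracket f T).re| ≤ 1) (f : Test d) :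
    ‖T f‖ ≤ 2 / δ * ‖toL2 f‖ := by
  have hs : ∀ s : ℝ, 0 ≤ s → ∀ f : Test d, s * ‖toL2 f‖ ≤ δ → s * |(bracket f T).re| ≤ 1 := by
    intro s hs f hf
    have h1 := h ((s : ℂ) • f) (by
      rwa [norm_toL2_smul, norm_real, Real.norm_of_nonneg hs])
    rwa [bracket_smul, conj_ofReal, Complex.re_ofReal_mul, abs_mul, abs_of_nonneg hs] at h1
  have hre : ∀ f : Test d, |(bracket f T).re| ≤ ‖toL2 f‖ / δ := by
    intro f
    rcases (norm_nonneg (toL2 f)).eq_or_lt with h0 | h0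
    · rw [← h0, zero_div]
      by_contra! hlt
      have := hs (2 / |(bracket f T).re|) (by positivity) f (by rw [← h0, mul_zero]; exact hδ.le)
      rw [div_mul_cancel₀ _ hlt.ne'] at this
      norm_num at this
    · have := hs (δ / ‖toL2 f‖) (by positivity) f (by rw [div_mul_cancel₀ _ h0.ne'])
      rw [le_div_iff₀ hδ]
      rw [div_mul_eq_mul_div, div_le_one h0] at this
      linarith
  have h1 := hre (conjTest f)
  have h2 := hre (I • conjTest f)
  rw [norm_toL2_conjTest] at h1
  rw [norm_toL2_smul, norm_I, one_mul, norm_toL2_conjTest, bracket_smul, conj_I, neg_mul,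
    Complex.neg_re, Complex.I_mul_re, neg_neg] at h2
  rw [bracket, conjTest_conjTest] at h1 h2
  calc ‖T f‖ ≤ |(T f).re| + |(T f).im| := Complex.norm_le_abs_re_add_abs_im _
    _ ≤ 2 / δ * ‖toL2 f‖ := by
        rw [show 2 / δ * ‖toL2 f‖ = ‖toL2 f‖ / δ + ‖toL2 f‖ / δ by ring]
        gcongr

/-- If the character `e^{2πi Re⟨f, T⟩}` stays close to `1` for small `f`, then so does its
exponent to `0`: along the segment from `0` to `f`, the character would otherwise reach `-1`. -/
theorem abs_re_bracket_le_of_gaugeChar {T : Test d →ₗ[ℂ] ℂ} {δ : ℝ}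
    (h : ∀ f, ‖toL2 f‖ ≤ δ → ‖gaugeChar T f - 1‖ ≤ 1) (f : Test d) (hf : ‖toL2 f‖ ≤ δ) :
    |(bracket f T).re| ≤ 1 := by
  by_contra! hlt
  set r := (bracket f T).re
  have hr : r ≠ 0 := fun h0 => by rw [h0, abs_zero] at hlt; linarith
  set s : ℝ := 1 / (2 * r) with hs
  have hs1 : |s| ≤ 1 := by
    rw [hs, abs_div, abs_one, abs_mul, abs_two, div_le_one (by positivity)]
    linarith
  have h1 := h ((s : ℂ) • f) (by
    rw [norm_toL2_smul, norm_real]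
    exact (mul_le_of_le_one_left (norm_nonneg _) hs1).trans hf)
  have h2 : gaugeChar T ((s : ℂ) • f) = -1 := by
    rw [gaugeChar, bracket_smul, conj_ofReal, Complex.re_ofReal_mul, ← Complex.exp_pi_mul_I]
    congr 1
    change 2 * (Real.pi : ℂ) * I * ((s * r : ℝ) : ℂ) = _
    rw [show s * r = 1 / 2 by rw [hs]; field_simp]
    push_cast
    ring
  rw [h2] at h1
  norm_num at h1

/-! ### Averages of the phases -/

theorem sum_range_two_pow (z : ℂ) (k : ℕ) :
    ∑ j ∈ Finset.range (2 ^ k), z ^ j = ∏ l ∈ Finset.range k, (1 + z ^ 2 ^ l) := by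
  induction k with
  | zero => simp
  | succ k ih =>
    rw [Finset.prod_range_succ, ← ih, pow_succ, mul_two, Finset.sum_range_add]
    simp only [pow_add]
    rw [← Finset.mul_sum]
    ring

theorem norm_one_add_exp_le (y : ℝ) : ‖1 + Complex.exp (I * y)‖ = 2 * |Real.cos (y / 2)| := by
  have : 1 + Complex.exp (I * y) =
      Complex.exp (((y / 2 : ℝ) : ℂ) * I) * (2 * Real.cos (y / 2) : ℝ) := by
    push_cast
    rw [Complex.two_cos, mul_add, ← Complex.exp_add, ← Complex.exp_add, add_comm]
    congr 1
    · congr 1; ring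
    · rw [show (y : ℂ) / 2 * I + -((y : ℂ) / 2) * I = 0 by ring, Complex.exp_zero]
  rw [this, norm_mul, Complex.norm_exp_ofReal_mul_I, one_mul, norm_real, Real.norm_eq_abs, abs_mul,
    abs_two]

/-- The averages `2⁻ᵏ ∑_{j < 2ᵏ} e^{-ijx/2ᵏ}` stay away from `1`, uniformly for `x ≥ a` and large
`k`. They are products of factors of modulus `|cos(x/2^{j+1})|`, `1 ≤ j ≤ k`, and for the first
`j` with `x/2ʲ ≤ π` the argument is neither small nor large. -/
theorem exists_norm_average_le {a : ℝ} (ha : 0 < a) : ∃ c < 1, ∀ M : ℝ, ∃ k : ℕ, ∀ x : ℝ, a ≤ x →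
    x ≤ M → ‖((2 : ℂ) ^ k)⁻¹ * ∑ j ∈ Finset.range (2 ^ k),
      Complex.exp (I * ((-(j * (1 / 2 ^ k)) * x : ℝ) : ℂ))‖ ≤ c := by
  set y₀ : ℝ := min (a / 2) (Real.pi / 2) with hy₀
  have hy₀pos : 0 < y₀ := lt_min (by positivity) (by positivity)
  have hy₀pi : y₀ ≤ Real.pi / 2 := min_le_right _ _
  refine ⟨Real.cos (y₀ / 2), ?_, fun M => ?_⟩
  · rw [← Real.cos_zero]
    exact Real.cos_lt_cos_of_nonneg_of_le_pi_div_two le_rfl (by linarith) (by linarith)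
  obtain ⟨k₀, hk₀⟩ := pow_unbounded_of_one_lt (M / Real.pi) (one_lt_two (α := ℝ))
  refine ⟨k₀ + 1, fun x hax hxM => ?_⟩
  set k := k₀ + 1
  have hk : x / 2 ^ k ≤ Real.pi := by
    rw [div_le_iff₀ (by positivity)]
    rw [div_lt_iff₀ Real.pi_pos] at hk₀
    have : (2 : ℝ) ^ k = 2 ^ k₀ * 2 := pow_succ _ _
    rw [this]
    nlinarith [Real.pi_pos, pow_pos (two_pos (α := ℝ)) k₀]
  have hex : ∃ j : ℕ, x / 2 ^ (j + 1) ≤ Real.pi := ⟨k₀, hk⟩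
  classical
  set j := Nat.find hex with hj
  have hj1 : x / 2 ^ (j + 1) ≤ Real.pi := Nat.find_spec hex
  have hjk : j ≤ k₀ := Nat.find_min' hex hk
  have hj2 : y₀ ≤ x / 2 ^ (j + 1) := by
    rcases Nat.eq_zero_or_pos j with h0 | h0
    · rw [h0]
      refine (min_le_left _ _).trans ?_
      norm_num
      linarith
    · have h1 := Nat.find_min hex (m := j - 1) (by omega)
      rw [Nat.sub_add_cancel h0, not_le] at h1
      refine (min_le_right _ _).trans ?_
      rw [pow_succ, ← div_div]
      linarith
  set z : ℂ := Complex.exp (I * ((-(x / 2 ^ k) : ℝ) : ℂ)) with hz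
  have hsum : ∑ j ∈ Finset.range (2 ^ k), Complex.exp (I * ((-(j * (1 / 2 ^ k)) * x : ℝ) : ℂ)) =
      ∏ l ∈ Finset.range k, (1 + z ^ 2 ^ l) := by
    rw [← sum_range_two_pow]
    refine Finset.sum_congr rfl fun i _ => ?_
    rw [hz, ← Complex.exp_nat_mul]
    congr 1
    push_cast
    ring
  have hfac : ∀ l, ‖(1 + z ^ 2 ^ l) / 2‖ = |Real.cos (x / 2 ^ k * 2 ^ l / 2)| := by
    intro l
    have : z ^ 2 ^ l = Complex.exp (I * ((-(x / 2 ^ k * 2 ^ l) : ℝ) : ℂ)) := by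
      rw [hz, ← Complex.exp_nat_mul]
      congr 1
      push_cast
      ring
    rw [norm_div, this, norm_one_add_exp_le, neg_div, Real.cos_neg]
    norm_num
  have hprod : ((2 : ℂ) ^ k)⁻¹ * ∏ l ∈ Finset.range k, (1 + z ^ 2 ^ l) =
      ∏ l ∈ Finset.range k, (1 + z ^ 2 ^ l) / 2 := by
    rw [Finset.prod_div_distrib, Finset.prod_const, Finset.card_range, div_eq_inv_mul]
  rw [hsum, hprod, norm_prod]
  have hmem : k₀ - j ∈ Finset.range k := Finset.mem_range.mpr (by omega)
  rw [← Finset.mul_prod_erase _ _ hmem]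
  have h1 : ∏ l ∈ (Finset.range k).erase (k₀ - j), ‖(1 + z ^ 2 ^ l) / 2‖ ≤ 1 :=
    Finset.prod_le_one (fun _ _ => norm_nonneg _) fun l _ => by
      rw [hfac]; exact Real.abs_cos_le_one _
  have h2 : ‖(1 + z ^ 2 ^ (k₀ - j)) / 2‖ ≤ Real.cos (y₀ / 2) := by
    have h3 : x / 2 ^ k * 2 ^ (k₀ - j) = x / 2 ^ (j + 1) := by
      have : (2 : ℝ) ^ k = 2 ^ (j + 1) * 2 ^ (k₀ - j) := by
        rw [← pow_add]; congr 1; omega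
      rw [this]
      field_simp
    rw [hfac, h3, abs_of_nonneg (Real.cos_nonneg_of_neg_pi_div_two_le_of_le (by linarith)
      (by linarith))]
    exact Real.cos_le_cos_of_nonneg_of_le_pi (by linarith) (by linarith) (by linarith)
  calc _ ≤ ‖(1 + z ^ 2 ^ (k₀ - j)) / 2‖ * 1 := by gcongr
    _ ≤ _ := by rw [mul_one]; exact h2

/-- Division of a test function by a smooth function without zeros on its support. -/
theorem exists_mulTest_eq (D : E d → ℂ) (hD : ContDiff ℝ ∞ D) (f : Test d) {ε : ℝ} (hε : 0 < ε)
    (h : ∀ k ∈ tsupport f, ε ≤ ‖D k‖) :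
    ∃ g : Test d, mulTest D hD g = f ∧ ‖toL2 g‖ ≤ ε⁻¹ * ‖toL2 f‖ := by
  have hne : ∀ k ∈ tsupport f, D k ≠ 0 := fun k hk =>
    norm_pos_iff.mp (hε.trans_le (h k hk))
  let g : Test d :=
    { toFun := fun k => (D k)⁻¹ * f k
      contDiff' := by
        rw [contDiff_iff_contDiffAt]
        intro k
        by_cases hk : k ∈ tsupport f
        · exact (hD.contDiffAt.inv (hne k hk)).mul f.contDiff.contDiffAt
        · have h0 := notMem_tsupport_iff_eventuallyEq.mp hk
          refine (contDiffAt_const (c := (0 : ℂ))).congr_of_eventuallyEq ?_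
          filter_upwards [h0] with x hx
          rw [hx, Pi.zero_apply, mul_zero]
      hasCompactSupport' := f.hasCompactSupport.mul_left
      tsupport_subset' := by simp }
  refine ⟨g, ?_, ?_⟩
  · ext k
    change D k * ((D k)⁻¹ * f k) = f k
    by_cases hk : f k = 0
    · rw [hk, mul_zero, mul_zero]
    · rw [mul_inv_cancel_left₀ (hne k (subset_tsupport _ hk))]
  · refine Lp.norm_le_mul_norm_of_ae_le_mul ?_
    filter_upwards [g.memLp.coeFn_toLp, f.memLp.coeFn_toLp] with k h1 h2
    have h1' : toL2 g k = (D k)⁻¹ * f k := h1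
    have h2' : toL2 f k = f k := h2
    rw [h1', h2', norm_mul, norm_inv]
    by_cases hk : f k = 0
    · rw [hk, norm_zero, mul_zero, mul_zero]
    · gcongr
      exact h k (subset_tsupport _ hk)

/-- If `(e^{-itϖ} - 1)v/ϖ` is bounded in `L²`, uniformly for small `t`, then `v/ϖ` is square
integrable. Averaging over `t` yields a bound for `(s - 1)v/ϖ`, with `s` an average of the phases
`e^{-itϖ}`, and `s - 1` is bounded away from `0` because `ϖ` is. The average is a finite one,
which depends on the support of the test function. -/
theorem memL2_quot_of_drift_bound (w : Dispersion d) (v : Dist d) {C T : ℝ} (hT : 0 < T)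
    (h : ∀ t, 0 ≤ t → t ≤ T → ∀ f, ‖w.drift t v f‖ ≤ C * ‖toL2 f‖) : MemL2 (w.quot v) := by
  obtain ⟨μ, hμ, hw⟩ := w.massive
  obtain ⟨c, hc, hav⟩ := exists_norm_average_le (mul_pos hT hμ)
  refine memL2_of_norm_le (C := |C| * (1 - c)⁻¹) fun f => ?_
  obtain ⟨M, hM⟩ := f.hasCompactSupport.isCompact.bddAbove_image (f := fun k => T * w.toFun k)
    (continuous_const.mul w.smooth.continuous).continuousOn
  obtain ⟨k, hk⟩ := hav M
  let t : ℕ → ℝ := fun j => T * (j * (1 / 2 ^ k))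
  let D : E d → ℂ := fun x => ((2 : ℂ) ^ k)⁻¹ * ∑ j ∈ Finset.range (2 ^ k), w.phase (-t j) x - 1
  have hD : ContDiff ℝ ∞ D :=
    (contDiff_const.mul (ContDiff.sum fun j _ => w.phase_smooth (-t j))).sub contDiff_const
  have hDlow : ∀ x ∈ tsupport f, 1 - c ≤ ‖D x‖ := by
    intro x hx
    have h1 := hk (T * w.toFun x) (mul_le_mul_of_nonneg_left (hw x) hT.le)
      (hM ⟨x, hx, rfl⟩)
    have h2 : ∀ j : ℕ, Complex.exp (I * ((-(j * (1 / 2 ^ k)) * (T * w.toFun x) : ℝ) : ℂ)) =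
        w.phase (-t j) x := fun j => by
      rw [Dispersion.phase]
      congr 1
      simp only [t]
      push_cast
      ring
    simp only [h2] at h1
    have h3 := norm_sub_norm_le (1 : ℂ)
      (((2 : ℂ) ^ k)⁻¹ * ∑ j ∈ Finset.range (2 ^ k), w.phase (-t j) x)
    rw [norm_one, norm_sub_rev] at h3
    exact (by linarith : 1 - c ≤ 1 - ‖((2 : ℂ) ^ k)⁻¹ *
      ∑ j ∈ Finset.range (2 ^ k), w.phase (-t j) x‖).trans h3
  obtain ⟨g, hg, hgn⟩ := exists_mulTest_eq D hD f (sub_pos.mpr hc) hDlow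
  have hq : w.quot v f = ((2 : ℂ) ^ k)⁻¹ * ∑ j ∈ Finset.range (2 ^ k), w.drift (t j) v g := by
    have h1 : ∀ j, w.drift (t j) v g = w.quot v (mulTest (fun x => w.phase (-t j) x - 1)
        ((w.phase_smooth (-t j)).sub contDiff_const) g) := fun j => rfl
    simp only [h1]
    rw [← map_sum, ← smul_eq_mul, ← map_smul, ← hg]
    congr 1
    ext x
    have h2 : ∀ (s : Finset ℕ) (F : ℕ → Test d), (∑ j ∈ s, F j : Test d) x = ∑ j ∈ s, F j x := by
      intro s F
      induction s using Finset.cons_induction with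
      | empty => rfl
      | cons a s ha ih => rw [Finset.sum_cons, Finset.sum_cons, ← ih]; rfl
    change D x * g x = ((2 : ℂ) ^ k)⁻¹ * (∑ j ∈ Finset.range (2 ^ k), _ : Test d) x
    rw [h2]
    change D x * g x = ((2 : ℂ) ^ k)⁻¹ * ∑ j ∈ Finset.range (2 ^ k), (w.phase (-t j) x - 1) * g x
    rw [← Finset.sum_mul, Finset.sum_sub_distrib, Finset.sum_const, Finset.card_range, nsmul_one,
      ← mul_assoc, mul_sub]
    push_cast
    rw [inv_mul_cancel₀ (by positivity)]
  have ht : ∀ j ∈ Finset.range (2 ^ k), ‖w.drift (t j) v g‖ ≤ |C| * ‖toL2 g‖ := by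
    intro j hj
    refine (h (t j) (by positivity) ?_ g).trans (by gcongr; exact le_abs_self C)
    refine mul_le_of_le_one_right hT.le ?_
    rw [mul_one_div, div_le_one (by positivity)]
    exact_mod_cast (Finset.mem_range.mp hj).le
  calc ‖w.quot v f‖ ≤ ((2 : ℝ) ^ k)⁻¹ * ∑ j ∈ Finset.range (2 ^ k), ‖w.drift (t j) v g‖ := by
        rw [hq, norm_mul, norm_inv, norm_pow, Complex.norm_ofNat]
        gcongr
        exact norm_sum_le _ _
    _ ≤ ((2 : ℝ) ^ k)⁻¹ * ∑ j ∈ Finset.range (2 ^ k), |C| * ‖toL2 g‖ := by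
        gcongr with j hj
        exact ht j hj
    _ = |C| * ‖toL2 g‖ := by
        rw [Finset.sum_const, Finset.card_range, nsmul_eq_mul]
        push_cast
        rw [inv_mul_cancel_left₀ (by positivity)]
    _ ≤ |C| * ((1 - c)⁻¹ * ‖toL2 f‖) := by gcongr
    _ = _ := by ring

end Criterion

/-! ### The undressed Hamiltonian and normality -/

section Undressed

variable {d : ℕ} {w : Dispersion d} {v : Dist d} {τ : ℝ → CCR d ≃⋆ₐ[ℂ] CCR d}
  {πF : CCR d →⋆ₐ[ℂ] (Fock d →L[ℂ] Fock d)} {ρ ρF : CCR d →ₚ[ℂ] ℂ}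

theorem bracket_eq_inner {T : Test d →ₗ[ℂ] ℂ} {g : L2 d} (hg : IsRepresentedBy T g) (f : Test d) :
    bracket f T = inner ℂ (toL2 f) g := by
  rw [bracket, hg, inner_eq_integral]
  refine integral_congr_ae ?_
  filter_upwards [f.memLp.coeFn_toLp] with k h1
  have h1' : toL2 f k = f k := h1
  rw [h1', mul_comm]
  rfl

theorem exp_im_inner_weylVector {T : Test d →ₗ[ℂ] ℂ} {g : L2 d} (hg : IsRepresentedBy T g)
    (f : Test d) :
    Complex.exp (-(2 * I * ((inner ℂ g (weylVector f) : ℂ).im : ℝ))) = gaugeChar (-T) f := by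
  have h1 : bracket f (-T) = -bracket f T := rfl
  have h2 : ∀ z : ℂ, (I * Real.pi * conj z).im = Real.pi * z.re := fun z => by
    rw [mul_assoc, Complex.I_mul_im, Complex.re_ofReal_mul, Complex.conj_re]
  rw [gaugeChar, h1, bracket_eq_inner hg, weylVector, inner_smul_right, ← inner_conj_symm, h2,
    Complex.neg_re]
  congr 1
  push_cast
  ring

theorem exp_im_inner_neg_weylVector_mul {T : Test d →ₗ[ℂ] ℂ} {g : L2 d} (hg : IsRepresentedBy T g)
    (f : Test d) : Complex.exp (-(2 * I * ((inner ℂ (-g) (weylVector f) : ℂ).im : ℝ))) *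
      gaugeChar (-T) f = 1 := by
  rw [← exp_im_inner_weylVector hg, ← Complex.exp_add, inner_neg_left, Complex.neg_im]
  push_cast
  ring_nf
  exact Complex.exp_zero

/-- If `v/ϖ = g` is square integrable, then the unitary group `D Γ(e^{itϖ}) D*`, with `D` the
dressing transformation, implements the dynamics. -/
theorem exists_undressed (hτ : IsVHMDynamics w v τ) (hπ : IsFockRep πF) {g : L2 d}
    (hg : IsRepresentedBy (w.quot v) g) : ∃ H : Fock d →ₗ.[ℂ] Fock d,
      IsHamiltonianIn πF τ H ∧ IsConj (fockWeyl (-g)) (dGamma w) H := by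
  obtain ⟨H, hU, hsa, hconj⟩ := w.isExpOf_dGamma.exists_conj (fockWeyl (-g))
  refine ⟨H, ⟨hsa, _, hU, fun t => implements_of_weyl fun f ψ => ?_⟩, hconj⟩
  have hτ' : τ t (weyl f) = gaugeChar (w.drift t v) f • weyl (w.phaseTest t f) := hτ.weyl t f
  simp only [LinearIsometryEquiv.trans_apply]
  rw [hτ', map_smul, smul_apply, hπ.apply, hπ.apply, fockWeyl_symm, fockWeyl_symm, neg_neg,
    fockWeyl_comm g (weylVector f), map_smul, map_smul, w.secondQuant_fockWeyl t (weylVector f),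
    w.phaseMul_weylVector, fockWeyl_comm (-g) (weylVector _), exp_im_inner_weylVector hg,
    smul_smul]
  congr 1
  rw [← w.gaugeChar_drift_mul v t f, mul_assoc, mul_comm (gaugeChar (-(w.quot v)) _),
    exp_im_inner_neg_weylVector_mul hg, mul_one]

/-- If a strongly continuous unitary group implements the dynamics on Fock space, then the
characters `e^{2πi Re⟨f, (e^{-itϖ} - 1)v/ϖ⟩}` are close to `1` for small `f`, uniformly for small
`t`, since they relate vectors close to the vacuum. -/
theorem memL2_of_isHamiltonianIn (hτ : IsVHMDynamics w v τ) (hπ : IsFockRep πF)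
    {H : Fock d →ₗ.[ℂ] Fock d} (hH : IsHamiltonianIn πF τ H) : MemL2 (w.quot v) := by
  obtain ⟨-, U, hU, hUτ⟩ := hH
  obtain ⟨δ, hδ, hδW⟩ := Metric.tendsto_nhds_nhds.mp (tendsto_fockWeyl_zero (vacuum d)) (1 / 4)
    (by norm_num)
  have hcont : Filter.Tendsto (fun t => U (-t) (vacuum d)) (nhds 0) (nhds (vacuum d)) := by
    have := ((hU.continuous (vacuum d)).comp continuous_neg).tendsto 0
    rwa [Function.comp_apply, neg_zero, hU.zero_apply] at this
  obtain ⟨T, hT, hTU⟩ := Metric.tendsto_nhds_nhds.mp hcont (1 / 8) (by norm_num)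
  have hpi := Real.pi_pos
  have key : ∀ t, 0 ≤ t → t ≤ T / 2 → ∀ f : Test d, ‖toL2 f‖ ≤ δ / (2 * Real.pi) →
      ‖gaugeChar (w.drift t v) f - 1‖ ≤ 1 := by
    intro t ht0 htT f hf
    set u := weylVector f
    have hu : ‖u‖ < δ := by
      rw [norm_weylVector]
      calc Real.pi * ‖toL2 f‖ ≤ Real.pi * (δ / (2 * Real.pi)) := by gcongr
        _ = δ / 2 := by field_simp
        _ < δ := by linarith
    have h1 : ‖fockWeyl u (vacuum d) - vacuum d‖ < 1 / 4 := by
      rw [← dist_eq_norm]; exact hδW (by rwa [dist_zero_right])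
    have h2 : ‖fockWeyl (w.phaseMul t u) (vacuum d) - vacuum d‖ < 1 / 4 := by
      rw [← dist_eq_norm]
      exact hδW (by rwa [dist_zero_right, LinearIsometry.norm_map])
    have h3 : ‖U (-t) (vacuum d) - vacuum d‖ < 1 / 8 := by
      rw [← dist_eq_norm]
      refine hTU ?_
      rw [dist_zero_right, Real.norm_of_nonneg ht0]
      linarith
    set c := gaugeChar (w.drift t v) f
    have hτ' : τ t (weyl f) = c • weyl (w.phaseTest t f) := hτ.weyl t f
    have h4 : c • fockWeyl (w.phaseMul t u) (vacuum d) =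
        U t (fockWeyl u (U (-t) (vacuum d))) := by
      have := hUτ t (weyl f) (vacuum d)
      rwa [hτ', map_smul, smul_apply, hπ.apply, hπ.apply, hU.symm_apply,
        ← w.phaseMul_weylVector] at this
    have h5 : ‖c • fockWeyl (w.phaseMul t u) (vacuum d) - vacuum d‖ ≤ 1 / 2 := by
      have e1 : c • fockWeyl (w.phaseMul t u) (vacuum d) - vacuum d =
          U t (fockWeyl u (U (-t) (vacuum d) - vacuum d) + (fockWeyl u (vacuum d) - vacuum d) -
            (U (-t) (vacuum d) - vacuum d)) := by
        have e2 : U t (U (-t) (vacuum d)) = vacuum d := by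
          rw [← hU.add, add_neg_cancel, hU.zero_apply]
        rw [h4]
        simp only [map_sub, map_add, e2]
        abel
      rw [e1, LinearIsometryEquiv.norm_map]
      calc _ ≤ ‖fockWeyl u (U (-t) (vacuum d) - vacuum d)‖ + ‖fockWeyl u (vacuum d) - vacuum d‖ +
            ‖U (-t) (vacuum d) - vacuum d‖ :=
            (norm_sub_le _ _).trans (by gcongr; exact norm_add_le _ _)
        _ ≤ 1 / 2 := by rw [LinearIsometryEquiv.norm_map]; linarith
    have h6 : (c - 1) • vacuum d = (c • fockWeyl (w.phaseMul t u) (vacuum d) - vacuum d) -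
        c • (fockWeyl (w.phaseMul t u) (vacuum d) - vacuum d) := by
      rw [smul_sub, sub_smul, one_smul]
      abel
    calc ‖c - 1‖ = ‖(c - 1) • vacuum d‖ := by rw [norm_smul, norm_vacuum, mul_one]
      _ ≤ ‖c • fockWeyl (w.phaseMul t u) (vacuum d) - vacuum d‖ +
          ‖c • (fockWeyl (w.phaseMul t u) (vacuum d) - vacuum d)‖ := by
          rw [h6]; exact norm_sub_le _ _
      _ ≤ 1 := by
          rw [norm_smul, norm_gaugeChar, one_mul]
          linarith
  refine memL2_quot_of_drift_bound w v (T := T / 2) (C := 2 / (δ / (2 * Real.pi)))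
    (by positivity) fun t ht0 htT f => ?_
  exact norm_le_of_abs_re_bracket_le (by positivity)
    (abs_re_bracket_le_of_gaugeChar (key t ht0 htT)) f

theorem exists_vacuum_gns_unitary (hπ : IsFockRep πF) (hρF : IsFockVacuumState πF ρF) :
    ∃ V : ρF.GNS ≃ₗᵢ[ℂ] Fock d, ∀ a ψ, V (ρF.gnsStarAlgHom a ψ) = πF a (V ψ) := by
  obtain ⟨V, -, hV⟩ := exists_gns_unitary (dense_span_gauged_fockRep (T := 0) (π := πF)
    fun f ψ => by rw [hπ.apply, gaugeChar_zero, one_smul]) hρF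
  exact ⟨V, hV⟩

/-- A state that is normal with respect to the vacuum has characteristic function
`f ↦ ω(W(f))` continuous in the `L²` norm. -/
theorem memL2_of_isNormalWrt (hπ : IsFockRep πF) (hρ : IsOmegaInfty w v ρ)
    (hρF : IsFockVacuumState πF ρF) (h : IsNormalWrt ρ ρF) : MemL2 (w.quot v) := by
  obtain ⟨ψ, hψ, hsum⟩ := h
  obtain ⟨V, hV⟩ := exists_vacuum_gns_unitary hπ hρF
  let F : L2 d → ℂ := fun u => ∑' n, inner ℂ (V (ψ n)) (fockWeyl u (V (ψ n)))
  have hF : ∀ f, F (weylVector f) = ρ (weyl f) := fun f => by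
    rw [← (hsum (weyl f)).tsum_eq]
    refine tsum_congr fun n => ?_
    rw [← hπ.apply, ← hV, LinearIsometryEquiv.inner_map_map]
  have hF0 : Filter.Tendsto F (nhds 0) (nhds (F 0)) := by
    refine tendsto_tsum_of_dominated_convergence hψ (fun n => ?_)
      (Filter.Eventually.of_forall fun u n => ?_)
    · rw [fockWeyl_zero]
      exact tendsto_const_nhds.inner (tendsto_fockWeyl_zero (V (ψ n)))
    · refine (norm_inner_le_norm _ _).trans (le_of_eq ?_)
      rw [LinearIsometryEquiv.norm_map (fockWeyl u), V.norm_map, sq]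
  have hF1 : F 0 = 1 := by
    have := hF 0
    rw [weyl_zero, hρ.map_one] at this
    rwa [weylVector, map_zero, smul_zero] at this
  have hG : Filter.Tendsto (fun u : L2 d => Complex.exp ((‖u‖ ^ 2 / 2 : ℝ)) * F u) (nhds 0)
      (nhds 1) := by
    have h1 : Continuous fun u : L2 d => Complex.exp ((‖u‖ ^ 2 / 2 : ℝ)) := by fun_prop
    have h2 := (h1.tendsto 0).mul hF0
    simpa [hF1] using h2
  have hGχ : ∀ f : Test d, Complex.exp ((‖weylVector f‖ ^ 2 / 2 : ℝ)) * F (weylVector f) =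
      gaugeChar (-(w.quot v)) f := fun f => by
    rw [hF, hρ.weyl, ← mul_assoc, ← Complex.exp_add, norm_weylVector, gaugeChar]
    have : (((Real.pi * ‖toL2 f‖) ^ 2 / 2 : ℝ) : ℂ) + -((Real.pi ^ 2 / 2 * ‖toL2 f‖ ^ 2 : ℝ) : ℂ) =
        0 := by push_cast; ring
    rw [this, Complex.exp_zero, one_mul]
  obtain ⟨δ, hδ, hδG⟩ := Metric.tendsto_nhds_nhds.mp hG 1 one_pos
  have hpi := Real.pi_pos
  have key : ∀ f : Test d, ‖toL2 f‖ ≤ δ / (2 * Real.pi) →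
      ‖gaugeChar (-(w.quot v)) f - 1‖ ≤ 1 := by
    intro f hf
    rw [← hGχ, ← dist_eq_norm]
    refine (hδG ?_).le
    rw [dist_zero_right, norm_weylVector]
    calc Real.pi * ‖toL2 f‖ ≤ Real.pi * (δ / (2 * Real.pi)) := by gcongr
      _ = δ / 2 := by field_simp
      _ < δ := by linarith
  refine memL2_of_norm_le (C := 2 / (δ / (2 * Real.pi))) fun f => ?_
  have := norm_le_of_abs_re_bracket_le (by positivity) (abs_re_bracket_le_of_gaugeChar key) f
  rwa [LinearMap.neg_apply, norm_neg] at this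

/-- If `v/ϖ = g` is square integrable, then `ω_∞` is the vector state of the coherent vector
`e^{a(g) - a*(g)}Ω`. -/
theorem isNormalWrt_of_memL2 (hπ : IsFockRep πF) (hρ : IsOmegaInfty w v ρ)
    (hρF : IsFockVacuumState πF ρF) (h : MemL2 (w.quot v)) : IsNormalWrt ρ ρF := by
  obtain ⟨g, hg⟩ := h
  obtain ⟨V, hV⟩ := exists_vacuum_gns_unitary hπ hρF
  set ξ := fockWeyl (-g) (vacuum d) with hξ
  have hvec : ∀ a, ρ a = inner ℂ ξ (πF a ξ) := state_ext (ρ' := vectorState πF ξ) fun f => by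
    rw [vectorState_apply, hπ.apply, hξ, fockWeyl_comm (weylVector f), inner_smul_right,
      LinearIsometryEquiv.inner_map_map, inner_vacuum_fockWeyl, norm_weylVector, hρ.weyl,
      inner_neg_right, ← inner_conj_symm, Complex.neg_im, Complex.conj_im, neg_neg,
      exp_im_inner_weylVector hg, mul_comm, gaugeChar]
    congr 3
    push_cast
    ring
  refine ⟨Pi.single 0 (V.symm ξ), ?_, fun a => ?_⟩
  · exact summable_of_ne_finset_zero (s := {0}) fun n hn => by
      simp [Pi.single_eq_of_ne (Finset.notMem_singleton.mp hn)]
  · have h1 : inner ℂ (V.symm ξ) (ρF.gnsStarAlgHom a (V.symm ξ)) = ρ a := by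
      rw [← V.inner_map_map, hV, LinearIsometryEquiv.apply_symm_apply, hvec]
    have h2 := hasSum_single (f := fun n => (inner ℂ ((Pi.single 0 (V.symm ξ) : ℕ → ρF.GNS) n)
      (ρF.gnsStarAlgHom a ((Pi.single 0 (V.symm ξ) : ℕ → ρF.GNS) n)) : ℂ)) 0 fun n hn => by
        rw [Pi.single_eq_of_ne hn, inner_zero_left]
    rwa [Pi.single_eq_same, h1] at h2

end Undressed

end VanHove

end

theorem mainTheorem8 (d : ℕ) (w : VanHove.Dispersion d) (v : VanHove.Dist d) :
    -- the dynamical map `τ`, the Fock representation `π_F`, the state `ω_∞` and the Fock vacuum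
    -- state `ω_F` exist and are unique
    (∃! τ : ℝ → VanHove.CCR d ≃⋆ₐ[ℂ] VanHove.CCR d, VanHove.IsVHMDynamics w v τ) ∧
    (∃! πF : VanHove.CCR d →⋆ₐ[ℂ] (VanHove.Fock d →L[ℂ] VanHove.Fock d),
      VanHove.IsFockRep πF) ∧
    (∃! ρ : VanHove.CCR d →ₚ[ℂ] ℂ, VanHove.IsOmegaInfty w v ρ) ∧
    (∀ πF : VanHove.CCR d →⋆ₐ[ℂ] (VanHove.Fock d →L[ℂ] VanHove.Fock d),
      VanHove.IsFockRep πF →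
        ∃! ρF : VanHove.CCR d →ₚ[ℂ] ℂ, VanHove.IsFockVacuumState πF ρF) ∧
    ∀ (τ : ℝ → VanHove.CCR d ≃⋆ₐ[ℂ] VanHove.CCR d)
      (πF : VanHove.CCR d →⋆ₐ[ℂ] (VanHove.Fock d →L[ℂ] VanHove.Fock d))
      (ρ ρF : VanHove.CCR d →ₚ[ℂ] ℂ),
      VanHove.IsVHMDynamics w v τ → VanHove.IsFockRep πF →
      VanHove.IsOmegaInfty w v ρ → VanHove.IsFockVacuumState πF ρF →
      -- the Hamiltonian in the GNS representation of `ω_∞` is `dΓ(ϖ)`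
      (∃ V : ρ.GNS ≃ₗᵢ[ℂ] VanHove.Fock d,
        V (VanHove.gnsVector ρ) = VanHove.vacuum d ∧
        (∀ (f : VanHove.Test d) (ψ : ρ.GNS),
          V (ρ.gnsStarAlgHom (VanHove.weyl f) ψ) =
            Complex.exp (2 * Real.pi * Complex.I *
              ((VanHove.bracket f (-(w.quot v))).re : ℂ)) • πF (VanHove.weyl f) (V ψ)) ∧
        (∃ H : ρ.GNS →ₗ.[ℂ] ρ.GNS, VanHove.IsGNSHamiltonian τ ρ H ∧
          (∀ H', VanHove.IsGNSHamiltonian τ ρ H' → H' = H) ∧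
          VanHove.IsConj V H (VanHove.dGamma w))) ∧
      -- the undressed Hamiltonian exists in Fock space if and only if `v/ϖ ∈ L²`
      ((∃ H : VanHove.Fock d →ₗ.[ℂ] VanHove.Fock d, VanHove.IsHamiltonianIn πF τ H) ↔
        VanHove.MemL2 (w.quot v)) ∧
      -- in which case it is `D dΓ(ϖ) D*` with the dressing unitary `D = e^{a(v/ϖ) - a*(v/ϖ)}`
      (∀ g : VanHove.L2 d, VanHove.IsRepresentedBy (w.quot v) g →
        ∃ D : VanHove.Fock d ≃ₗᵢ[ℂ] VanHove.Fock d,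
          (∀ h : VanHove.L2 d, D (VanHove.expVector h) =
            Complex.exp (-(‖g‖ ^ 2 / 2 : ℝ) + inner ℂ g h) • VanHove.expVector (h - g)) ∧
          ∃ H : VanHove.Fock d →ₗ.[ℂ] VanHove.Fock d,
            VanHove.IsHamiltonianIn πF τ H ∧ VanHove.IsConj D (VanHove.dGamma w) H) ∧
      -- `v/ϖ ∈ L²` if and only if `ω_∞` is normal with respect to the Fock vacuum
      (VanHove.MemL2 (w.quot v) ↔ VanHove.IsNormalWrt ρ ρF) := by
  refine ⟨?_, ?_, ?_, ?_, ?_⟩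
  · obtain ⟨τ, hτ⟩ := VanHove.exists_isVHMDynamics w v
    exact ⟨τ, hτ, fun τ' hτ' => hτ'.unique hτ⟩
  · obtain ⟨πF, hπ⟩ := VanHove.exists_isFockRep d
    exact ⟨πF, hπ, fun π' hπ' => hπ'.unique hπ⟩
  · obtain ⟨π, hπ⟩ := VanHove.exists_gauged_fockRep (-(w.quot v))
    have hρ := VanHove.isOmegaInfty_vectorState (v := v) (w := w) hπ
    exact ⟨_, hρ, fun ρ' hρ' => PositiveLinearMap.ext (hρ'.unique hρ)⟩
  · intro πF hπ
    exact ⟨VanHove.vectorState πF (VanHove.vacuum d), fun _ => rfl,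
      fun ρ' hρ' => PositiveLinearMap.ext hρ'⟩
  · intro τ πF ρ ρF hτ hπ hρ hρF
    refine ⟨?_, ⟨?_, ?_⟩, fun g hg => ?_, VanHove.isNormalWrt_of_memL2 hπ hρ hρF,
      VanHove.memL2_of_isNormalWrt hπ hρ hρF⟩
    · obtain ⟨V, hV1, hV2⟩ := hρ.exists_unitary
      obtain ⟨H, hH, hconj⟩ := VanHove.exists_gnsHamiltonian hτ hV1 hV2
      refine ⟨V, hV1, fun f ψ => ?_, H, hH, fun H' hH' => hH'.unique hH, hconj⟩
      rw [hV2, hπ.apply, VanHove.gaugeChar]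
    · rintro ⟨H, hH⟩
      exact VanHove.memL2_of_isHamiltonianIn hτ hπ hH
    · rintro ⟨g, hg⟩
      obtain ⟨H, hH, -⟩ := VanHove.exists_undressed hτ hπ hg
      exact ⟨H, hH⟩
    · refine ⟨VanHove.fockWeyl (-g), fun h => ?_, VanHove.exists_undressed hτ hπ hg⟩
      rw [VanHove.fockWeyl_expVector, norm_neg, inner_neg_left, sub_eq_add_neg h g]
      simp
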